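/- **Setting.** Let $D=\{z_1,\dots,z_n\}$ be a training set with $n=kb$, $k\ge 1$, $b\ge 2$; let $L(\vartheta,z)\in\mathbb R$, $\vartheta\in\mathbb R^d$, be the loss at $z$, let $L(\vartheta,B)=\frac1{|B|}\sum_{z\in B}L(\vartheta,z)$, and write $L$ for $L(\cdot,D)$. One epoch of SGD without replacement with learning rate $\eta>0$ from $\theta$ lists $D$ in a uniformly random order, cuts the list into $k$ consecutive batches $B_1,\dots,B_k$ of size $b$, and makes the steps $\theta_t=\theta_{t-1}-\eta\nabla L(\theta_{t-1},B_t)$, $\theta_0=\theta$. It is compared with $k$ steps, with the same $\eta$ and $\theta$, of any of: GD (every batch is $D$); SGD with replacement with $k$ independent, uniformly random batches of $b$ distinct points; SGD with replacement with $k$ independent batches of $b$ independent uniform points. Let $(e_i)$ be an orthonormal basis of eigenvectors of the full-batch Hessian $\nabla^2L(\theta)$, with eigenvalues $\lambda_i$; $\frac{d}{d\theta_i}$ is the derivative at $\theta$ in direction $e_i$, and matrices are written in the basis $(e_i)$. Let $c=\eta k$, $$H=\frac{c^2}{2n}\Big(\mathbb E_{z\in D}\big[(\nabla^2L(\theta,z))^2\big]-(\nabla^2L(\theta))^2\Big),$$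 let $\mathrm{Cov}_{z\in D}(\nabla L(\vartheta,z))$ be the empirical covariance matrix of the sample gradients, and let $S_i$ be the diagonal matrix (not depending on $\vartheta$) $$(S_i)_{jj}=\frac{\eta}{2k}\sum_{h=0}^{k+2}(-\eta\lambda_i)^h\sum_{l=h+2}^{k}\binom kl(-\eta\lambda_j)^{l-h-2},\qquad D_i=\frac{d}{d\theta_i}\,\mathrm{trace}\big(S_i\cdot \mathrm{Cov}_{z\in D}(\nabla L(z))\big).$$ **Theorem.** For every $\Lambda$ there is a constant $C>0$, depending only on $\Lambda$, such that the following holds for all $d,n,k,b,L,\theta,\eta$ as above and all $r,G,M$. Suppose that every $L(\cdot,z)$ is $C^2$ on the open ball of radius $r$ around $\theta$, and that there its Hessian is bounded by $M$ and $M$-Lipschitz (i.e. its third weak derivatives are bounded); that $\|\nabla L(\theta,z)\|\le G$ for all $z\in D$; that $cM\le\Lambda$; and that $C\,\eta kG<r$. Let $\Delta_i$ be the $i$-th coordinate of the expected parameters after one epoch of SGD without replacement minus the expected parameters after $k$ steps of the reference algorithm, and put $$s=\frac{\eta}{b}\,(cM)\,G .$$ Then, for every $i$, $$\Big|\Delta_i+\frac{\eta}{b-\frac1k}\,D_i\Big|\le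 C\Big(\big(\eta kG+\tfrac1n\big)s+c\,\|H\|\,\|\nabla L(\theta)\|\Big),$$ $$\Big|\Delta_i+\frac{\eta}{b-1}\,D_i\Big|\le C\Big(\big(\eta kG+\tfrac kn\big)s+c\,\|H\|\,\|\nabla L(\theta)\|\Big).$$ So, when $H\nabla L$ is negligible, the difference is $-\frac{\eta}{b-1}\frac{d}{d\theta_i}\mathrm{trace}(S_i\cdot\mathrm{Cov}_{z\in D}(\nabla L(z)))$ up to the stated error. The error is multiplicative whenever the step has its natural order of magnitude: if $\gamma=\eta/(b-\frac1k)$ and $\tau=\frac1n$, or $\gamma=\eta/(b-1)$ and $\tau=\frac kn$, then for every real $\kappa$ with $s\le\kappa\,|\gamma D_i|$, $$|\Delta_i+\gamma D_i|\le C\Big(\kappa\,(\eta kG+\tau)\,|\gamma D_i|+c\,\|H\|\,\|\nabla L(\theta)\|\Big).$$ -/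

import Mathlib

open scoped Gradient

noncomputable section

namespace SGDBias

/-- Average of `f` over a finite type, i.e. its expectation under the uniform law. -/
def mean {α V : Type*} [Fintype α] [AddCommGroup V] [Module ℝ V] (f : α → V) : V :=
  (Fintype.card α : ℝ)⁻¹ • ∑ a, f a

/-- The parameter space `ℝ^d` with its Euclidean norm. -/
abbrev Param (d : ℕ) : Type := EuclideanSpace ℝ (Fin d)

variable {d n : ℕ}

/-- Empirical loss `ϑ ↦ L(ϑ, B)` of a family `B` of data points; `ℓ z ϑ` is the loss at the
data point `z`. -/
def lossOn (ℓ : Fin n → Param d → ℝ) {α : Type} [Fintype α] (B : α → Fin n) :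
    Param d → ℝ :=
  fun ϑ => mean fun a => ℓ (B a) ϑ

/-- The full-batch loss `ϑ ↦ L(ϑ, D)`. -/
def fullLoss (ℓ : Fin n → Param d → ℝ) : Param d → ℝ :=
  lossOn ℓ (fun z : Fin n => z)

/-- The Hessian of `f` at `ϑ`, as an operator. -/
def hess (f : Param d → ℝ) (ϑ : Param d) : Param d →L[ℝ] Param d :=
  fderiv ℝ (fun x => ∇ f x) ϑ

/-- The parameters after `k` gradient steps with learning rate `η` started at `θ`, where step
`t` uses the loss `f t`. -/
def descend {k : ℕ} (η : ℝ) (f : Fin k → Param d → ℝ) (θ : Param d) : Param d :=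
  Fin.foldl k (fun ϑ t => ϑ - η • ∇ (f t) ϑ) θ

/-- Expected parameters after one epoch of mini-batch SGD without replacement: the data set is
listed in a uniformly random order and cut into `k` consecutive batches of size `b`
(batch `t` consists of the points `σ (t, 0), …, σ (t, b - 1)`). -/
def sgdWithoutReplacement (ℓ : Fin n → Param d → ℝ) (k b : ℕ) (η : ℝ) (θ : Param d) :
    Param d :=
  mean fun σ : Fin k × Fin b ≃ Fin n =>
    descend η (fun t : Fin k => lossOn ℓ fun r : Fin b => σ (t, r)) θ

/-- The algorithms with which SGD without replacement is compared: full-batch gradient descent,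
and SGD with replacement, in which the batches of the `k` steps are independent and each batch
consists either of `b` distinct data points, uniformly at random, or of `b` independent
uniformly random data points. -/
inductive Reference
  | gd
  | sgdDistinct
  | sgdIndep

/-- Expected parameters after `k` steps of a reference algorithm. -/
def Reference.expected (ℓ : Fin n → Param d → ℝ) (k b : ℕ) (η : ℝ) (θ : Param d) :
    Reference → Param d
  | .gd => descend η (fun _ : Fin k => fullLoss ℓ) θ
  | .sgdDistinct => mean fun B : Fin k → (Fin b ↪ Fin n) =>
      descend η (fun t : Fin k => lossOn ℓ (B t)) θ
  | .sgdIndep => mean fun B : Fin k → (Fin b → Fin n) =>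
      descend η (fun t : Fin k => lossOn ℓ (B t)) θ

/-- The matrix `Cov_{z ∈ D}(∇L(ϑ, z))` in the orthonormal basis `e`. -/
def gradCov (ℓ : Fin n → Param d → ℝ) (e : OrthonormalBasis (Fin d) ℝ (Param d))
    (ϑ : Param d) : Matrix (Fin d) (Fin d) ℝ :=
  Matrix.of fun j l => mean fun z : Fin n =>
    inner ℝ (e j) (∇ (ℓ z) ϑ - ∇ (fullLoss ℓ) ϑ) *
      inner ℝ (e l) (∇ (ℓ z) ϑ - ∇ (fullLoss ℓ) ϑ)

/-- The diagonal matrix `S_i`, written in the eigenbasis of the Hessian, where `lam` lists the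
eigenvalues. The prefactor `η / (2 k)` is `η² / (2 c)` for `c = η k`. -/
def weight (η : ℝ) (k : ℕ) (lam : Fin d → ℝ) (i : Fin d) : Matrix (Fin d) (Fin d) ℝ :=
  Matrix.diagonal fun j => η / (2 * k) *
    ∑ h ∈ Finset.range (k + 3), (-η * lam i) ^ h *
      ∑ l ∈ Finset.Icc (h + 2) k, (k.choose l : ℝ) * (-η * lam j) ^ (l - h - 2)

/-- `d/dθ_i trace(S_i · Cov_{z ∈ D}(∇L(z)))` at `θ`, the matrix `S_i` being held fixed. -/
def regDeriv (ℓ : Fin n → Param d → ℝ) (k : ℕ) (η : ℝ) (θ : Param d)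
    (e : OrthonormalBasis (Fin d) ℝ (Param d)) (lam : Fin d → ℝ) (i : Fin d) : ℝ :=
  lineDeriv ℝ (fun ϑ => (weight η k lam i * gradCov ℓ e ϑ).trace) θ (e i)

/-- `H = c² / (2 n) · (𝔼_z[(∇²L(z))²] - (∇²L)²)` at `θ`, for `c = η k`. -/
def hessVar (ℓ : Fin n → Param d → ℝ) (k : ℕ) (η : ℝ) (θ : Param d) :
    Param d →L[ℝ] Param d :=
  ((η * k) ^ 2 / (2 * n)) •
    ((mean fun z : Fin n => (hess (ℓ z) θ).comp (hess (ℓ z) θ)) -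
      (hess (fullLoss ℓ) θ).comp (hess (fullLoss ℓ) θ))

/-- `x` equals `y` up to `C` times (the relative error `ε` plus the additive error `h`).
Relative errors are measured against `s`, a natural size of `y`; whenever `y` really has that
order of magnitude, `s ≤ κ |y|`, they are measured against `|y|` itself. -/
def ApproxEq (C ε s h x y : ℝ) : Prop :=
  |x - y| ≤ C * (ε * s + h) ∧
    ∀ κ : ℝ, s ≤ κ * |y| → |x - y| ≤ C * (κ * ε * |y| + h)

end SGDBias

end

open SGDBias

open scoped Gradient

noncomputable section

namespace SGDBias

/-! ### Averages over finite types. -/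

section Mean

variable {α β V W : Type*} [Fintype α] [Fintype β] [AddCommGroup V] [Module ℝ V]
  [AddCommGroup W] [Module ℝ W]

/-! Put `F z = η ∇L(·, z)`, `A z = η ∇²L(·, z)`, `γ = ηG`, `μ = ηM` and `K = exp Λ`, which bounds
both `kμ` and `(1 + μ)^k`. Every algorithm is compared with the gradient descent path `x_t`.
Expanding a batch step around `x_t` (`mean_run_succ`), the expected deviation `e_t` of an SGD run
from `x_t` satisfies `e_{t+1} = (1 - 𝔼_z A z x_t) e_t - drift_t` up to `μ` times the mean square
deviation. The latter is `O((kγ)²/n)`, because the data points at distinct positions are almost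
uncorrelated. Here `drift_t` is the expectation of the derivative fluctuation of batch `t` applied
to the current iterate. With replacement, the batch is independent of the iterate and the drift
vanishes, so all reference algorithms agree with gradient descent up to the error term. Without
replacement, the drift produces the bias.

The drift is computed with an exchange principle (`mean_swap`): if `∑ z, f z σ = 0`, then the
expectation of `f (σ p) σ` is the average over `q` of the effect on `f (σ p) ·` of exchanging the
positions `p` and `q`. For `p` in batch `t`, an exchange changes the earlier batches by a total
fraction of at most `1/b`, so each use of the principle gains smallness. One use replaces the fields
by their affine approximations at `θ` (`norm_drift_sub_le`).

The affine run is then unrolled with `T = stepDeriv A θ` (`norm_mean_derivDev_linRun_sub_le`).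
Functions of the data at two positions, centred in one of them, have expectation `-1/(n-1)` times
their diagonal average. Applied to the fields at earlier data points, this gives exactly
`driftModel`. The remaining terms are bilinear in the derivative fluctuations and act on the
displacement of the run. The mean displacement is about `k ‖𝔼 F‖` and yields the error `‖H‖ ‖∇L‖`;
the centred displacement contributes only `O(1/n²)`, by two nested exchanges
(`norm_mean_bilinear_linDev_le`).

Solving the linear recursion gives a double geometric sum in `T`. In the eigenbasis of the Hessian
its binomial expansion is the weight `S_i` (`weight_sum_eq`), and the product rule for the
covariance turns the sum into `D_i` (`inner_biasModel`). The natural factor is `ηk/(n-1) = η/(b -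
1/k)`; passing to `η/(b-1)` costs a relative error `O(k/n)`. -/

theorem mean_add (f g : α → V) : mean (fun a => f a + g a) = mean f + mean g := by
  simp [mean, Finset.sum_add_distrib]

theorem mean_sub (f g : α → V) : mean (fun a => f a - g a) = mean f - mean g := by
  simp [mean, Finset.sum_sub_distrib, smul_sub]

theorem mean_neg (f : α → V) : mean (fun a => -f a) = -mean f := by
  simp [mean]

theorem mean_smul (c : ℝ) (f : α → V) : mean (fun a => c • f a) = c • mean f := by
  simp [mean, ← Finset.smul_sum, smul_comm c]

theorem mean_const [Nonempty α] (v : V) : mean (fun _ : α => v) = v := by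
  simp [mean, ← Nat.cast_smul_eq_nsmul ℝ, smul_smul]

theorem mean_zero : mean (fun _ : α => (0 : V)) = 0 := by
  simp [mean]

theorem mean_sum {ι : Type*} (s : Finset ι) (f : ι → α → V) :
    mean (fun a => ∑ i ∈ s, f i a) = ∑ i ∈ s, mean (f i) := by
  simp [mean, Finset.sum_comm (s := Finset.univ), Finset.smul_sum]

theorem mean_comm (f : α → β → V) :
    mean (fun a => mean (f a)) = mean fun b => mean fun a => f a b := by
  simp only [mean, ← Finset.smul_sum]
  rw [Finset.sum_comm, smul_comm]

theorem mean_comp_equiv (e : α ≃ β) (f : β → V) : mean (fun a => f (e a)) = mean f := by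
  simp [mean, Fintype.card_congr e, Equiv.sum_comp e f]

theorem map_mean (L : V →ₗ[ℝ] W) (f : α → V) : L (mean f) = mean fun a => L (f a) := by
  simp [mean]

theorem sum_eq_zero_iff_mean [Nonempty α] (f : α → V) : ∑ a, f a = 0 ↔ mean f = 0 := by
  simp [mean]

theorem sum_sub_mean [Nonempty α] (f : α → V) : ∑ a, (f a - mean f) = 0 := by
  rw [sum_eq_zero_iff_mean, mean_sub, mean_const, sub_self]

theorem mean_mono {f g : α → ℝ} (h : ∀ a, f a ≤ g a) : mean f ≤ mean g := by
  simp only [mean, smul_eq_mul]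
  exact mul_le_mul_of_nonneg_left (Finset.sum_le_sum fun a _ => h a) (by positivity)

theorem mean_le [Nonempty α] {f : α → ℝ} {c : ℝ} (h : ∀ a, f a ≤ c) : mean f ≤ c :=
  (mean_mono h).trans_eq (mean_const c)

theorem mean_mul_left (c : ℝ) (f : α → ℝ) : mean (fun a => c * f a) = c * mean f :=
  mean_smul c f

end Mean

section NormedMean

variable {α V W : Type*} [Fintype α] [NormedAddCommGroup V] [NormedSpace ℝ V]
  [NormedAddCommGroup W] [NormedSpace ℝ W]

theorem norm_mean_le_mean (f : α → V) : ‖mean f‖ ≤ mean fun a => ‖f a‖ := by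
  simp only [mean, norm_smul, smul_eq_mul, norm_inv, RCLike.norm_natCast]
  exact mul_le_mul_of_nonneg_left (norm_sum_le _ _) (by positivity)

theorem norm_mean_le [Nonempty α] {f : α → V} {c : ℝ} (h : ∀ a, ‖f a‖ ≤ c) : ‖mean f‖ ≤ c :=
  (norm_mean_le_mean f).trans (mean_le h)

theorem clm_mean (L : V →L[ℝ] W) (f : α → V) : L (mean f) = mean fun a => L (f a) :=
  map_mean L.toLinearMap f

theorem mean_apply (A : α → V →L[ℝ] W) (x : V) : mean A x = mean fun a => A a x := by
  simp [mean]

end NormedMean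

/-! ### Growth constants and a discrete Gronwall inequality. -/

/-- The constants of a run of `k` steps: `γ` bounds the first step, `μ` the derivative of a step,
and `K` the accumulated growth. -/
structure Scale (k : ℕ) (γ μ K : ℝ) : Prop where
  gamma_nonneg : 0 ≤ γ
  mu_nonneg : 0 ≤ μ
  one_le : 1 ≤ K
  mul_le : k * μ ≤ K
  pow_le : (1 + μ) ^ k ≤ K

/-- A contribution `v i` is amplified at most by `(1 + μ)^k ≤ K` before time `t`, and the initial
value contributes nothing. All error recursions below are closed with this bound. -/
theorem gronwall {k : ℕ} {γ μ K : ℝ} (hS : Scale k γ μ K) {a v : ℕ → ℝ} (h0 : a 0 ≤ 0)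
    (hv : ∀ t < k, 0 ≤ v t) (h : ∀ t < k, a (t + 1) ≤ (1 + μ) * a t + v t) {t : ℕ} (ht : t ≤ k) :
    a t ≤ K * ∑ i ∈ Finset.range t, v i := by
  have hμ := hS.mu_nonneg
  have key : ∀ t ≤ k, a t ≤ (1 + μ) ^ t * ∑ i ∈ Finset.range t, v i := by
    intro t
    induction t with
    | zero => simpa using h0
    | succ t ih =>
      intro ht
      have h1 := ih (by omega)
      have h2 := h t (by omega)
      have h3 : 1 ≤ (1 + μ) ^ (t + 1) := one_le_pow₀ (by linarith)
      have h4 := hv t (by omega)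
      rw [Finset.sum_range_succ, mul_add]
      calc a (t + 1) ≤ (1 + μ) * a t + v t := h2
        _ ≤ (1 + μ) * ((1 + μ) ^ t * ∑ i ∈ Finset.range t, v i) + (1 + μ) ^ (t + 1) * v t := by
          gcongr
          nlinarith
        _ = _ := by ring
  refine (key t ht).trans ?_
  have : 0 ≤ ∑ i ∈ Finset.range t, v i := Finset.sum_nonneg fun i hi =>
    hv i (by have := Finset.mem_range.1 hi; omega)
  gcongr
  exact (pow_le_pow_right₀ (by linarith) ht).trans hS.pow_le

/-! ### Iterated steps and their stability. -/

section Iterates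

variable {E : Type*} [AddCommGroup E]

/-- The iterates of `x ↦ x - Φ t x`, started at `θ`. -/
def traj (Φ : ℕ → E → E) (θ : E) : ℕ → E
  | 0 => θ
  | t + 1 => traj Φ θ t - Φ t (traj Φ θ t)

/-- Agreement along one of the two trajectories suffices. This matters because the gradient of an
averaged loss is only known inside the ball where the losses are smooth. -/
theorem traj_congr {Φ Φ' : ℕ → E → E} {θ : E} {k : ℕ}
    (h : ∀ t < k, Φ t (traj Φ' θ t) = Φ' t (traj Φ' θ t)) {t : ℕ} (ht : t ≤ k) :
    traj Φ θ t = traj Φ' θ t := by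
  induction t with
  | zero => rfl
  | succ t ih => rw [traj, traj, ih (by omega), h t (by omega)]

theorem foldl_eq_traj {Φ : ℕ → E → E} {θ : E} {k : ℕ} (ψ : Fin k → E → E)
    (h : ∀ t : Fin k, ψ t = Φ t) :
    Fin.foldl k (fun x t => x - ψ t x) θ = traj Φ θ k := by
  induction k with
  | zero => simp [traj]
  | succ k ih =>
    rw [Fin.foldl_succ_last, ih (fun t => ψ t.castSucc) (fun t => h t.castSucc), h, traj]
    rfl

end Iterates

section Trajectories

variable {E : Type*} [NormedAddCommGroup E] [NormedSpace ℝ E]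

/-- A vector field `F` with derivative `A`, controlled on the ball of radius `ρ` around `θ`. -/
structure SmoothField (F : E → E) (A : E → E →L[ℝ] E) (θ : E) (ρ γ μ : ℝ) : Prop where
  base : ‖F θ‖ ≤ γ
  norm_le : ∀ x ∈ Metric.closedBall θ ρ, ‖A x‖ ≤ μ
  lip_deriv : ∀ x ∈ Metric.closedBall θ ρ, ∀ y ∈ Metric.closedBall θ ρ,
    ‖A x - A y‖ ≤ μ * ‖x - y‖
  lip : ∀ x ∈ Metric.closedBall θ ρ, ∀ y ∈ Metric.closedBall θ ρ, ‖F x - F y‖ ≤ μ * ‖x - y‖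
  taylor : ∀ x ∈ Metric.closedBall θ ρ, ∀ y ∈ Metric.closedBall θ ρ,
    ‖F x - F y - A y (x - y)‖ ≤ μ * ‖x - y‖ ^ 2

/-- The affine approximation of `F` at `θ`. -/
def lin (F : E → E) (A : E → E →L[ℝ] E) (θ : E) : E → E := fun x => F θ + A θ (x - θ)

namespace SmoothField

variable {F : E → E} {A : E → E →L[ℝ] E} {θ : E} {ρ γ μ : ℝ}

theorem lin (h : SmoothField F A θ ρ γ μ) (hρ : 0 ≤ ρ) :
    SmoothField (lin F A θ) (fun _ => A θ) θ ρ γ μ := by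
  have h0 : ‖A θ‖ ≤ μ := h.norm_le θ (Metric.mem_closedBall_self hρ)
  have hμ : 0 ≤ μ := (norm_nonneg _).trans h0
  have key : ∀ x y, SGDBias.lin F A θ x - SGDBias.lin F A θ y = A θ (x - y) := by
    intro x y
    simp [SGDBias.lin]
  refine ⟨by simpa [SGDBias.lin] using h.base, fun _ _ => h0, fun x _ y _ => ?_,
    fun x _ y _ => ?_, fun x _ y _ => ?_⟩
  · simp only [sub_self, norm_zero]
    positivity
  · rw [key]
    exact (A θ).le_of_opNorm_le h0 _
  · rw [key, sub_self, norm_zero]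
    positivity

theorem mean {α : Type*} [Fintype α] [Nonempty α] {F : α → E → E} {A : α → E → E →L[ℝ] E}
    (h : ∀ a, SmoothField (F a) (A a) θ ρ γ μ) :
    SmoothField (fun x => SGDBias.mean fun a => F a x) (fun x => SGDBias.mean fun a => A a x)
      θ ρ γ μ := by
  refine ⟨norm_mean_le fun a => (h a).base, fun x hx => norm_mean_le fun a => (h a).norm_le x hx,
    fun x hx y hy => ?_, fun x hx y hy => ?_, fun x hx y hy => ?_⟩
  · rw [← mean_sub]
    exact norm_mean_le fun a => (h a).lip_deriv x hx y hy
  · rw [← mean_sub]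
    exact norm_mean_le fun a => (h a).lip x hx y hy
  · rw [mean_apply, ← mean_sub, ← mean_sub]
    exact norm_mean_le fun a => (h a).taylor x hx y hy

variable {k : ℕ} {K : ℝ}

theorem norm_field_le (h : SmoothField F A θ (K * (k * γ)) γ μ) (hS : Scale k γ μ K) {x : E}
    (hx : x ∈ Metric.closedBall θ (K * (k * γ))) : ‖F x‖ ≤ 2 * K ^ 2 * γ := by
  have hγ := hS.gamma_nonneg
  have hμ := hS.mu_nonneg
  have hK := hS.one_le
  have hθ : θ ∈ Metric.closedBall θ (K * (k * γ)) := Metric.mem_closedBall_self (by positivity)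
  have h1 := h.lip x hx θ hθ
  have h2 : ‖x - θ‖ ≤ K * (k * γ) := mem_closedBall_iff_norm.1 hx
  have h3 : ‖F x‖ ≤ ‖F x - F θ‖ + ‖F θ‖ := by simpa using norm_add_le (F x - F θ) (F θ)
  have h4 : μ * ‖x - θ‖ ≤ μ * (K * (k * γ)) := by gcongr
  have h5 : μ * (K * (k * γ)) = (k * μ) * (K * γ) := by ring
  have h6 : (k * μ) * (K * γ) ≤ K * (K * γ) := by
    gcongr
    exact hS.mul_le
  have h7 : 1 * γ ≤ K ^ 2 * γ := by
    gcongr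
    exact one_le_pow₀ hK
  nlinarith [h.base]

theorem norm_sub_lin_le (h : SmoothField F A θ ρ γ μ) {x : E} (hμ : 0 ≤ μ)
    (hx : x ∈ Metric.closedBall θ ρ) :
    ‖F x - SGDBias.lin F A θ x‖ ≤ μ * ρ ^ 2 := by
  have hρ : 0 ≤ ρ := dist_nonneg.trans hx
  have h1 := h.taylor x hx θ (Metric.mem_closedBall_self hρ)
  have h2 : ‖x - θ‖ ≤ ρ := mem_closedBall_iff_norm.1 hx
  rw [SGDBias.lin, ← sub_sub]
  refine h1.trans ?_
  gcongr

/-- The affine remainder has a Lipschitz constant of order `μρ`, not just `μ`: the Taylor error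
between `x` and `y` and the change of the derivative from `θ` to `y` both carry a factor `ρ`. -/
theorem norm_sub_lin_sub_le (h : SmoothField F A θ ρ γ μ) {x y : E} (hμ : 0 ≤ μ)
    (hx : x ∈ Metric.closedBall θ ρ) (hy : y ∈ Metric.closedBall θ ρ) :
    ‖(F x - SGDBias.lin F A θ x) - (F y - SGDBias.lin F A θ y)‖ ≤ 3 * μ * ρ * ‖x - y‖ := by
  have hρ : 0 ≤ ρ := dist_nonneg.trans hx
  have h1 := h.taylor x hx y hy
  have h2 : ‖x - θ‖ ≤ ρ := mem_closedBall_iff_norm.1 hx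
  have h3 : ‖y - θ‖ ≤ ρ := mem_closedBall_iff_norm.1 hy
  have h4 := h.lip_deriv y hy θ (Metric.mem_closedBall_self hρ)
  have h5 : ‖x - y‖ ≤ 2 * ρ := by
    have := norm_sub_le (x - θ) (y - θ)
    rw [sub_sub_sub_cancel_right] at this
    linarith
  have e : (F x - SGDBias.lin F A θ x) - (F y - SGDBias.lin F A θ y)
      = (F x - F y - A y (x - y)) + (A y - A θ) (x - y) := by
    simp only [SGDBias.lin, map_sub, _root_.sub_apply]
    abel
  rw [e]
  calc _ ≤ ‖F x - F y - A y (x - y)‖ + ‖(A y - A θ) (x - y)‖ := norm_add_le _ _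
    _ ≤ μ * ‖x - y‖ ^ 2 + (μ * ‖y - θ‖) * ‖x - y‖ := by
      gcongr
      exact (A y - A θ).le_of_opNorm_le h4 _
    _ ≤ μ * ((2 * ρ) * ‖x - y‖) + (μ * ρ) * ‖x - y‖ := by
      rw [pow_two]
      gcongr
    _ = _ := by ring

end SmoothField

variable {θ : E} {k : ℕ} {γ μ K : ℝ}

theorem norm_step_sub_le {x y : E} {F : E → E} {A : E → E →L[ℝ] E} {ρ : ℝ}
    (h : SmoothField F A θ ρ γ μ)
    (hx : x ∈ Metric.closedBall θ ρ) (hy : y ∈ Metric.closedBall θ ρ) :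
    ‖(x - F x) - (y - F y)‖ ≤ (1 + μ) * ‖x - y‖ := by
  have h1 := h.lip x hx y hy
  have h2 : ‖(x - F x) - (y - F y)‖ ≤ ‖x - y‖ + ‖F x - F y‖ := by
    rw [sub_sub_sub_comm]
    exact norm_sub_le _ _
  linarith

/-- The Lipschitz bound for step `t` is available only inside the ball, so the induction carries the
bound `(1 + μ)^t * (t * γ)`, which never exceeds the radius for `t ≤ k`. -/
theorem traj_mem (hS : Scale k γ μ K) {Φ : ℕ → E → E} {Ψ : ℕ → E → E →L[ℝ] E}
    (hΦ : ∀ t, SmoothField (Φ t) (Ψ t) θ (K * (k * γ)) γ μ) {t : ℕ} (ht : t ≤ k) :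
    traj Φ θ t ∈ Metric.closedBall θ (K * (k * γ)) := by
  have hγ := hS.gamma_nonneg
  have hμ := hS.mu_nonneg
  have hK := hS.one_le
  have hθ : θ ∈ Metric.closedBall θ (K * (k * γ)) := Metric.mem_closedBall_self (by positivity)
  have hb : ∀ t ≤ k, (1 + μ) ^ t * (t * γ) ≤ K * (k * γ) := by
    intro t ht
    have h1 : (1 + μ) ^ t ≤ K := (pow_le_pow_right₀ (by linarith) ht).trans hS.pow_le
    have h2 : (t : ℝ) ≤ k := by exact_mod_cast ht
    gcongr
  have key : ∀ t ≤ k, ‖traj Φ θ t - θ‖ ≤ (1 + μ) ^ t * (t * γ) := by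
    intro t
    induction t with
    | zero => simp [traj]
    | succ t ih =>
      intro ht
      have h1 := ih (by omega)
      have hm : traj Φ θ t ∈ Metric.closedBall θ (K * (k * γ)) :=
        mem_closedBall_iff_norm.2 (h1.trans (hb t (by omega)))
      have h2 := norm_step_sub_le (hΦ t) hm hθ
      have h3 : ‖traj Φ θ (t + 1) - θ‖ ≤ ‖(traj Φ θ t - Φ t (traj Φ θ t)) - (θ - Φ t θ)‖
          + ‖Φ t θ‖ := by
        rw [traj]
        refine le_of_eq_of_le (congrArg _ ?_) (norm_sub_le _ _)
        abel
      have h4 := (hΦ t).base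
      have h5 : 1 * γ ≤ (1 + μ) ^ (t + 1) * γ := by
        gcongr
        exact one_le_pow₀ (by linarith)
      calc _ ≤ (1 + μ) * ((1 + μ) ^ t * (t * γ)) + (1 + μ) ^ (t + 1) * γ := by
            nlinarith
        _ = _ := by
            push_cast
            ring
  exact mem_closedBall_iff_norm.2 ((key t ht).trans (hb t ht))

/-- The two fields need to be compared only along the second trajectory; the Lipschitz bound of the
first field propagates the error. -/
theorem traj_sub_le (hS : Scale k γ μ K) {Φ Φ' : ℕ → E → E} {Ψ Ψ' : ℕ → E → E →L[ℝ] E}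
    (hΦ : ∀ t, SmoothField (Φ t) (Ψ t) θ (K * (k * γ)) γ μ)
    (hΦ' : ∀ t, SmoothField (Φ' t) (Ψ' t) θ (K * (k * γ)) γ μ) {v : ℕ → ℝ}
    (hv : ∀ t < k, ‖Φ t (traj Φ' θ t) - Φ' t (traj Φ' θ t)‖ ≤ v t) {t : ℕ} (ht : t ≤ k) :
    ‖traj Φ θ t - traj Φ' θ t‖ ≤ K * ∑ i ∈ Finset.range t, v i := by
  refine gronwall hS (a := fun t => ‖traj Φ θ t - traj Φ' θ t‖) (by simp [traj])
    (fun t ht => (norm_nonneg _).trans (hv t ht)) (fun t ht => ?_) ht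
  have h1 := norm_step_sub_le (hΦ t) (traj_mem hS hΦ ht.le) (traj_mem hS hΦ' ht.le)
  have h2 := hv t ht
  have e : traj Φ θ (t + 1) - traj Φ' θ (t + 1)
      = ((traj Φ θ t - Φ t (traj Φ θ t)) - (traj Φ' θ t - Φ t (traj Φ' θ t)))
        - (Φ t (traj Φ' θ t) - Φ' t (traj Φ' θ t)) := by
    rw [traj, traj]
    abel
  simp only [e]
  exact (norm_sub_le _ _).trans (add_le_add h1 h2)

end Trajectories

theorem Scale.mono {k r : ℕ} {γ μ K : ℝ} (hS : Scale k γ μ K) (hr : r ≤ k) : Scale r γ μ K := by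
  have h := hS.mu_nonneg
  refine ⟨hS.gamma_nonneg, h, hS.one_le, le_trans ?_ hS.mul_le,
    le_trans (pow_le_pow_right₀ (by linarith) hr) hS.pow_le⟩
  gcongr

/-! ### Batches and the effect of an exchange. -/

section BatchMean

variable {V W : Type*} {n k b : ℕ} [NeZero k]

/-- The average of `f` over the `t`-th batch of the arrangement `ω` of data points. -/
def batchMean [AddCommGroup V] [Module ℝ V] (f : Fin n → V) (ω : Fin k × Fin b → Fin n)
    (t : ℕ) : V :=
  mean fun j => f (ω (Fin.ofNat k t, j))

/-- The fraction of the `t`-th batch on which `ω` and `ω'` differ. -/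
def diffFrac (ω ω' : Fin k × Fin b → Fin n) (t : ℕ) : ℝ :=
  mean fun j => if ω (Fin.ofNat k t, j) = ω' (Fin.ofNat k t, j) then 0 else 1

theorem diffFrac_nonneg (ω ω' : Fin k × Fin b → Fin n) (t : ℕ) : 0 ≤ diffFrac ω ω' t := by
  refine (mean_zero (α := Fin b) (V := ℝ)).symm.le.trans (mean_mono fun j => ?_)
  split_ifs <;> norm_num

theorem norm_batchMean_sub_le [NormedAddCommGroup V] [NormedSpace ℝ V] {f : Fin n → V} {c : ℝ}
    (h : ∀ z, ‖f z‖ ≤ c) (ω ω' : Fin k × Fin b → Fin n) (t : ℕ) :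
    ‖batchMean f ω t - batchMean f ω' t‖ ≤ diffFrac ω ω' t * (2 * c) := by
  rw [batchMean, batchMean, ← mean_sub, mul_comm, diffFrac, ← mean_mul_left]
  refine (norm_mean_le_mean _).trans (mean_mono fun j => ?_)
  split_ifs with hj
  · rw [hj]
    simp
  · have h1 := h (ω (Fin.ofNat k t, j))
    have h2 := h (ω' (Fin.ofNat k t, j))
    have h3 := norm_sub_le (f (ω (Fin.ofNat k t, j))) (f (ω' (Fin.ofNat k t, j)))
    linarith

/-- Position `(t, j)` is not in a batch before `t`, so only `q` can be altered there, and one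
position has weight `1 / b` in its batch. This is the source of every factor `1 / b` below. -/
theorem sum_diffFrac_swap_le (ω : Fin k × Fin b → Fin n) {t : ℕ} (ht : t < k) (j : Fin b)
    (q : Fin k × Fin b) {r : ℕ} (hr : r ≤ t) :
    ∑ i ∈ Finset.range r, diffFrac ω (ω ∘ Equiv.swap (Fin.ofNat k t, j) q) i ≤ 1 / b := by
  have h1 : ∀ i ∈ Finset.range r, diffFrac ω (ω ∘ Equiv.swap (Fin.ofNat k t, j) q) i
      ≤ (1 / b) * if i = q.1.val then 1 else 0 := by
    intro i hi
    have hit : i < t := (Finset.mem_range.1 hi).trans_le hr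
    have hne : ∀ j', (Fin.ofNat k i, j') ≠ (Fin.ofNat k t, j) := by
      intro j' he
      have := congrArg (fun x => x.1.val) he
      simp only [Fin.val_ofNat, Nat.mod_eq_of_lt ht, Nat.mod_eq_of_lt (hit.trans ht)] at this
      omega
    have h2 : ∀ j', (if ω (Fin.ofNat k i, j')
        = (ω ∘ Equiv.swap (Fin.ofNat k t, j) q) (Fin.ofNat k i, j') then (0 : ℝ) else 1)
        ≤ if j' = q.2 then (if i = q.1.val then 1 else 0) else 0 := by
      intro j'
      by_cases hq : (Fin.ofNat k i, j') = q
      · have h3 : i = q.1.val := by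
          rw [← hq]
          simp [Nat.mod_eq_of_lt (hit.trans ht)]
        have h4 : j' = q.2 := by rw [← hq]
        rw [if_pos h4, if_pos h3]
        split_ifs <;> norm_num
      · rw [Function.comp_apply, Equiv.swap_apply_of_ne_of_ne (hne j') hq, if_pos rfl]
        split_ifs <;> norm_num
    refine (mean_mono h2).trans ?_
    simp [mean]
  refine (Finset.sum_le_sum h1).trans ?_
  rw [← Finset.mul_sum, Finset.sum_ite_eq']
  split_ifs <;> simp

end BatchMean

/-! ### SGD runs, their affine approximations, and their dependence on the arrangement. -/

section Runs

variable {E : Type*} [NormedAddCommGroup E] [NormedSpace ℝ E] {n k b : ℕ} [NeZero k]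

/-- The run of SGD in which step `t` uses the `t`-th batch of `ω`. -/
def run (F : Fin n → E → E) (θ : E) (ω : Fin k × Fin b → Fin n) : ℕ → E :=
  traj (fun t x => batchMean (fun z => F z x) ω t) θ

/-- The run of SGD for the affine approximations of the fields at `θ`. -/
def linRun (F : Fin n → E → E) (A : Fin n → E → E →L[ℝ] E) (θ : E)
    (ω : Fin k × Fin b → Fin n) : ℕ → E :=
  run (fun z => lin (F z) (A z) θ) θ ω

theorem run_succ (F : Fin n → E → E) (θ : E) (ω : Fin k × Fin b → Fin n) (t : ℕ) :
    run F θ ω (t + 1) = run F θ ω t - batchMean (fun z => F z (run F θ ω t)) ω t := rfl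

theorem batchMean_apply (A : Fin n → E →L[ℝ] E) (ω : Fin k × Fin b → Fin n) (t : ℕ) (x : E) :
    batchMean A ω t x = batchMean (fun z => A z x) ω t := mean_apply _ _

theorem batchMean_lin (F : Fin n → E → E) (A : Fin n → E → E →L[ℝ] E) (θ : E)
    (ω : Fin k × Fin b → Fin n) (t : ℕ) (x : E) :
    batchMean (fun z => lin (F z) (A z) θ x) ω t
      = batchMean (fun z => F z θ) ω t + batchMean (fun z => A z θ) ω t (x - θ) := by
  rw [batchMean_apply]
  exact mean_add _ _

theorem linRun_succ (F : Fin n → E → E) (A : Fin n → E → E →L[ℝ] E) (θ : E)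
    (ω : Fin k × Fin b → Fin n) (t : ℕ) :
    linRun F A θ ω (t + 1) = linRun F A θ ω t - (batchMean (fun z => F z θ) ω t
      + batchMean (fun z => A z θ) ω t (linRun F A θ ω t - θ)) := by
  rw [← batchMean_lin]
  rfl

theorem run_congr (F : Fin n → E → E) (θ : E) {ω ω' : Fin k × Fin b → Fin n} {t : ℕ}
    (h : ∀ i < t, ∀ j, ω (Fin.ofNat k i, j) = ω' (Fin.ofNat k i, j)) :
    run F θ ω t = run F θ ω' t :=
  traj_congr (k := t) (fun i hi => by simp only [batchMean, h i hi]) le_rfl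

variable {F : Fin n → E → E} {A : Fin n → E → E →L[ℝ] E} {θ : E} {γ μ K : ℝ} [NeZero b]

theorem SmoothField.batch {ρ : ℝ} (hF : ∀ z, SmoothField (F z) (A z) θ ρ γ μ)
    (ω : Fin k × Fin b → Fin n) (t : ℕ) :
    SmoothField (fun x => batchMean (fun z => F z x) ω t) (fun x => batchMean (fun z => A z x) ω t)
      θ ρ γ μ :=
  SmoothField.mean fun j => hF (ω (Fin.ofNat k t, j))

theorem run_mem (hS : Scale k γ μ K) (hF : ∀ z, SmoothField (F z) (A z) θ (K * (k * γ)) γ μ)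
    (ω : Fin k × Fin b → Fin n) {t : ℕ} (ht : t ≤ k) :
    run F θ ω t ∈ Metric.closedBall θ (K * (k * γ)) :=
  traj_mem hS (SmoothField.batch hF ω) ht

omit [NeZero k] in
theorem SmoothField.lin_scale (hS : Scale k γ μ K)
    (hF : ∀ z, SmoothField (F z) (A z) θ (K * (k * γ)) γ μ) (z : Fin n) :
    SmoothField (SGDBias.lin (F z) (A z) θ) (fun _ => A z θ) θ (K * (k * γ)) γ μ := by
  have := hS.gamma_nonneg
  have := hS.one_le
  exact (hF z).lin (by positivity)

theorem linRun_mem (hS : Scale k γ μ K) (hF : ∀ z, SmoothField (F z) (A z) θ (K * (k * γ)) γ μ)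
    (ω : Fin k × Fin b → Fin n) {t : ℕ} (ht : t ≤ k) :
    linRun F A θ ω t ∈ Metric.closedBall θ (K * (k * γ)) :=
  run_mem hS (SmoothField.lin_scale hS hF) ω ht

theorem run_sub_le (hS : Scale k γ μ K) (hF : ∀ z, SmoothField (F z) (A z) θ (K * (k * γ)) γ μ)
    (ω ω' : Fin k × Fin b → Fin n) {t : ℕ} (ht : t ≤ k) :
    ‖run F θ ω t - run F θ ω' t‖
      ≤ 4 * K ^ 3 * γ * ∑ i ∈ Finset.range t, diffFrac ω ω' i := by
  have h := traj_sub_le hS (SmoothField.batch hF ω) (SmoothField.batch hF ω')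
    (v := fun i => diffFrac ω ω' i * (2 * (2 * K ^ 2 * γ))) (fun i hi =>
      norm_batchMean_sub_le (fun z => (hF z).norm_field_le hS (run_mem hS hF ω' hi.le)) _ _ _) ht
  refine h.trans_eq ?_
  rw [← Finset.sum_mul]
  ring

theorem linRun_sub_le (hS : Scale k γ μ K)
    (hF : ∀ z, SmoothField (F z) (A z) θ (K * (k * γ)) γ μ)
    (ω ω' : Fin k × Fin b → Fin n) {t : ℕ} (ht : t ≤ k) :
    ‖linRun F A θ ω t - linRun F A θ ω' t‖
      ≤ 4 * K ^ 3 * γ * ∑ i ∈ Finset.range t, diffFrac ω ω' i :=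
  run_sub_le hS (SmoothField.lin_scale hS hF) ω ω' ht

theorem run_sub_linRun_le (hS : Scale k γ μ K)
    (hF : ∀ z, SmoothField (F z) (A z) θ (K * (k * γ)) γ μ)
    (ω : Fin k × Fin b → Fin n) {t : ℕ} (ht : t ≤ k) :
    ‖run F θ ω t - linRun F A θ ω t‖ ≤ K ^ 2 * (K * (k * γ)) ^ 2 := by
  have hγ := hS.gamma_nonneg
  have hμ := hS.mu_nonneg
  have hK := hS.one_le
  have h := traj_sub_le hS (SmoothField.batch hF ω)
    (SmoothField.batch (SmoothField.lin_scale hS hF) ω)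
    (v := fun _ => μ * (K * (k * γ)) ^ 2) (fun i hi => by
      rw [batchMean, batchMean, ← mean_sub]
      exact norm_mean_le fun j => (hF _).norm_sub_lin_le hμ (linRun_mem hS hF ω hi.le)) ht
  refine h.trans ?_
  rw [Finset.sum_const, Finset.card_range, nsmul_eq_mul]
  calc K * (t * (μ * (K * (k * γ)) ^ 2)) ≤ K * (k * (μ * (K * (k * γ)) ^ 2)) := by gcongr
    _ = K * (k * μ) * (K * (k * γ)) ^ 2 := by ring
    _ ≤ K * K * (K * (k * γ)) ^ 2 := by
      gcongr
      exact hS.mul_le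
    _ = _ := by ring

/-- Changing the batches affects the difference between a run and its affine approximation only
to second order. -/
theorem run_sub_linRun_sub_le (hS : Scale k γ μ K)
    (hF : ∀ z, SmoothField (F z) (A z) θ (K * (k * γ)) γ μ)
    (ω ω' : Fin k × Fin b → Fin n) {r : ℕ} (hr : r ≤ k) {β : ℝ}
    (hβ : ∑ i ∈ Finset.range r, diffFrac ω ω' i ≤ β) :
    ‖(run F θ ω r - linRun F A θ ω r) - (run F θ ω' r - linRun F A θ ω' r)‖
      ≤ 16 * K ^ 7 * μ * (k * γ) ^ 2 * β := by
  have hγ := hS.gamma_nonneg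
  have hμ := hS.mu_nonneg
  have hK := hS.one_le
  set ρ := K * (k * γ) with hρ
  have hρ0 : 0 ≤ ρ := by positivity
  have hθ : θ ∈ Metric.closedBall θ ρ := Metric.mem_closedBall_self hρ0
  have hβ0 : 0 ≤ β := (Finset.sum_nonneg fun i _ => diffFrac_nonneg ω ω' i).trans hβ
  have hstep : ∀ t < r,
      ‖(run F θ ω (t + 1) - linRun F A θ ω (t + 1))
        - (run F θ ω' (t + 1) - linRun F A θ ω' (t + 1))‖
      ≤ (1 + μ) * ‖(run F θ ω t - linRun F A θ ω t) - (run F θ ω' t - linRun F A θ ω' t)‖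
        + (diffFrac ω ω' t * (2 * μ) * (K ^ 2 * ρ ^ 2) + 3 * μ * ρ * (4 * K ^ 3 * γ * β)
          + diffFrac ω ω' t * (2 * (μ * ρ ^ 2))) := by
    intro t ht
    have htk : t < k := ht.trans_le hr
    have hx := run_mem hS hF ω htk.le
    have hx' := run_mem hS hF ω' htk.le
    have hN := run_sub_linRun_le hS hF ω' htk.le
    have hD := run_sub_le hS hF ω ω' htk.le
    simp only [run_succ, linRun_succ]
    set x := run F θ ω t
    set x' := run F θ ω' t
    set y := linRun F A θ ω t
    set y' := linRun F A θ ω' t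
    have hD' : ‖x - x'‖ ≤ 4 * K ^ 3 * γ * β := by
      refine hD.trans ?_
      gcongr
      exact (Finset.sum_le_sum_of_subset_of_nonneg (Finset.range_subset_range.2 ht.le)
        (fun i _ _ => diffFrac_nonneg ω ω' i)).trans hβ
    have hb := SmoothField.batch hF ω t
    have h1 := hb.norm_sub_lin_sub_le hμ hx hx'
    have h2 : ‖batchMean (fun z => F z x' - lin (F z) (A z) θ x') ω t
        - batchMean (fun z => F z x' - lin (F z) (A z) θ x') ω' t‖
        ≤ diffFrac ω ω' t * (2 * (μ * ρ ^ 2)) :=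
      norm_batchMean_sub_le (fun z => (hF z).norm_sub_lin_le hμ hx') _ _ _
    have h3 : ‖batchMean (fun z => A z θ) ω t - batchMean (fun z => A z θ) ω' t‖
        ≤ diffFrac ω ω' t * (2 * μ) :=
      norm_batchMean_sub_le (fun z => (hF z).norm_le θ hθ) _ _ _
    have h4 := hb.norm_le θ hθ
    have e2 : ∀ ω : Fin k × Fin b → Fin n,
        batchMean (fun z => F z x' - lin (F z) (A z) θ x') ω t
        = batchMean (fun z => F z x') ω t - (batchMean (fun z => F z θ) ω t
          + batchMean (fun z => A z θ) ω t (x' - θ)) := fun ω => by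
      rw [← batchMean_lin]
      exact mean_sub _ _
    simp only [lin] at h1
    rw [e2, e2] at h2
    set B := batchMean (fun z => A z θ) ω t
    set B' := batchMean (fun z => A z θ) ω' t
    -- The second difference is propagated by the linear step with `B`. The forcing consists of the
    -- change of `B` acting on `x' - y'`, the change of the affine remainder from `x'` to `x` within
    -- one batch, and its change between the two batches at `x'`; each is small in two ways.
    have e : (x - batchMean (fun z => F z x) ω t
          - (y - (batchMean (fun z => F z θ) ω t + B (y - θ))))
        - (x' - batchMean (fun z => F z x') ω' t
          - (y' - (batchMean (fun z => F z θ) ω' t + B' (y' - θ))))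
        = (((x - y) - (x' - y')) - B ((x - y) - (x' - y'))) - (B - B') (x' - y')
          - (batchMean (fun z => F z x) ω t - (batchMean (fun z => F z θ) ω t + B (x - θ))
            - (batchMean (fun z => F z x') ω t - (batchMean (fun z => F z θ) ω t + B (x' - θ))))
          - ((batchMean (fun z => F z x') ω t - (batchMean (fun z => F z θ) ω t + B (x' - θ)))
            - (batchMean (fun z => F z x') ω' t
              - (batchMean (fun z => F z θ) ω' t + B' (x' - θ)))) := by
      simp only [map_sub, _root_.sub_apply]
      abel
    rw [e]
    refine (norm_sub_le _ _).trans ?_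
    refine (add_le_add (norm_sub_le _ _) le_rfl).trans ?_
    refine (add_le_add (add_le_add (norm_sub_le _ _) le_rfl) le_rfl).trans ?_
    have i1 : ‖((x - y) - (x' - y')) - B ((x - y) - (x' - y'))‖
        ≤ (1 + μ) * ‖(x - y) - (x' - y')‖ := by
      have := norm_sub_le ((x - y) - (x' - y')) (B ((x - y) - (x' - y')))
      have := B.le_of_opNorm_le h4 ((x - y) - (x' - y'))
      linarith
    have i2 : ‖(B - B') (x' - y')‖ ≤ diffFrac ω ω' t * (2 * μ) * (K ^ 2 * ρ ^ 2) := by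
      refine ((B - B').le_of_opNorm_le h3 _).trans ?_
      have := diffFrac_nonneg ω ω' t
      gcongr
    have i3 := h1.trans (mul_le_mul_of_nonneg_left hD' (by positivity : 0 ≤ 3 * μ * ρ))
    linarith
  have h := gronwall (hS.mono hr) (a := fun t =>
    ‖(run F θ ω t - linRun F A θ ω t) - (run F θ ω' t - linRun F A θ ω' t)‖)
    (by simp [run, linRun, traj]) (fun t _ => by
      have := diffFrac_nonneg ω ω' t
      positivity) hstep le_rfl
  refine h.trans ?_
  simp only [Finset.sum_add_distrib, ← Finset.sum_mul, Finset.sum_const, Finset.card_range,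
    nsmul_eq_mul]
  calc K * ((∑ i ∈ Finset.range r, diffFrac ω ω' i) * (2 * μ) * (K ^ 2 * ρ ^ 2)
        + r * 3 * μ * ρ * (4 * K ^ 3 * γ * β)
        + (∑ i ∈ Finset.range r, diffFrac ω ω' i) * (2 * (μ * ρ ^ 2)))
      ≤ K * (β * (2 * μ) * (K ^ 2 * ρ ^ 2) + k * 3 * μ * ρ * (4 * K ^ 3 * γ * β)
        + β * (2 * (μ * ρ ^ 2))) := by gcongr
    _ = (2 * K ^ 5 + 12 * K ^ 5 + 2 * K ^ 3) * (μ * (k * γ) ^ 2 * β) := by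
      rw [hρ]
      ring
    _ ≤ (2 * K ^ 7 + 12 * K ^ 7 + 2 * K ^ 7) * (μ * (k * γ) ^ 2 * β) := by
      gcongr <;> first | exact hK | norm_num
    _ = _ := by ring

/-- The mixed second difference of affine runs. -/
theorem linRun_mixed_le (hS : Scale k γ μ K)
    (hF : ∀ z, SmoothField (F z) (A z) θ (K * (k * γ)) γ μ)
    (ω₀ ω₁ ω₂ ω₃ : Fin k × Fin b → Fin n) {r : ℕ} (hr : r ≤ k) {β l : ℝ}
    (hω : ∀ i < r, ∀ j, (ω₀ (Fin.ofNat k i, j) = ω₂ (Fin.ofNat k i, j)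
        ∧ ω₁ (Fin.ofNat k i, j) = ω₃ (Fin.ofNat k i, j))
      ∨ (ω₀ (Fin.ofNat k i, j) = ω₁ (Fin.ofNat k i, j)
        ∧ ω₂ (Fin.ofNat k i, j) = ω₃ (Fin.ofNat k i, j)))
    (h₁ : ∑ i ∈ Finset.range r, diffFrac ω₀ ω₁ i ≤ β)
    (h₂ : ∑ i ∈ Finset.range r, diffFrac ω₀ ω₂ i ≤ β)
    (hl : 0 ≤ l)
    (h₃ : ∀ i < r, ‖linRun F A θ ω₁ i - linRun F A θ ω₃ i‖ ≤ l)
    (h₄ : ∀ i < r, ‖linRun F A θ ω₂ i - linRun F A θ ω₃ i‖ ≤ l) :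
    ‖(linRun F A θ ω₀ r - linRun F A θ ω₁ r) - (linRun F A θ ω₂ r - linRun F A θ ω₃ r)‖
      ≤ 4 * K * μ * β * l := by
  have hγ := hS.gamma_nonneg
  have hμ := hS.mu_nonneg
  have hK := hS.one_le
  have hθ : θ ∈ Metric.closedBall θ (K * (k * γ)) := Metric.mem_closedBall_self (by positivity)
  -- At each position at most one of the two modifications acts, so batch averages are additive in
  -- them and their mixed second difference vanishes.
  have hadd : ∀ {V : Type _} [NormedAddCommGroup V] [NormedSpace ℝ V] (f : Fin n → V), ∀ t < r,
      batchMean f ω₀ t - batchMean f ω₁ t - (batchMean f ω₂ t - batchMean f ω₃ t) = 0 := by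
    intro V _ _ f t ht
    simp only [batchMean]
    rw [← mean_sub, ← mean_sub, ← mean_sub]
    rw [← mean_zero (α := Fin b) (V := V)]
    congr 1
    ext j
    rcases hω t ht j with ⟨h, h'⟩ | ⟨h, h'⟩ <;> rw [h, h'] <;> simp
  have hstep : ∀ t < r,
      ‖(linRun F A θ ω₀ (t + 1) - linRun F A θ ω₁ (t + 1))
        - (linRun F A θ ω₂ (t + 1) - linRun F A θ ω₃ (t + 1))‖
      ≤ (1 + μ) * ‖(linRun F A θ ω₀ t - linRun F A θ ω₁ t)
        - (linRun F A θ ω₂ t - linRun F A θ ω₃ t)‖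
        + (diffFrac ω₀ ω₁ t * (2 * μ) * l + diffFrac ω₀ ω₂ t * (2 * μ) * l) := by
    intro t ht
    have htk : t < k := ht.trans_le hr
    have i1 := h₃ t ht
    have i2 := h₄ t ht
    have d1 := diffFrac_nonneg ω₀ ω₁ t
    have d2 := diffFrac_nonneg ω₀ ω₂ t
    have a1 : ‖batchMean (fun z => A z θ) ω₀ t - batchMean (fun z => A z θ) ω₁ t‖
        ≤ diffFrac ω₀ ω₁ t * (2 * μ) :=
      norm_batchMean_sub_le (fun z => (hF z).norm_le θ hθ) _ _ _
    have a2 : ‖batchMean (fun z => A z θ) ω₀ t - batchMean (fun z => A z θ) ω₂ t‖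
        ≤ diffFrac ω₀ ω₂ t * (2 * μ) :=
      norm_batchMean_sub_le (fun z => (hF z).norm_le θ hθ) _ _ _
    have a0 := (SmoothField.batch hF ω₀ t).norm_le θ hθ
    have eF := hadd (fun z => F z θ) t ht
    have eA := hadd (fun z => A z θ) t ht
    simp only [linRun_succ]
    set y₀ := linRun F A θ ω₀ t
    set y₁ := linRun F A θ ω₁ t
    set y₂ := linRun F A θ ω₂ t
    set y₃ := linRun F A θ ω₃ t
    set f₀ := batchMean (fun z => F z θ) ω₀ t
    set f₁ := batchMean (fun z => F z θ) ω₁ t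
    set f₂ := batchMean (fun z => F z θ) ω₂ t
    set f₃ := batchMean (fun z => F z θ) ω₃ t
    set B₀ := batchMean (fun z => A z θ) ω₀ t
    set B₁ := batchMean (fun z => A z θ) ω₁ t
    set B₂ := batchMean (fun z => A z θ) ω₂ t
    set B₃ := batchMean (fun z => A z θ) ω₃ t
    have e3 : B₃ = B₁ + B₂ - B₀ := by
      rw [← sub_eq_zero, ← eA]
      abel
    have f3 : f₃ = f₁ + f₂ - f₀ := by
      rw [← sub_eq_zero, ← eF]
      abel
    -- Eliminating `f₃` and `B₃` removes all first-order forcing. What is left are products of a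
    -- change of the derivative by one modification and a change of the run by the other.
    have e : (y₀ - (f₀ + B₀ (y₀ - θ)) - (y₁ - (f₁ + B₁ (y₁ - θ))))
          - (y₂ - (f₂ + B₂ (y₂ - θ)) - (y₃ - (f₃ + B₃ (y₃ - θ))))
        = (((y₀ - y₁) - (y₂ - y₃)) - B₀ ((y₀ - y₁) - (y₂ - y₃)))
          - (B₀ - B₁) (y₁ - y₃) - (B₀ - B₂) (y₂ - y₃) := by
      rw [e3, f3]
      simp only [map_sub, _root_.sub_apply, _root_.add_apply]
      abel
    rw [e]
    have j1 := (B₀ - B₁).le_of_opNorm_le a1 (y₁ - y₃)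
    have j2 := (B₀ - B₂).le_of_opNorm_le a2 (y₂ - y₃)
    have j3 := B₀.le_of_opNorm_le a0 ((y₀ - y₁) - (y₂ - y₃))
    have k1 : diffFrac ω₀ ω₁ t * (2 * μ) * ‖y₁ - y₃‖ ≤ diffFrac ω₀ ω₁ t * (2 * μ) * l := by
      gcongr
    have k2 : diffFrac ω₀ ω₂ t * (2 * μ) * ‖y₂ - y₃‖ ≤ diffFrac ω₀ ω₂ t * (2 * μ) * l := by
      gcongr
    refine (norm_sub_le _ _).trans ?_
    refine (add_le_add (norm_sub_le _ _) le_rfl).trans ?_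
    refine (add_le_add (add_le_add (norm_sub_le _ _) le_rfl) le_rfl).trans ?_
    linarith
  have h := gronwall (hS.mono hr) (a := fun t =>
    ‖(linRun F A θ ω₀ t - linRun F A θ ω₁ t) - (linRun F A θ ω₂ t - linRun F A θ ω₃ t)‖)
    (by simp [run, linRun, traj]) (fun t _ => by
      have := diffFrac_nonneg ω₀ ω₁ t
      have := diffFrac_nonneg ω₀ ω₂ t
      positivity) hstep le_rfl
  refine h.trans ?_
  simp only [Finset.sum_add_distrib, ← Finset.sum_mul]
  calc _ ≤ K * (β * (2 * μ) * l + β * (2 * μ) * l) := by gcongr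
    _ = _ := by ring

end Runs

/-! ### Exchangeability of a uniformly random arrangement. -/

section Swap

variable {P V : Type*} [Fintype P] [DecidableEq P] {n : ℕ}

/-- Composition with a transposition, as an equivalence. -/
def swapEquiv (p q : P) : (P ≃ Fin n) ≃ (P ≃ Fin n) where
  toFun σ := (Equiv.swap p q).trans σ
  invFun σ := (Equiv.swap p q).trans σ
  left_inv σ := by ext; simp
  right_inv σ := by ext; simp

section Module

variable [AddCommGroup V] [Module ℝ V]

/-- Composing with the transposition preserves the uniform law and turns `f (σ p) (swapped σ)` into
`f (σ q) σ`; summed over `q` these run through all data points and cancel by `hf`. -/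
theorem mean_swap (hP : Fintype.card P = n) (p : P) (f : Fin n → (P ≃ Fin n) → V)
    (hf : ∀ σ, ∑ z, f z σ = 0) :
    (n : ℝ) • mean (fun σ : P ≃ Fin n => f (σ p) σ)
      = ∑ q, mean fun σ : P ≃ Fin n => f (σ p) σ - f (σ p) ((Equiv.swap p q).trans σ) := by
  have h1 : ∀ q, mean (fun σ : P ≃ Fin n => f (σ p) ((Equiv.swap p q).trans σ))
      = mean fun σ : P ≃ Fin n => f (σ q) σ := by
    intro q
    rw [← mean_comp_equiv (swapEquiv p q) fun σ : P ≃ Fin n => f (σ q) σ]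
    simp [swapEquiv]
  have h2 : ∑ q, mean (fun σ : P ≃ Fin n => f (σ q) σ) = 0 := by
    rw [← mean_sum, ← mean_zero (α := P ≃ Fin n)]
    congr 1
    ext σ
    rw [Equiv.sum_comp σ (fun z => f z σ), hf]
  simp only [mean_sub, h1, Finset.sum_sub_distrib, h2, sub_zero, Finset.sum_const,
    Finset.card_univ, hP, ← Nat.cast_smul_eq_nsmul ℝ]

theorem mean_equiv_apply [NeZero n] (hP : Fintype.card P = n) (p : P) (f : Fin n → V) :
    mean (fun σ : P ≃ Fin n => f (σ p)) = mean f := by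
  have : Nonempty (P ≃ Fin n) := ⟨Fintype.equivFinOfCardEq hP⟩
  have h := mean_swap hP p (fun z _ => f z - mean f) (fun _ => sum_sub_mean f)
  simp only [sub_self, mean_zero, Finset.sum_const_zero] at h
  rcases smul_eq_zero.1 h with h | h
  · exact absurd h (NeZero.ne _)
  · rwa [mean_sub, mean_const, sub_eq_zero] at h

/-- In `mean_swap` at `p`, only the exchange with `q` itself affects `σ q`, and it produces the
diagonal. Centring in the first argument alone is enough. -/
theorem mean_equiv_pair [NeZero n] (hP : Fintype.card P = n) {p q : P} (hpq : p ≠ q)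
    (B : Fin n → Fin n → V) (hB : ∀ z', ∑ z, B z z' = 0) :
    ((n : ℝ) - 1) • mean (fun σ : P ≃ Fin n => B (σ p) (σ q)) = -mean fun z => B z z := by
  have h := mean_swap hP p (fun z σ => B z (σ q)) (fun σ => hB (σ q))
  rw [Finset.sum_eq_single q] at h
  · simp only [Equiv.trans_apply, Equiv.swap_apply_right, mean_sub] at h
    rw [mean_equiv_apply hP p (fun z => B z z)] at h
    rw [sub_smul, h, one_smul]
    abel
  · intro q' _ hq'
    simp only [Equiv.trans_apply, Equiv.swap_apply_of_ne_of_ne hpq.symm hq'.symm, sub_self,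
      mean_zero]
  · simp

end Module

theorem norm_mean_swap_le [NormedAddCommGroup V] [NormedSpace ℝ V] [NeZero n]
    (hP : Fintype.card P = n) (p : P)
    (f : Fin n → (P ≃ Fin n) → V) (hf : ∀ σ, ∑ z, f z σ = 0) {c : ℝ}
    (h : ∀ q σ, ‖f (σ p) σ - f (σ p) ((Equiv.swap p q).trans σ)‖ ≤ c) :
    ‖mean fun σ : P ≃ Fin n => f (σ p) σ‖ ≤ c := by
  have : Nonempty (P ≃ Fin n) := ⟨Fintype.equivFinOfCardEq hP⟩
  have hn : (0 : ℝ) < n := by exact_mod_cast Nat.pos_of_ne_zero (NeZero.ne n)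
  have h1 : ‖(n : ℝ) • mean (fun σ : P ≃ Fin n => f (σ p) σ)‖ ≤ n * c := by
    rw [mean_swap hP p f hf]
    refine (norm_sum_le_of_le _ fun q _ => norm_mean_le (h q)).trans ?_
    simp [hP]
  rw [norm_smul, RCLike.norm_natCast] at h1
  exact le_of_mul_le_mul_left h1 hn

end Swap

/-! ### Sampling schemes with almost uncorrelated positions. -/

section Sampling

variable {E : Type*} [NormedAddCommGroup E] [InnerProductSpace ℝ E] {n : ℕ}
  {P Ω : Type*} [Fintype Ω]

/-- A random arrangement of data points at the positions `P` in which every position is uniformly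
distributed and distinct positions are almost uncorrelated. -/
structure Sampling (E : Type*) [NormedAddCommGroup E] [InnerProductSpace ℝ E]
    (ω : Ω → P → Fin n) : Prop where
  one : ∀ (p : P) (f : Fin n → E), mean (fun o => f (ω o p)) = mean f
  pair : ∀ (p q : P), p ≠ q → ∀ (u v : Fin n → E) (c : ℝ), mean u = 0 → mean v = 0 →
    (∀ z, ‖u z‖ ≤ c) → (∀ z, ‖v z‖ ≤ c) →
    mean (fun o => (inner ℝ (u (ω o p)) (v (ω o q)) : ℝ)) ≤ 2 * c ^ 2 / n

/-- The covariance of two positions is `-1/(n-1)` times a diagonal average of size at most `c²`, and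
`1/(n-1) ≤ 2/n` for `n ≥ 2`. -/
theorem mean_inner_equiv_le [Fintype P] [DecidableEq P] (hn : 2 ≤ n) (hP : Fintype.card P = n)
    {p q : P} (hpq : p ≠ q) {u v : Fin n → E} {c : ℝ} (hu : mean u = 0)
    (huc : ∀ z, ‖u z‖ ≤ c) (hvc : ∀ z, ‖v z‖ ≤ c) :
    mean (fun σ : P ≃ Fin n => (inner ℝ (u (σ p)) (v (σ q)) : ℝ)) ≤ 2 * c ^ 2 / n := by
  have : NeZero n := ⟨by omega⟩
  have hn' : (2 : ℝ) ≤ n := by exact_mod_cast hn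
  have h := mean_equiv_pair hP hpq (fun z z' => (inner ℝ (u z) (v z') : ℝ)) (fun z' => by
    rw [← sum_inner, (sum_eq_zero_iff_mean u).2 hu, inner_zero_left])
  have h2 : -mean (fun z => (inner ℝ (u z) (v z) : ℝ)) ≤ c ^ 2 := by
    rw [← mean_neg]
    refine mean_le fun z => ?_
    have h3 := abs_real_inner_le_norm (u z) (v z)
    have h4 : ‖u z‖ * ‖v z‖ ≤ c * c :=
      mul_le_mul (huc z) (hvc z) (norm_nonneg _) ((norm_nonneg _).trans (huc z))
    have h5 := neg_abs_le (inner ℝ (u z) (v z) : ℝ)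
    nlinarith
  rw [smul_eq_mul] at h
  set X := mean (fun σ : P ≃ Fin n => (inner ℝ (u (σ p)) (v (σ q)) : ℝ))
  rw [le_div_iff₀ (by linarith)]
  rcases le_or_gt X 0 with hX | hX
  · nlinarith [sq_nonneg c]
  · nlinarith [sq_nonneg c]

theorem Sampling.equiv [Fintype P] [DecidableEq P] (hn : 2 ≤ n) (hP : Fintype.card P = n) :
    Sampling E (fun (σ : P ≃ Fin n) p => σ p) := by
  have : NeZero n := ⟨by omega⟩
  exact ⟨fun p f => mean_equiv_apply hP p f, fun p q hpq u v c hu _ huc hvc =>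
    mean_inner_equiv_le hn hP hpq hu huc hvc⟩

/-- Expanding the square, the `n` diagonal terms give `n c²` and the at most `n²` mixed terms give
`n² · 2c²/n`. -/
theorem Sampling.mean_norm_sq_sum_le [Fintype P] [Nonempty Ω] {ω : Ω → P → Fin n}
    (hω : Sampling E ω) (hP : Fintype.card P = n) (a : P → Fin n → E) {c : ℝ}
    (ha : ∀ p, mean (a p) = 0) (hc : ∀ p z, ‖a p z‖ ≤ c) :
    mean (fun o => ‖∑ p, a p (ω o p)‖ ^ 2) ≤ 3 * n * c ^ 2 := by
  classical
  have h1 : ∀ o, ‖∑ p, a p (ω o p)‖ ^ 2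
      = ∑ p, ∑ q, (inner ℝ (a p (ω o p)) (a q (ω o q)) : ℝ) := by
    intro o
    rw [← real_inner_self_eq_norm_sq, sum_inner]
    simp only [inner_sum]
  have h2 : ∀ p q, mean (fun o => (inner ℝ (a p (ω o p)) (a q (ω o q)) : ℝ))
      ≤ (if p = q then c ^ 2 else 0) + 2 * c ^ 2 / n := by
    intro p q
    split_ifs with hpq
    · subst hpq
      have : 0 ≤ 2 * c ^ 2 / n := by positivity
      refine le_trans (mean_le fun o => ?_) (le_add_of_nonneg_right this)
      rw [real_inner_self_eq_norm_sq]
      have := hc p (ω o p)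
      gcongr
    · rw [zero_add]
      exact hω.pair p q hpq _ _ c (ha p) (ha q) (hc p) (hc q)
  simp only [h1, mean_sum]
  refine (Finset.sum_le_sum fun p _ => Finset.sum_le_sum fun q _ => h2 p q).trans ?_
  simp only [Finset.sum_add_distrib, Finset.sum_ite_eq, Finset.mem_univ, if_true,
    Finset.sum_const, Finset.card_univ, hP, nsmul_eq_mul]
  rcases eq_or_ne n 0 with rfl | hn
  · simp
  · have : (n : ℝ) ≠ 0 := by exact_mod_cast hn
    field_simp
    linarith

/-- A coordinate of independent uniform variables may be drawn independently of the rest. -/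
theorem mean_pi_resample {ι β V : Type*} [Fintype ι] [DecidableEq ι] [Fintype β] [Nonempty β]
    [AddCommGroup V] [Module ℝ V]
    (t : ι) (f : β → (ι → β) → V) (hf : ∀ c B c', f c (Function.update B t c') = f c B) :
    mean (fun B : ι → β => f (B t) B) = mean fun B : ι → β => mean fun c => f c B := by
  -- The involution exchanging a fresh draw with the coordinate `t`.
  let e : (β × (ι → β)) ≃ (β × (ι → β)) :=
    { toFun := fun x => (x.2 t, Function.update x.2 t x.1)
      invFun := fun x => (x.2 t, Function.update x.2 t x.1)
      left_inv := fun x => by simp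
      right_inv := fun x => by simp }
  have h : ∑ x : β × (ι → β), f x.1 x.2 = ∑ x : β × (ι → β), f (x.2 t) x.2 := by
    rw [← Equiv.sum_comp e]
    simp [e, hf]
  rw [Fintype.sum_prod_type_right, Fintype.sum_prod_type_right] at h
  simp only [mean, ← Finset.smul_sum]
  rw [h]
  simp only [Finset.sum_const, Finset.card_univ, ← Nat.cast_smul_eq_nsmul ℝ, ← Finset.smul_sum]
  rw [smul_smul (Fintype.card β : ℝ)⁻¹, inv_mul_cancel₀ (by positivity), one_smul]

theorem mean_pi_apply {ι β V : Type*} [Fintype ι] [DecidableEq ι] [Fintype β] [Nonempty β]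
    [AddCommGroup V] [Module ℝ V] (t : ι) (f : β → V) :
    mean (fun B : ι → β => f (B t)) = mean f := by
  rw [mean_pi_resample t (fun c _ => f c) (fun _ _ _ => rfl), mean_const]

/-- Two positions in the same block are covered by `hB`; positions in different blocks are
independent, so resampling one block makes their covariance zero. -/
theorem Sampling.pi {ι κ β : Type*} [Fintype ι] [DecidableEq ι] [Fintype β] [Nonempty β]
    {B : β → κ → Fin n} (hB : Sampling E B) :
    Sampling E (fun (o : ι → β) (p : ι × κ) => B (o p.1) p.2) := by
  refine ⟨fun p f => ?_, fun p q hpq u v c hu hv huc hvc => ?_⟩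
  · rw [mean_pi_apply p.1 (fun c => f (B c p.2)), hB.one]
  · by_cases h : p.1 = q.1
    · have h2 : p.2 ≠ q.2 := fun h2 => hpq (Prod.ext h h2)
      simp only [h]
      rw [mean_pi_apply q.1 (fun c => (inner ℝ (u (B c p.2)) (v (B c q.2)) : ℝ))]
      exact hB.pair _ _ h2 u v c hu hv huc hvc
    · rw [mean_pi_resample p.1
        (fun c (o : ι → β) => (inner ℝ (u (B c p.2)) (v (B (o q.1) q.2)) : ℝ))
        (fun c o c' => by rw [Function.update_of_ne (Ne.symm h)])]
      have h3 : ∀ o : ι → β, mean (fun c => (inner ℝ (u (B c p.2)) (v (B (o q.1) q.2)) : ℝ))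
          = 0 := by
        intro o
        have h4 := map_mean (innerₛₗ ℝ (v (B (o q.1) q.2))) (fun c => u (B c p.2))
        rw [hB.one, hu, map_zero] at h4
        simpa only [real_inner_comm, innerₛₗ_apply_apply] using h4.symm
      simp only [h3, mean_zero]
      positivity

theorem Sampling.indep [NeZero n] {b : ℕ} : Sampling E (fun (B : Fin b → Fin n) j => B j) := by
  have h := Sampling.pi (E := E) (n := n) (ι := Fin b) (κ := Unit) (β := Fin n)
    (B := fun z _ => z) ⟨fun _ _ => rfl, fun p q hpq => absurd (Subsingleton.elim p q) hpq⟩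
  exact ⟨fun p f => h.one (p, ()) f, fun p q hpq => h.pair (p, ()) (q, ()) (by simpa using hpq)⟩

/-- A random injection may be followed by a random permutation of the data without changing its law,
which reduces draws of distinct points to the case of permutations. -/
theorem mean_embedding {V : Type*} [AddCommGroup V] [Module ℝ V] {b : ℕ}
    (f : (Fin b ↪ Fin n) → V) :
    mean f = mean fun B : Fin b ↪ Fin n => mean fun π : Fin n ≃ Fin n =>
      f (B.trans π.toEmbedding) := by
  have : Nonempty (Fin n ≃ Fin n) := ⟨Equiv.refl _⟩
  have h : ∀ π : Fin n ≃ Fin n, mean (fun B : Fin b ↪ Fin n => f (B.trans π.toEmbedding))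
      = mean f := by
    intro π
    exact mean_comp_equiv (Equiv.embeddingCongr (Equiv.refl _) π) f
  rw [mean_comm]
  simp only [h, mean_const]

theorem Sampling.embedding (hn : 2 ≤ n) {b : ℕ} (hb : b ≤ n) :
    Sampling E (fun (B : Fin b ↪ Fin n) j => B j) := by
  have : NeZero n := ⟨by omega⟩
  have : Nonempty (Fin b ↪ Fin n) := ⟨Fin.castLEEmb hb⟩
  refine ⟨fun p f => ?_, fun p q hpq u v c hu _ huc hvc => ?_⟩
  · rw [mean_embedding]
    simp only [Function.Embedding.trans_apply, Equiv.coe_toEmbedding,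
      mean_equiv_apply (Fintype.card_fin n), mean_const]
  · rw [mean_embedding]
    exact mean_le fun B => mean_inner_equiv_le hn (Fintype.card_fin n) (B.injective.ne hpq)
      hu huc hvc

end Sampling

/-! ### Deviation of SGD from gradient descent. -/

section Deviation

variable {E : Type*} [NormedAddCommGroup E] [InnerProductSpace ℝ E] {n k b : ℕ}

/-- The iterates of full-batch gradient descent. -/
def gd (F : Fin n → E → E) (θ : E) : ℕ → E := traj (fun _ x => mean fun z => F z x) θ

/-- The deviation of the field of a data point from the full-batch field, along `gd`. -/
def noise (F : Fin n → E → E) (θ : E) (t : ℕ) (z : Fin n) : E :=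
  F z (gd F θ t) - mean fun z' => F z' (gd F θ t)

/-- The deviation of the derivative at a data point from the full-batch derivative. -/
def derivDev (A : Fin n → E → E →L[ℝ] E) (x : E) (z : Fin n) : E →L[ℝ] E :=
  A z x - mean fun z' => A z' x

theorem mean_noise [NeZero n] (F : Fin n → E → E) (θ : E) (t : ℕ) : mean (noise F θ t) = 0 := by
  have h := mean_sub (fun z => F z (gd F θ t)) fun _ => mean fun z => F z (gd F θ t)
  rw [mean_const, sub_self] at h
  exact h

theorem mean_derivDev (A : Fin n → E → E →L[ℝ] E) (x : E) : mean (derivDev A x) = 0 := by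
  rcases isEmpty_or_nonempty (Fin n) with hn | hn
  · simp [mean]
  have h := mean_sub (fun z => A z x) fun _ => mean fun z => A z x
  rw [mean_const, sub_self] at h
  exact h

theorem ofNat_val [NeZero k] (i : Fin k) : Fin.ofNat k i.val = i := by
  ext
  simp

theorem sum_batchMean [NeZero k] (f : ℕ → Fin n → E) (ω : Fin k × Fin b → Fin n) {t : ℕ}
    (ht : t ≤ k) :
    ∑ i ∈ Finset.range t, batchMean (f i) ω i
      = ∑ p : Fin k × Fin b, if p.1.val < t then (b : ℝ)⁻¹ • f p.1 (ω p) else 0 := by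
  have h1 : ∀ x : Fin k, ∑ j : Fin b, (if x.val < t then (b : ℝ)⁻¹ • f x (ω (x, j)) else 0)
      = if x.val < t then batchMean (f x) ω x else 0 := by
    intro x
    split_ifs
    · simp [batchMean, mean, Finset.smul_sum]
    · simp
  rw [Fintype.sum_prod_type]
  simp only [h1]
  rw [Fin.sum_univ_eq_sum_range (fun i => if i < t then batchMean (f i) ω i else 0) k,
    ← Finset.sum_filter]
  congr 1
  ext i
  simp only [Finset.mem_range, Finset.mem_filter]
  omega

variable [NeZero k] [NeZero b] {F : Fin n → E → E} {A : Fin n → E → E →L[ℝ] E} {θ : E}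
  {γ μ K : ℝ} {Ω : Type*} [Fintype Ω] [Nonempty Ω] {ω : Ω → Fin k × Fin b → Fin n}

omit [NeZero k] [NeZero b] in
theorem gd_mem [NeZero n] (hS : Scale k γ μ K)
    (hF : ∀ z, SmoothField (F z) (A z) θ (K * (k * γ)) γ μ) {t : ℕ} (ht : t ≤ k) :
    gd F θ t ∈ Metric.closedBall θ (K * (k * γ)) :=
  traj_mem hS (fun _ => SmoothField.mean hF) ht

/-- The noise is evaluated along the deterministic gradient descent path, so it is a sum over
positions of fixed centred functions of size `4K²γ/b`; then `3 n (4K²γ/b)² = 48 K⁴ (kγ)²/n` because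
`n = kb`. -/
theorem mean_norm_sq_noise_le [NeZero n] (hω : Sampling E ω) (hn : n = k * b) (hS : Scale k γ μ K)
    (hF : ∀ z, SmoothField (F z) (A z) θ (K * (k * γ)) γ μ) {t : ℕ} (ht : t ≤ k) :
    mean (fun o => ‖∑ i ∈ Finset.range t, batchMean (noise F θ i) (ω o) i‖ ^ 2)
      ≤ 48 * K ^ 4 * (k * γ) ^ 2 / n := by
  have hγ := hS.gamma_nonneg
  have hK := hS.one_le
  have hb : (0 : ℝ) < b := by exact_mod_cast Nat.pos_of_ne_zero (NeZero.ne b)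
  have hk : (0 : ℝ) < k := by exact_mod_cast Nat.pos_of_ne_zero (NeZero.ne k)
  simp only [sum_batchMean _ _ ht]
  have h := hω.mean_norm_sq_sum_le (by simp [hn])
    (fun p z => if p.1.val < t then (b : ℝ)⁻¹ • noise F θ p.1 z else 0)
    (c := (b : ℝ)⁻¹ * (4 * K ^ 2 * γ)) (fun p => ?_) (fun p z => ?_)
  · refine h.trans_eq ?_
    have hn' : (n : ℝ) = k * b := by exact_mod_cast hn
    rw [hn']
    field_simp
    ring
  · split_ifs
    · rw [mean_smul, mean_noise, smul_zero]
    · exact mean_zero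
  · split_ifs with hp
    · rw [norm_smul, norm_inv, RCLike.norm_natCast]
      gcongr
      have hm := gd_mem hS hF (hp.le.trans ht)
      have h1 := (hF z).norm_field_le hS hm
      have h2 := (SmoothField.mean hF).norm_field_le hS hm
      have h3 := norm_sub_le (F z (gd F θ p.1)) (mean fun z' => F z' (gd F θ p.1))
      simp only [noise]
      linarith
    · rw [norm_zero]
      positivity

/-- Adding the accumulated noise to the deviation cancels the noise of each step exactly; the
remaining increment is bounded by `μ` times the deviation itself. -/
theorem norm_run_sub_gd_add_le [NeZero n] (hS : Scale k γ μ K)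
    (hF : ∀ z, SmoothField (F z) (A z) θ (K * (k * γ)) γ μ) (ω : Fin k × Fin b → Fin n) {t : ℕ}
    (ht : t ≤ k) :
    ‖run F θ ω t - gd F θ t + ∑ i ∈ Finset.range t, batchMean (noise F θ i) ω i‖
      ≤ K * ∑ i ∈ Finset.range t,
          μ * ‖∑ i ∈ Finset.range i, batchMean (noise F θ i) ω i‖ := by
  have hμ := hS.mu_nonneg
  refine gronwall hS (a := fun t =>
    ‖run F θ ω t - gd F θ t + ∑ i ∈ Finset.range t, batchMean (noise F θ i) ω i‖)
    (by simp [run, gd, traj]) (fun t _ => by positivity) (fun t ht => ?_) ht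
  have h1 := (SmoothField.batch hF ω t).lip _ (run_mem hS hF ω ht.le) _ (gd_mem hS hF ht.le)
  have e1 : batchMean (noise F θ t) ω t
      = batchMean (fun z => F z (gd F θ t)) ω t - mean fun z => F z (gd F θ t) := by
    simp only [batchMean, noise]
    rw [mean_sub, mean_const]
  have e2 : gd F θ (t + 1) = gd F θ t - mean fun z => F z (gd F θ t) := rfl
  simp only [Finset.sum_range_succ, run_succ, e1, e2]
  set N := ∑ i ∈ Finset.range t, batchMean (noise F θ i) ω i
  set x := run F θ ω t
  set y := gd F θ t
  have e : x - batchMean (fun z => F z x) ω t - (y - mean fun z => F z y)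
        + (N + (batchMean (fun z => F z y) ω t - mean fun z => F z y))
      = (x - y + N) - (batchMean (fun z => F z x) ω t - batchMean (fun z => F z y) ω t) := by
    abel
  rw [e]
  have h2 := norm_sub_le (x - y + N)
    (batchMean (fun z => F z x) ω t - batchMean (fun z => F z y) ω t)
  have h3 : ‖x - y‖ ≤ ‖x - y + N‖ + ‖N‖ := by simpa using norm_sub_le (x - y + N) N
  have h4 : μ * ‖x - y‖ ≤ μ * (‖x - y + N‖ + ‖N‖) := by gcongr
  linarith

/-- The mean square deviation of an SGD run from gradient descent. -/
theorem mean_norm_sq_run_sub_gd_le [NeZero n] (hω : Sampling E ω) (hn : n = k * b)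
    (hS : Scale k γ μ K)
    (hF : ∀ z, SmoothField (F z) (A z) θ (K * (k * γ)) γ μ) {t : ℕ} (ht : t ≤ k) :
    mean (fun o => ‖run F θ (ω o) t - gd F θ t‖ ^ 2) ≤ 192 * K ^ 8 * (k * γ) ^ 2 / n := by
  have hγ := hS.gamma_nonneg
  have hμ := hS.mu_nonneg
  have hK := hS.one_le
  set N : Ω → ℕ → E := fun o t => ∑ i ∈ Finset.range t, batchMean (noise F θ i) (ω o) i with hN
  set V := 48 * K ^ 4 * (k * γ) ^ 2 / n with hV
  have hV0 : 0 ≤ V := by positivity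
  have hNV : ∀ t ≤ k, mean (fun o => ‖N o t‖ ^ 2) ≤ V := fun t ht =>
    mean_norm_sq_noise_le hω hn hS hF ht
  have h1 : ∀ o, ‖run F θ (ω o) t - gd F θ t‖ ^ 2
      ≤ 2 * ‖N o t‖ ^ 2 + (2 * K ^ 2 * μ ^ 2 * k) * ∑ i ∈ Finset.range t, ‖N o i‖ ^ 2 := by
    intro o
    have h := norm_run_sub_gd_add_le hS hF (ω o) ht
    rw [← Finset.mul_sum] at h
    change ‖run F θ (ω o) t - gd F θ t + N o t‖ ≤ K * (μ * ∑ i ∈ Finset.range t, ‖N o i‖) at h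
    have h2 : ‖run F θ (ω o) t - gd F θ t‖
        ≤ ‖run F θ (ω o) t - gd F θ t + N o t‖ + ‖N o t‖ := by
      simpa using norm_sub_le (run F θ (ω o) t - gd F θ t + N o t) (N o t)
    have h3 : (∑ i ∈ Finset.range t, ‖N o i‖) ^ 2 ≤ k * ∑ i ∈ Finset.range t, ‖N o i‖ ^ 2 := by
      refine sq_sum_le_card_mul_sum_sq.trans ?_
      rw [Finset.card_range]
      gcongr
    set X := ∑ i ∈ Finset.range t, ‖N o i‖
    calc ‖run F θ (ω o) t - gd F θ t‖ ^ 2 ≤ (K * (μ * X) + ‖N o t‖) ^ 2 := by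
          gcongr
          linarith
      _ ≤ 2 * ‖N o t‖ ^ 2 + 2 * K ^ 2 * μ ^ 2 * X ^ 2 := by
          nlinarith [sq_nonneg (K * (μ * X) - ‖N o t‖)]
      _ ≤ 2 * ‖N o t‖ ^ 2
          + 2 * K ^ 2 * μ ^ 2 * (k * ∑ i ∈ Finset.range t, ‖N o i‖ ^ 2) := by gcongr
      _ = _ := by ring
  refine (mean_mono h1).trans ?_
  rw [mean_add, mean_mul_left, mean_mul_left, mean_sum]
  have h4 : ∑ i ∈ Finset.range t, mean (fun o => ‖N o i‖ ^ 2) ≤ k * V := by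
    refine (Finset.sum_le_sum fun i hi =>
      hNV i ((Finset.mem_range.1 hi).le.trans ht)).trans ?_
    rw [Finset.sum_const, Finset.card_range, nsmul_eq_mul]
    gcongr
  calc _ ≤ 2 * V + (2 * K ^ 2 * μ ^ 2 * k) * (k * V) := by
        gcongr
        exact hNV t ht
    _ = 2 * V + 2 * K ^ 2 * (k * μ) ^ 2 * V := by ring
    _ ≤ 2 * (K ^ 4 * V) + 2 * K ^ 2 * K ^ 2 * V := by
        have : 1 * V ≤ K ^ 4 * V := by
          gcongr
          exact one_le_pow₀ hK
        have := hS.mul_le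
        gcongr
        linarith
    _ = _ := by
        rw [hV]
        ring

/-- The correlation of the derivative fluctuation of batch `t` with the iterate. -/
def drift (F : Fin n → E → E) (A : Fin n → E → E →L[ℝ] E) (θ : E)
    (ω : Ω → Fin k × Fin b → Fin n) (t : ℕ) : E :=
  mean fun o => batchMean (fun z => derivDev A (gd F θ t) z (run F θ (ω o) t)) (ω o) t

/-- The recursion for the bias. The batch field is expanded to first order at the gradient descent
iterate, and the batch derivative is split into its full-batch value and a fluctuation. The
quadratic remainder is controlled by the mean square deviation. -/
theorem mean_run_succ [NeZero n] (hω : Sampling E ω) (hn : n = k * b) (hS : Scale k γ μ K)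
    (hF : ∀ z, SmoothField (F z) (A z) θ (K * (k * γ)) γ μ) {t : ℕ} (ht : t < k) :
    ‖(mean (fun o => run F θ (ω o) (t + 1)) - gd F θ (t + 1))
        - ((mean (fun o => run F θ (ω o) t) - gd F θ t)
          - (mean fun z => A z (gd F θ t)) (mean (fun o => run F θ (ω o) t) - gd F θ t)
          - drift F A θ ω t)‖ ≤ μ * (192 * K ^ 8 * (k * γ) ^ 2 / n) := by
  have hμ := hS.mu_nonneg
  have hx := gd_mem hS hF ht.le
  set x := gd F θ t with hxdef
  set B := mean fun z => A z x with hB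
  have e2 : gd F θ (t + 1) = x - mean fun z => F z x := rfl
  have hone : ∀ f : Fin n → E, mean (fun o => batchMean f (ω o) t) = mean f := by
    intro f
    simp only [batchMean]
    rw [mean_comm]
    simp only [hω.one, mean_const]
  have hdev : mean (fun o => batchMean (fun z => derivDev A x z x) (ω o) t) = 0 := by
    rw [hone, ← mean_apply, mean_derivDev, _root_.zero_apply]
  -- The fluctuation is applied to the run and to `x` separately: the former averages to the drift,
  -- the latter to zero.
  have key : ∀ o, run F θ (ω o) (t + 1) = run F θ (ω o) t
      - batchMean (fun z => F z x) (ω o) t - B (run F θ (ω o) t - x)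
      - batchMean (fun z => derivDev A x z (run F θ (ω o) t)) (ω o) t
      + batchMean (fun z => derivDev A x z x) (ω o) t
      - (batchMean (fun z => F z (run F θ (ω o) t)) (ω o) t - batchMean (fun z => F z x) (ω o) t
        - batchMean (fun z => A z x) (ω o) t (run F θ (ω o) t - x)) := by
    intro o
    have e : ∀ y, batchMean (fun z => derivDev A x z y) (ω o) t
        = batchMean (fun z => A z x) (ω o) t y - B y := by
      intro y
      rw [← batchMean_apply]
      simp only [batchMean, derivDev]
      rw [mean_sub, mean_const, _root_.sub_apply]
    rw [run_succ, e, e, map_sub, map_sub]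
    abel
  simp only [key]
  rw [mean_sub, mean_add, mean_sub, mean_sub, mean_sub, hone, hdev, ← clm_mean, mean_sub,
    mean_const, e2]
  have h3 : ‖mean fun o => batchMean (fun z => F z (run F θ (ω o) t)) (ω o) t
        - batchMean (fun z => F z x) (ω o) t
        - batchMean (fun z => A z x) (ω o) t (run F θ (ω o) t - x)‖
      ≤ μ * (192 * K ^ 8 * (k * γ) ^ 2 / n) := by
    refine (norm_mean_le_mean _).trans ?_
    refine (mean_mono fun o => (SmoothField.batch hF (ω o) t).taylor _
      (run_mem hS hF (ω o) ht.le) x hx).trans ?_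
    rw [mean_mul_left]
    gcongr
    exact mean_norm_sq_run_sub_gd_le hω hn hS hF ht.le
  rw [← norm_neg] at h3
  refine le_of_eq_of_le (congrArg _ ?_) h3
  rw [drift, ← hxdef]
  abel

/-- If the batches of the steps are independent, the expected run is close to gradient descent. -/
theorem norm_mean_run_sub_gd_le [NeZero n] (hω : Sampling E ω) (hn : n = k * b)
    (hS : Scale k γ μ K)
    (hF : ∀ z, SmoothField (F z) (A z) θ (K * (k * γ)) γ μ)
    (hdrift : ∀ t < k, drift F A θ ω t = 0) :
    ‖mean (fun o => run F θ (ω o) k) - gd F θ k‖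
      ≤ 192 * K ^ 9 * (k * μ) * (k * γ) ^ 2 / n := by
  have hμ := hS.mu_nonneg
  have hγ := hS.gamma_nonneg
  have hK := hS.one_le
  have h := gronwall hS (a := fun t => ‖mean (fun o => run F θ (ω o) t) - gd F θ t‖)
    (v := fun _ => μ * (192 * K ^ 8 * (k * γ) ^ 2 / n))
    (by simp [run, gd, traj, mean_const]) (fun t _ => by positivity) (fun t ht => ?_) le_rfl
  · refine h.trans_eq ?_
    rw [Finset.sum_const, Finset.card_range, nsmul_eq_mul]
    ring
  · have h1 := mean_run_succ hω hn hS hF ht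
    rw [hdrift t ht, sub_zero] at h1
    have h2 := (SmoothField.mean hF).norm_le _ (gd_mem hS hF ht.le)
    set e := mean (fun o => run F θ (ω o) t) - gd F θ t
    set e' := mean (fun o => run F θ (ω o) (t + 1)) - gd F θ (t + 1)
    set B := mean fun z => A z (gd F θ t)
    have h3 := B.le_of_opNorm_le h2 e
    have h4 := norm_sub_le e (B e)
    have h5 : ‖e'‖ ≤ ‖e' - (e - B e)‖ + ‖e - B e‖ := by
      simpa using norm_add_le (e' - (e - B e)) (e - B e)
    linarith

omit [NeZero b] in
-- The run before step `t` does not see batch `t`, so this batch can be redrawn independently, and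
-- the derivative fluctuation then averages to zero for each fixed iterate.
theorem drift_pi_eq_zero {β : Type*} [Fintype β] [Nonempty β] {B : β → Fin b → Fin n}
    (hB : Sampling E B) {t : ℕ} (ht : t < k) :
    drift F A θ (fun (o : Fin k → β) (p : Fin k × Fin b) => B (o p.1) p.2) t = 0 := by
  have hloc : ∀ (o : Fin k → β) c,
      run F θ (fun p : Fin k × Fin b => B (Function.update o (Fin.ofNat k t) c p.1) p.2) t
      = run F θ (fun p : Fin k × Fin b => B (o p.1) p.2) t := by
    intro o c
    refine run_congr F θ fun i hi j => ?_
    have hne : Fin.ofNat k i ≠ Fin.ofNat k t := by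
      intro he
      have := congrArg Fin.val he
      simp only [Fin.val_ofNat, Nat.mod_eq_of_lt ht, Nat.mod_eq_of_lt (hi.trans ht)] at this
      omega
    simp only [Function.update_of_ne hne]
  unfold drift
  simp only [batchMean]
  rw [mean_pi_resample (Fin.ofNat k t) (fun c (o : Fin k → β) => mean fun j =>
    derivDev A (gd F θ t) (B c j)
      (run F θ (fun p : Fin k × Fin b => B (o p.1) p.2) t))
    (fun c o c' => by simp only [hloc])]
  rw [← mean_zero (α := Fin k → β)]
  congr 1
  ext o
  rw [mean_comm]
  have h1 : ∀ (j : Fin b) (y : E),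
      mean (fun c => derivDev A (gd F θ t) (B c j) y) = 0 := by
    intro j y
    rw [hB.one j (fun z => derivDev A (gd F θ t) z y), ← mean_apply, mean_derivDev,
      _root_.zero_apply]
  simp only [h1, mean_zero]

end Deviation

/-! ### Sampling without replacement: reduction to affine runs. -/

section WithoutReplacement

variable {E : Type*} [NormedAddCommGroup E] [InnerProductSpace ℝ E] {n k b : ℕ}
  {F : Fin n → E → E} {A : Fin n → E → E →L[ℝ] E} {θ : E} {γ μ K : ℝ}

theorem sum_derivDev_apply [NeZero n] (x y : E) : ∑ z, derivDev A x z y = 0 := by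
  have h := (sum_eq_zero_iff_mean (derivDev A x)).2 (mean_derivDev A x)
  rw [← _root_.sum_apply, h, _root_.zero_apply]

omit [InnerProductSpace ℝ E] in
theorem Scale.base_mem (hS : Scale k γ μ K) : θ ∈ Metric.closedBall θ (K * (k * γ)) := by
  have hγ := hS.gamma_nonneg
  have hK := hS.one_le
  exact Metric.mem_closedBall_self (by positivity)

theorem norm_derivDev_le [NeZero n] (hF : ∀ z, SmoothField (F z) (A z) θ (K * (k * γ)) γ μ)
    {x : E} (hx : x ∈ Metric.closedBall θ (K * (k * γ))) (z : Fin n) :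
    ‖derivDev A x z‖ ≤ 2 * μ := by
  have h1 := (hF z).norm_le x hx
  have h2 := (SmoothField.mean hF).norm_le x hx
  have h3 := norm_sub_le (A z x) (mean fun z' => A z' x)
  rw [derivDev]
  linarith

theorem norm_derivDev_sub_le [NeZero n] (hF : ∀ z, SmoothField (F z) (A z) θ (K * (k * γ)) γ μ)
    {x y : E} (hx : x ∈ Metric.closedBall θ (K * (k * γ)))
    (hy : y ∈ Metric.closedBall θ (K * (k * γ))) (z : Fin n) :
    ‖derivDev A x z - derivDev A y z‖ ≤ 2 * μ * ‖x - y‖ := by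
  have h1 := (hF z).lip_deriv x hx y hy
  have h2 := (SmoothField.mean hF).lip_deriv x hx y hy
  have h3 := norm_sub_le (A z x - A z y) ((mean fun z' => A z' x) - mean fun z' => A z' y)
  rw [derivDev, derivDev, sub_sub_sub_comm]
  linarith

variable [NeZero k] [NeZero b] [NeZero n]

omit [NeZero n] in
theorem linRun_swap_sub_le (hS : Scale k γ μ K)
    (hF : ∀ z, SmoothField (F z) (A z) θ (K * (k * γ)) γ μ) (ω : Fin k × Fin b → Fin n)
    {r t : ℕ} (hr : r ≤ t) (ht : t < k) (j : Fin b) (q : Fin k × Fin b) :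
    ‖linRun F A θ ω r - linRun F A θ (ω ∘ Equiv.swap (Fin.ofNat k t, j) q) r‖
      ≤ 4 * K ^ 3 * γ * (1 / b) := by
  have hγ := hS.gamma_nonneg
  have hK := hS.one_le
  refine (linRun_sub_le hS hF _ _ (hr.trans ht.le)).trans ?_
  gcongr
  exact sum_diffFrac_swap_le ω ht j q hr

/-- Along runs without replacement, the fields may be replaced by their affine approximations. -/
theorem norm_drift_sub_le (hn : n = k * b) (hS : Scale k γ μ K)
    (hF : ∀ z, SmoothField (F z) (A z) θ (K * (k * γ)) γ μ) {t : ℕ} (ht : t < k) :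
    ‖drift F A θ (fun (σ : Fin k × Fin b ≃ Fin n) p => σ p) t
        - mean fun σ : Fin k × Fin b ≃ Fin n =>
          batchMean (fun z => derivDev A θ z (linRun F A θ σ t - θ)) σ t‖
      ≤ 40 * K ^ 8 * μ * (k * γ) ^ 2 / n := by
  have hμ := hS.mu_nonneg
  have hγ := hS.gamma_nonneg
  have hK := hS.one_le
  have hb : (0 : ℝ) < b := by exact_mod_cast Nat.pos_of_ne_zero (NeZero.ne b)
  have hk : (0 : ℝ) < k := by exact_mod_cast Nat.pos_of_ne_zero (NeZero.ne k)
  have hn' : (n : ℝ) = k * b := by exact_mod_cast hn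
  have hx := gd_mem hS hF ht.le
  have hP : Fintype.card (Fin k × Fin b) = n := by simp [hn]
  have hxθ : ‖gd F θ t - θ‖ ≤ K * (k * γ) := mem_closedBall_iff_norm.1 hx
  unfold drift
  set x := gd F θ t
  simp only [batchMean]
  rw [mean_comm, mean_comm (fun (σ : Fin k × Fin b ≃ Fin n) j =>
    derivDev A θ (σ (Fin.ofNat k t, j)) (linRun F A θ σ t - θ)), ← mean_sub]
  refine norm_mean_le fun j => ?_
  rw [← mean_sub]
  refine norm_mean_swap_le hP (Fin.ofNat k t, j)
    (fun z σ => derivDev A x z (run F θ σ t) - derivDev A θ z (linRun F A θ σ t - θ))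
    (fun σ => by rw [Finset.sum_sub_distrib, sum_derivDev_apply, sum_derivDev_apply, sub_self])
    (fun q σ => ?_)
  have h1 := run_sub_linRun_sub_le hS hF σ (σ ∘ Equiv.swap (Fin.ofNat k t, j) q) ht.le
    (sum_diffFrac_swap_le σ ht j q le_rfl)
  have h2 := linRun_swap_sub_le hS hF σ le_rfl ht j q
  have h3 := norm_derivDev_le hF hx (σ (Fin.ofNat k t, j))
  have h4 := norm_derivDev_sub_le hF hx hS.base_mem (σ (Fin.ofNat k t, j))
  rw [Equiv.coe_trans]
  set y := run F θ σ t
  set y' := run F θ (σ ∘ Equiv.swap (Fin.ofNat k t, j) q) t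
  set l := linRun F A θ σ t
  set l' := linRun F A θ (σ ∘ Equiv.swap (Fin.ofNat k t, j) q) t
  set Z := derivDev A x (σ (Fin.ofNat k t, j))
  set Z₀ := derivDev A θ (σ (Fin.ofNat k t, j))
  -- An exchange moves the affine remainder `y - l` only to second order, and it moves `l` by
  -- `O(γ/b)`, which is multiplied by the small change of the derivative from `θ` to `x`.
  have e : Z y - Z₀ (l - θ) - (Z y' - Z₀ (l' - θ))
      = Z ((y - l) - (y' - l')) + (Z - Z₀) (l - l') := by
    simp only [map_sub, _root_.sub_apply]
    abel
  rw [e]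
  calc _ ≤ ‖Z ((y - l) - (y' - l'))‖ + ‖(Z - Z₀) (l - l')‖ := norm_add_le _ _
    _ ≤ (2 * μ) * ‖(y - l) - (y' - l')‖ + (2 * μ * ‖x - θ‖) * ‖l - l'‖ :=
      add_le_add (Z.le_of_opNorm_le h3 _) ((Z - Z₀).le_of_opNorm_le h4 _)
    _ ≤ (2 * μ) * (16 * K ^ 7 * μ * (k * γ) ^ 2 * (1 / b))
        + (2 * μ * (K * (k * γ))) * (4 * K ^ 3 * γ * (1 / b)) := by gcongr
    _ = (32 * K ^ 7 * (k * μ) + 8 * K ^ 4) * (μ * (k * γ) ^ 2 / n) := by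
      rw [hn']
      field_simp
      ring
    _ ≤ (32 * K ^ 7 * K + 8 * K ^ 8) * (μ * (k * γ) ^ 2 / n) := by
      gcongr
      · exact hS.mul_le
      · norm_num
    _ = _ := by ring

theorem norm_apply₃_le {Z Z' W : E →L[ℝ] E} {c c' : ℝ} (hZ : ‖Z‖ ≤ c) (hZ' : ‖Z'‖ ≤ c')
    (x : E) : ‖Z (W (Z' x))‖ ≤ c * ‖W‖ * c' * ‖x‖ := by
  have hc : 0 ≤ c := (norm_nonneg _).trans hZ
  calc ‖Z (W (Z' x))‖ ≤ c * (‖W‖ * (c' * ‖x‖)) := by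
        refine (Z.le_of_opNorm_le hZ _).trans ?_
        gcongr
        refine (W.le_opNorm _).trans ?_
        gcongr
        exact Z'.le_of_opNorm_le hZ' _
    _ = _ := by ring

omit [NeZero n] in
/-- The effect of two exchanges on an affine run. -/
theorem linRun_swap_mixed_le (hS : Scale k γ μ K)
    (hF : ∀ z, SmoothField (F z) (A z) θ (K * (k * γ)) γ μ) (ω : Fin k × Fin b → Fin n)
    {r t : ℕ} (hr : r < t) (ht : t < k) {j j' : Fin b} {q₁ q₂ : Fin k × Fin b}
    (h1 : q₁ ≠ (Fin.ofNat k r, j')) (h2 : q₂ ≠ (Fin.ofNat k t, j)) (h3 : q₂ ≠ q₁) :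
    ‖(linRun F A θ ω r - linRun F A θ (ω ∘ Equiv.swap (Fin.ofNat k t, j) q₁) r)
      - (linRun F A θ (ω ∘ Equiv.swap (Fin.ofNat k r, j') q₂) r
        - linRun F A θ ((ω ∘ Equiv.swap (Fin.ofNat k r, j') q₂)
            ∘ Equiv.swap (Fin.ofNat k t, j) q₁) r)‖
      ≤ 4 * K * μ * (1 / b) * (4 * K ^ 3 * γ * (1 / b)) := by
  have hγ := hS.gamma_nonneg
  have hK := hS.one_le
  have hne : ∀ i i', i < i' → i' < k → ∀ j j' : Fin b,
      ((Fin.ofNat k i, j) : Fin k × Fin b) ≠ (Fin.ofNat k i', j') := by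
    intro i i' hi hi' j j' he
    have := congrArg (fun x => x.1.val) he
    simp only [Fin.val_ofNat, Nat.mod_eq_of_lt hi', Nat.mod_eq_of_lt (hi.trans hi')] at this
    omega
  have hpq : ((Fin.ofNat k r, j') : Fin k × Fin b) ≠ (Fin.ofNat k t, j) := hne r t hr ht _ _
  -- The two pairs of positions are disjoint, so the exchanges commute.
  have hcomm : (ω ∘ Equiv.swap (Fin.ofNat k r, j') q₂) ∘ Equiv.swap (Fin.ofNat k t, j) q₁
      = (ω ∘ Equiv.swap (Fin.ofNat k t, j) q₁) ∘ Equiv.swap (Fin.ofNat k r, j') q₂ := by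
    funext x
    simp only [Function.comp_apply]
    congr 1
    by_cases x1 : x = (Fin.ofNat k t, j)
    · rw [x1, Equiv.swap_apply_left, Equiv.swap_apply_of_ne_of_ne h1 h3.symm,
        Equiv.swap_apply_of_ne_of_ne hpq.symm h2.symm, Equiv.swap_apply_left]
    by_cases x2 : x = q₁
    · rw [x2, Equiv.swap_apply_right, Equiv.swap_apply_of_ne_of_ne h1 h3.symm,
        Equiv.swap_apply_of_ne_of_ne hpq.symm h2.symm, Equiv.swap_apply_right]
    rw [Equiv.swap_apply_of_ne_of_ne x1 x2]
    by_cases x3 : x = (Fin.ofNat k r, j')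
    · rw [x3, Equiv.swap_apply_left, Equiv.swap_apply_of_ne_of_ne h2 h3]
    by_cases x4 : x = q₂
    · rw [x4, Equiv.swap_apply_right, Equiv.swap_apply_of_ne_of_ne hpq h1.symm]
    · rw [Equiv.swap_apply_of_ne_of_ne x3 x4, Equiv.swap_apply_of_ne_of_ne x1 x2]
  refine linRun_mixed_le hS hF _ _ _ _ (hr.trans ht).le (fun i hi j'' => ?_)
    (sum_diffFrac_swap_le ω ht j q₁ hr.le) (sum_diffFrac_swap_le ω (hr.trans ht) j' q₂ le_rfl)
    (by positivity) (fun i hi => ?_) (fun i hi => ?_)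
  · have n1 := hne i t (hi.trans hr) ht j'' j
    have n2 := hne i r hi (hr.trans ht) j'' j'
    simp only [Function.comp_apply]
    by_cases hx : ((Fin.ofNat k i, j'') : Fin k × Fin b) = q₁
    · left
      rw [hx] at n2 ⊢
      rw [Equiv.swap_apply_of_ne_of_ne n2 h3.symm, Equiv.swap_apply_right,
        Equiv.swap_apply_of_ne_of_ne hpq.symm h2.symm]
      exact ⟨rfl, rfl⟩
    · right
      rw [Equiv.swap_apply_of_ne_of_ne n1 hx]
      exact ⟨rfl, rfl⟩
  · rw [hcomm]
    exact linRun_swap_sub_le hS hF _ hi.le (hr.trans ht) j' q₂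
  · exact linRun_swap_sub_le hS hF _ (hi.le.trans hr.le) ht j q₁

end WithoutReplacement

/-! ### Third-order correlations of derivative fluctuations with the affine run. -/

section Correlation

variable {E : Type*} [NormedAddCommGroup E] [InnerProductSpace ℝ E] {n k b : ℕ}
  {F : Fin n → E → E} {A : Fin n → E → E →L[ℝ] E} {θ : E} {γ μ K : ℝ}
  [NeZero k] [NeZero b] [NeZero n]

omit [NeZero b] in
theorem ofNat_pair_ne {i i' : ℕ} (hi : i < i') (hi' : i' < k) (j j' : Fin b) :
    ((Fin.ofNat k i, j) : Fin k × Fin b) ≠ (Fin.ofNat k i', j') := by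
  intro he
  have := congrArg (fun x => x.1.val) he
  simp only [Fin.val_ofNat, Nat.mod_eq_of_lt hi', Nat.mod_eq_of_lt (hi.trans hi')] at this
  omega

variable (F A θ) in
/-- The centred affine run. -/
def linDev (r : ℕ) (σ : Fin k × Fin b ≃ Fin n) : E :=
  linRun F A θ σ r - mean fun σ : Fin k × Fin b ≃ Fin n => linRun F A θ σ r

omit [NeZero b] [NeZero n] in
theorem mean_linDev (hn : n = k * b) (r : ℕ) :
    mean (linDev F A θ r : (Fin k × Fin b ≃ Fin n) → E) = 0 := by
  have : Nonempty (Fin k × Fin b ≃ Fin n) := ⟨Fintype.equivFinOfCardEq (by simp [hn])⟩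
  have h := mean_sub (fun σ : Fin k × Fin b ≃ Fin n => linRun F A θ σ r)
    fun _ => mean fun σ : Fin k × Fin b ≃ Fin n => linRun F A θ σ r
  rw [mean_const, sub_self] at h
  exact h

omit [NeZero b] [NeZero n] in
-- The run up to time `r` uses neither batch `r` nor batch `t`.
theorem linDev_swap_eq {r t : ℕ} (hr : r < t) (ht : t < k) (j j' : Fin b)
    (σ : Fin k × Fin b ≃ Fin n) :
    linDev F A θ r ((Equiv.swap (Fin.ofNat k t, j) (Fin.ofNat k r, j')).trans σ)
      = linDev F A θ r σ := by
  rw [linDev, linDev]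
  congr 1
  refine run_congr _ θ fun i hi j'' => ?_
  rw [Equiv.trans_apply, Equiv.swap_apply_of_ne_of_ne (ofNat_pair_ne (hi.trans hr) ht _ _)
    (ofNat_pair_ne hi (hr.trans ht) _ _)]

/-- Since `linDev` is centred, the average of the quadratic expression over the data point may be
subtracted; an exchange then gains the factor `γ/b`. -/
theorem norm_mean_quadratic_linDev_le (hn : n = k * b) (hS : Scale k γ μ K)
    (hF : ∀ z, SmoothField (F z) (A z) θ (K * (k * γ)) γ μ) {r t : ℕ} (hr : r ≤ t) (ht : t < k)
    (j : Fin b) (W : E →L[ℝ] E) :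
    ‖mean fun σ : Fin k × Fin b ≃ Fin n => derivDev A θ (σ (Fin.ofNat k t, j))
        (W (derivDev A θ (σ (Fin.ofNat k t, j)) (linDev F A θ r σ)))‖
      ≤ 8 * μ ^ 2 * ‖W‖ * (4 * K ^ 3 * γ * (1 / b)) := by
  have hμ := hS.mu_nonneg
  have hP : Fintype.card (Fin k × Fin b) = n := by simp [hn]
  have : Nonempty (Fin k × Fin b ≃ Fin n) := ⟨Fintype.equivFinOfCardEq hP⟩
  have hZ := norm_derivDev_le hF hS.base_mem
  let Q : Fin n → E →L[ℝ] E := fun z => derivDev A θ z ∘L W ∘L derivDev A θ z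
  have hQ : ∀ z, ‖Q z‖ ≤ 4 * μ ^ 2 * ‖W‖ := fun z => by
    refine ContinuousLinearMap.opNorm_le_bound _ (by positivity) fun x => ?_
    exact (norm_apply₃_le (hZ z) (hZ z) x).trans_eq (by ring)
  have hQm : ‖mean Q‖ ≤ 4 * μ ^ 2 * ‖W‖ := norm_mean_le hQ
  have h0 : mean (fun σ : Fin k × Fin b ≃ Fin n => mean Q (linDev F A θ r σ)) = 0 := by
    rw [← clm_mean, mean_linDev hn, map_zero]
  have h1 : (mean fun σ : Fin k × Fin b ≃ Fin n => derivDev A θ (σ (Fin.ofNat k t, j))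
        (W (derivDev A θ (σ (Fin.ofNat k t, j)) (linDev F A θ r σ))))
      = mean fun σ : Fin k × Fin b ≃ Fin n =>
        (Q (σ (Fin.ofNat k t, j)) - mean Q) (linDev F A θ r σ) := by
    simp only [_root_.sub_apply]
    rw [mean_sub, h0, sub_zero]
    rfl
  rw [h1]
  refine norm_mean_swap_le hP (Fin.ofNat k t, j) (fun z σ => (Q z - mean Q) (linDev F A θ r σ))
    (fun σ => by rw [← _root_.sum_apply, sum_sub_mean, _root_.zero_apply]) (fun q σ => ?_)
  have h2 : ‖Q (σ (Fin.ofNat k t, j)) - mean Q‖ ≤ 8 * μ ^ 2 * ‖W‖ := by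
    have := norm_sub_le (Q (σ (Fin.ofNat k t, j))) (mean Q)
    have := hQ (σ (Fin.ofNat k t, j))
    linarith
  rw [← map_sub]
  refine (ContinuousLinearMap.le_of_opNorm_le _ h2 _).trans ?_
  have h3 := linRun_swap_sub_le hS hF σ hr ht j q
  rw [linDev, linDev, sub_sub_sub_cancel_right, Equiv.coe_trans]
  gcongr

/-- A second exchange, applied to the increment left by a first one. For all but two partners it
yields a mixed second difference of order `μ/b` times the first increment. Summed over `n = kb`
partners this is `kμ ≤ K`, and the two exceptional partners are estimated crudely, so a further
factor `1/n` is gained. -/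
theorem norm_mean_exchange_le (hn : n = k * b) (hS : Scale k γ μ K)
    (hF : ∀ z, SmoothField (F z) (A z) θ (K * (k * γ)) γ μ) {r t : ℕ} (hr : r < t) (ht : t < k)
    (j j' : Fin b) (W : E →L[ℝ] E) {q₁ : Fin k × Fin b} (hq₁ : q₁ ≠ (Fin.ofNat k r, j')) :
    n * ‖mean fun σ : Fin k × Fin b ≃ Fin n => derivDev A θ (σ (Fin.ofNat k t, j))
        (W (derivDev A θ (σ (Fin.ofNat k r, j'))
          (linRun F A θ σ r - linRun F A θ (σ ∘ Equiv.swap (Fin.ofNat k t, j) q₁) r)))‖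
      ≤ μ ^ 2 * ‖W‖ * (16 * K ^ 2 + 16) * (4 * K ^ 3 * γ * (1 / b)) := by
  have hμ := hS.mu_nonneg
  have hγ := hS.gamma_nonneg
  have hK := hS.one_le
  have hb : (0 : ℝ) < b := by exact_mod_cast Nat.pos_of_ne_zero (NeZero.ne b)
  have hn' : (n : ℝ) = k * b := by exact_mod_cast hn
  have hP : Fintype.card (Fin k × Fin b) = n := by simp [hn]
  have : Nonempty (Fin k × Fin b ≃ Fin n) := ⟨Fintype.equivFinOfCardEq hP⟩
  have hZ := norm_derivDev_le hF hS.base_mem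
  set d := 4 * K ^ 3 * γ * (1 / b) with hd
  have hd0 : 0 ≤ d := by positivity
  set p : Fin k × Fin b := (Fin.ofNat k t, j) with hp
  set q : Fin k × Fin b := (Fin.ofNat k r, j') with hq
  have hpq : q ≠ p := ofNat_pair_ne hr ht j' j
  let D : (Fin k × Fin b ≃ Fin n) → E := fun σ =>
    linRun F A θ σ r - linRun F A θ (σ ∘ Equiv.swap p q₁) r
  have hD : ∀ σ, ‖D σ‖ ≤ d := fun σ => linRun_swap_sub_le hS hF σ hr.le ht j q₁
  have h := mean_swap hP q (fun z σ => derivDev A θ (σ p) (W (derivDev A θ z (D σ))))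
    (fun σ => by rw [← map_sum, ← map_sum, sum_derivDev_apply, map_zero, map_zero])
  have h1 : n * ‖mean fun σ : Fin k × Fin b ≃ Fin n =>
      derivDev A θ (σ p) (W (derivDev A θ (σ q) (D σ)))‖
      = ‖(n : ℝ) • mean fun σ : Fin k × Fin b ≃ Fin n =>
      derivDev A θ (σ p) (W (derivDev A θ (σ q) (D σ)))‖ := by
    rw [norm_smul, RCLike.norm_natCast]
  change n * ‖mean fun σ : Fin k × Fin b ≃ Fin n =>
      derivDev A θ (σ p) (W (derivDev A θ (σ q) (D σ)))‖ ≤ _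
  rw [h1, h]
  have h2 : ∀ q₂ ∈ Finset.univ, ‖mean fun σ : Fin k × Fin b ≃ Fin n =>
      derivDev A θ (σ p) (W (derivDev A θ (σ q) (D σ)))
        - derivDev A θ (((Equiv.swap q q₂).trans σ) p)
          (W (derivDev A θ (σ q) (D ((Equiv.swap q q₂).trans σ))))‖
      ≤ 4 * μ ^ 2 * ‖W‖ * (4 * K * μ * (1 / b) * d)
        + ((if q₂ = p then 8 * μ ^ 2 * ‖W‖ * d else 0)
          + (if q₂ = q₁ then 8 * μ ^ 2 * ‖W‖ * d else 0)) := by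
    intro q₂ _
    refine norm_mean_le fun σ => ?_
    -- For these two partners the exchanges interfere, and each term is estimated separately.
    by_cases hc : q₂ = p ∨ q₂ = q₁
    · have i1 := norm_apply₃_le (W := W) (hZ (σ p)) (hZ (σ q)) (D σ)
      have i2 := norm_apply₃_le (W := W) (hZ (((Equiv.swap q q₂).trans σ) p)) (hZ (σ q))
        (D ((Equiv.swap q q₂).trans σ))
      have i3 : 2 * μ * ‖W‖ * (2 * μ) * ‖D σ‖ ≤ 2 * μ * ‖W‖ * (2 * μ) * d := by
        have := hD σ
        gcongr
      have i4 : 2 * μ * ‖W‖ * (2 * μ) * ‖D ((Equiv.swap q q₂).trans σ)‖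
          ≤ 2 * μ * ‖W‖ * (2 * μ) * d := by
        have := hD ((Equiv.swap q q₂).trans σ)
        gcongr
      have i5 : 8 * μ ^ 2 * ‖W‖ * d ≤ (if q₂ = p then 8 * μ ^ 2 * ‖W‖ * d else 0)
          + (if q₂ = q₁ then 8 * μ ^ 2 * ‖W‖ * d else 0) := by
        have : 0 ≤ 8 * μ ^ 2 * ‖W‖ * d := by positivity
        rcases hc with hc | hc
        · rw [if_pos hc]
          split_ifs <;> linarith
        · rw [if_pos hc]
          split_ifs <;> linarith
      have i6 : 0 ≤ 4 * μ ^ 2 * ‖W‖ * (4 * K * μ * (1 / b) * d) := by positivity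
      refine (norm_sub_le _ _).trans ?_
      linarith
    · push Not at hc
      rw [if_neg hc.1, if_neg hc.2, add_zero, add_zero, Equiv.trans_apply,
        Equiv.swap_apply_of_ne_of_ne hpq.symm hc.1.symm, ← map_sub, ← map_sub, ← map_sub]
      refine (norm_apply₃_le (hZ _) (hZ _) _).trans ?_
      have i1 := linRun_swap_mixed_le hS hF σ hr ht hq₁ hc.1 hc.2
      have i2 : ‖D σ - D ((Equiv.swap q q₂).trans σ)‖ ≤ 4 * K * μ * (1 / b) * d := i1
      calc _ ≤ 2 * μ * ‖W‖ * (2 * μ) * (4 * K * μ * (1 / b) * d) := by gcongr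
        _ = _ := by ring
  refine (norm_sum_le_of_le _ h2).trans ?_
  rw [Finset.sum_add_distrib, Finset.sum_add_distrib, Finset.sum_ite_eq', Finset.sum_ite_eq',
    if_pos (Finset.mem_univ _), if_pos (Finset.mem_univ _), Finset.sum_const, Finset.card_univ, hP,
    nsmul_eq_mul, hn']
  calc _ = μ ^ 2 * ‖W‖ * (16 * K * (k * μ) + 16) * d := by
        field_simp
        ring
    _ ≤ μ ^ 2 * ‖W‖ * (16 * K * K + 16) * d := by
        gcongr
        exact hS.mul_le
    _ = _ := by ring

/-- Exchanging at `p` expresses `n X` by increments. The exchange with `q` gives `X - Y`, with `Y`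
the quadratic average; every other one is `O(1/n)` by `norm_mean_exchange_le`. Hence `(n - 1) X` is
of order `γ/b`, and `X` of order `kγ/n²`. -/
theorem norm_mean_bilinear_linDev_le (hn : n = k * b) (hn2 : 2 ≤ n) (hS : Scale k γ μ K)
    (hF : ∀ z, SmoothField (F z) (A z) θ (K * (k * γ)) γ μ) {r t : ℕ} (hr : r < t) (ht : t < k)
    (j j' : Fin b) (W : E →L[ℝ] E) :
    ‖mean fun σ : Fin k × Fin b ≃ Fin n => derivDev A θ (σ (Fin.ofNat k t, j))
        (W (derivDev A θ (σ (Fin.ofNat k r, j')) (linDev F A θ r σ)))‖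
      ≤ 320 * K ^ 5 * μ ^ 2 * ‖W‖ * (k * γ) / n ^ 2 := by
  have hμ := hS.mu_nonneg
  have hγ := hS.gamma_nonneg
  have hK := hS.one_le
  have hb : (0 : ℝ) < b := by exact_mod_cast Nat.pos_of_ne_zero (NeZero.ne b)
  have hk : (0 : ℝ) < k := by exact_mod_cast Nat.pos_of_ne_zero (NeZero.ne k)
  have hn' : (n : ℝ) = k * b := by exact_mod_cast hn
  have hn2' : (2 : ℝ) ≤ n := by exact_mod_cast hn2
  have hP : Fintype.card (Fin k × Fin b) = n := by simp [hn]
  set d := 4 * K ^ 3 * γ * (1 / b) with hd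
  have hd0 : 0 ≤ d := by positivity
  have hquad := norm_mean_quadratic_linDev_le hn hS hF hr.le ht j W
  have hexch := fun q₁ (hq : q₁ ≠ (Fin.ofNat k r, j')) =>
    norm_mean_exchange_le hn hS hF hr ht j j' W hq
  have hswap := linDev_swap_eq (F := F) (A := A) (θ := θ) (n := n) hr ht j j'
  set p : Fin k × Fin b := (Fin.ofNat k t, j) with hp
  set q : Fin k × Fin b := (Fin.ofNat k r, j') with hq
  have hpq : q ≠ p := ofNat_pair_ne hr ht j' j
  set X := mean fun σ : Fin k × Fin b ≃ Fin n =>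
    derivDev A θ (σ p) (W (derivDev A θ (σ q) (linDev F A θ r σ))) with hX
  set Y := mean fun σ : Fin k × Fin b ≃ Fin n =>
    derivDev A θ (σ p) (W (derivDev A θ (σ p) (linDev F A θ r σ))) with hY
  have h := mean_swap hP p
    (fun z (σ : Fin k × Fin b ≃ Fin n) =>
      derivDev A θ z (W (derivDev A θ (σ q) (linDev F A θ r σ))))
    (fun σ => sum_derivDev_apply _ _)
  -- The partner `q` is special: the exchange turns `σ q` into `σ p` and leaves the run up to time
  -- `r` unchanged.
  rw [← hX, ← Finset.add_sum_erase _ _ (Finset.mem_univ q)] at h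
  simp only [Equiv.trans_apply, Equiv.swap_apply_right, hswap] at h
  rw [mean_sub, ← hX, ← hY] at h
  have h2 : ‖∑ q₁ ∈ Finset.univ.erase q, mean fun σ : Fin k × Fin b ≃ Fin n =>
      derivDev A θ (σ p) (W (derivDev A θ (σ q) (linDev F A θ r σ)))
      - derivDev A θ (σ p) (W (derivDev A θ (σ (Equiv.swap p q₁ q))
          (linDev F A θ r ((Equiv.swap p q₁).trans σ))))‖
      ≤ μ ^ 2 * ‖W‖ * (16 * K ^ 2 + 16) * d := by
    refine (norm_sum_le_of_le (Finset.univ.erase q)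
      (f := fun q₁ => _) (n := fun _ => (μ ^ 2 * ‖W‖ * (16 * K ^ 2 + 16) * d) / n)
      fun q₁ hq₁ => ?_).trans ?_
    · have hne : q₁ ≠ q := Finset.ne_of_mem_erase hq₁
      have h3 := hexch q₁ hne
      rw [le_div_iff₀' (by linarith)]
      refine le_of_eq_of_le ?_ h3
      congr 3
      ext σ
      rw [Equiv.swap_apply_of_ne_of_ne hpq hne.symm, ← map_sub, ← map_sub, ← map_sub, linDev,
        linDev, sub_sub_sub_cancel_right, Equiv.coe_trans]
    · rw [Finset.sum_const, Finset.card_erase_of_mem (Finset.mem_univ _), Finset.card_univ, hP,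
        nsmul_eq_mul, mul_div_assoc', div_le_iff₀ (by linarith), mul_comm]
      gcongr
      omega
  set S := ∑ q₁ ∈ Finset.univ.erase q, mean fun σ : Fin k × Fin b ≃ Fin n =>
      derivDev A θ (σ p) (W (derivDev A θ (σ q) (linDev F A θ r σ)))
      - derivDev A θ (σ p) (W (derivDev A θ (σ (Equiv.swap p q₁ q))
          (linDev F A θ r ((Equiv.swap p q₁).trans σ))))
  have h4 : ((n : ℝ) - 1) • X = S - Y := by
    rw [sub_smul, h, one_smul]
    abel
  have h5 : ((n : ℝ) - 1) * ‖X‖ ≤ μ ^ 2 * ‖W‖ * (16 * K ^ 2 + 24) * d := by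
    have := congrArg norm h4
    rw [norm_smul, Real.norm_of_nonneg (by linarith)] at this
    rw [this]
    refine (norm_sub_le _ _).trans ((add_le_add h2 hquad).trans_eq ?_)
    ring
  have h6 : ‖X‖ * n ≤ 2 * (μ ^ 2 * ‖W‖ * (16 * K ^ 2 + 24) * d) := by
    nlinarith [norm_nonneg X]
  have h7 : μ ^ 2 * ‖W‖ * (16 * K ^ 2 + 24) * d ≤ μ ^ 2 * ‖W‖ * (16 * K ^ 2 + 24 * K ^ 2) * d := by
    have : 1 ≤ K ^ 2 := one_le_pow₀ hK
    gcongr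
    linarith
  rw [pow_two (n : ℝ), ← div_div, le_div_iff₀ (by linarith)]
  calc ‖X‖ * n ≤ 2 * (μ ^ 2 * ‖W‖ * (16 * K ^ 2 + 24 * K ^ 2) * d) := by linarith
    _ = _ := by
      rw [hd, hn']
      field_simp
      ring

end Correlation

/-! ### The drift of an affine run without replacement. -/

section Drift

variable {E : Type*} [NormedAddCommGroup E] [InnerProductSpace ℝ E] {n k b : ℕ}
  {F : Fin n → E → E} {A : Fin n → E → E →L[ℝ] E} {θ : E} {γ μ K : ℝ}

/-- The derivative at `θ` of a step of full-batch gradient descent. -/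
def stepDeriv (A : Fin n → E → E →L[ℝ] E) (θ : E) : E →L[ℝ] E := 1 - mean fun z => A z θ

/-- The covariance of the derivatives and the fields at `θ`, with `W` in between. -/
def fieldCorr (F : Fin n → E → E) (A : Fin n → E → E →L[ℝ] E) (θ : E) (W : E →L[ℝ] E) : E :=
  ((n : ℝ) - 1)⁻¹ • mean fun z => derivDev A θ z (W (F z θ))

theorem norm_pow_stepDeriv_le [NeZero n] (hS : Scale k γ μ K)
    (hF : ∀ z, SmoothField (F z) (A z) θ (K * (k * γ)) γ μ) {v : ℕ} (hv : v ≤ k) :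
    ‖stepDeriv A θ ^ v‖ ≤ K := by
  have hμ := hS.mu_nonneg
  have hK := hS.one_le
  have h1 : ‖stepDeriv A θ‖ ≤ 1 + μ := by
    refine (norm_sub_le _ _).trans (add_le_add ContinuousLinearMap.norm_id_le ?_)
    exact (SmoothField.mean hF).norm_le θ hS.base_mem
  have h2 : ‖stepDeriv A θ ^ v‖ ≤ (1 + μ) ^ v := by
    induction v with
    | zero =>
      rw [pow_zero, pow_zero]
      exact ContinuousLinearMap.norm_id_le
    | succ v ih =>
      rw [pow_succ, pow_succ]
      have := ih (by omega)
      exact (norm_mul_le _ _).trans (by gcongr)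
  exact h2.trans ((pow_le_pow_right₀ (by linarith) hv).trans hS.pow_le)

variable [NeZero k] [NeZero b] [NeZero n]

/-- On average the affine run is driven by the full-batch field; the derivative fluctuations
contribute only `O(μγ/b)` per step by an exchange. This is why the full gradient, not `G`,
accompanies `H` in the final error. -/
theorem norm_mean_linRun_sub_le (hn : n = k * b) (hS : Scale k γ μ K)
    (hF : ∀ z, SmoothField (F z) (A z) θ (K * (k * γ)) γ μ) {r : ℕ} (hr : r ≤ k) :
    ‖mean fun σ : Fin k × Fin b ≃ Fin n => linRun F A θ σ r - θ‖
      ≤ K * k * ‖mean fun z => F z θ‖ + 8 * K ^ 5 * (k * γ) / n := by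
  have hμ := hS.mu_nonneg
  have hγ := hS.gamma_nonneg
  have hK := hS.one_le
  have hb : (0 : ℝ) < b := by exact_mod_cast Nat.pos_of_ne_zero (NeZero.ne b)
  have hk : (0 : ℝ) < k := by exact_mod_cast Nat.pos_of_ne_zero (NeZero.ne k)
  have hn' : (n : ℝ) = k * b := by exact_mod_cast hn
  have hP : Fintype.card (Fin k × Fin b) = n := by simp [hn]
  have : Nonempty (Fin k × Fin b ≃ Fin n) := ⟨Fintype.equivFinOfCardEq hP⟩
  have h := gronwall hS
    (a := fun r => ‖mean fun σ : Fin k × Fin b ≃ Fin n => linRun F A θ σ r - θ‖)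
    (v := fun _ => ‖mean fun z => F z θ‖ + 2 * μ * (4 * K ^ 3 * γ * (1 / b)))
    (by simp [linRun, run, traj, mean_zero]) (fun t _ => by positivity) (fun r hr => ?_) hr
  · refine h.trans ?_
    rw [Finset.sum_const, Finset.card_range, nsmul_eq_mul]
    calc K * (r * (‖mean fun z => F z θ‖ + 2 * μ * (4 * K ^ 3 * γ * (1 / b))))
        ≤ K * (k * (‖mean fun z => F z θ‖ + 2 * μ * (4 * K ^ 3 * γ * (1 / b)))) := by gcongr
      _ = K * k * ‖mean fun z => F z θ‖ + 8 * K ^ 4 * (k * μ) * (k * γ) / n := by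
        rw [hn']
        field_simp
        ring
      _ ≤ K * k * ‖mean fun z => F z θ‖ + 8 * K ^ 4 * K * (k * γ) / n := by
        gcongr
        exact hS.mul_le
      _ = _ := by ring
  · have e : ∀ σ : Fin k × Fin b ≃ Fin n, linRun F A θ σ (r + 1) - θ
        = (linRun F A θ σ r - θ) - (mean fun z => A z θ) (linRun F A θ σ r - θ)
          - batchMean (fun z => F z θ) σ r
          - batchMean (fun z => derivDev A θ z (linRun F A θ σ r - θ)) σ r := by
      intro σ
      have e1 : batchMean (fun z => derivDev A θ z (linRun F A θ σ r - θ)) σ r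
          = batchMean (fun z => A z θ) σ r (linRun F A θ σ r - θ)
            - (mean fun z => A z θ) (linRun F A θ σ r - θ) := by
        rw [← batchMean_apply, ← _root_.sub_apply]
        congr 1
        simp only [batchMean, derivDev]
        rw [mean_sub, mean_const]
      rw [linRun_succ, e1]
      abel
    have h1 : ‖mean fun σ : Fin k × Fin b ≃ Fin n =>
        batchMean (fun z => derivDev A θ z (linRun F A θ σ r - θ)) σ r‖
        ≤ 2 * μ * (4 * K ^ 3 * γ * (1 / b)) := by
      simp only [batchMean]
      rw [mean_comm]
      refine norm_mean_le fun j => ?_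
      refine norm_mean_swap_le hP (Fin.ofNat k r, j)
        (fun z σ => derivDev A θ z (linRun F A θ σ r - θ)) (fun σ => sum_derivDev_apply _ _)
        fun q σ => ?_
      rw [← map_sub, sub_sub_sub_cancel_right]
      refine (ContinuousLinearMap.le_of_opNorm_le _ (norm_derivDev_le hF hS.base_mem _) _).trans ?_
      have := linRun_swap_sub_le hS hF σ le_rfl hr j q
      rw [Equiv.coe_trans]
      gcongr
    have h2 : mean (fun σ : Fin k × Fin b ≃ Fin n => batchMean (fun z => F z θ) σ r)
        = mean fun z => F z θ := by
      simp only [batchMean]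
      rw [mean_comm]
      simp only [mean_equiv_apply hP _ (fun z => F z θ), mean_const]
    have h3 := (SmoothField.mean hF).norm_le θ hS.base_mem
    simp only [e]
    rw [mean_sub, mean_sub, mean_sub, h2, ← clm_mean]
    set m := mean fun σ : Fin k × Fin b ≃ Fin n => linRun F A θ σ r - θ
    have h4 := ContinuousLinearMap.le_of_opNorm_le _ h3 m
    refine (norm_sub_le _ _).trans ?_
    refine (add_le_add (norm_sub_le _ _) h1).trans ?_
    have h5 := norm_sub_le m ((mean fun z => A z θ) m)
    linarith

/-- The displacement is split into its mean `m` and a centred part. For `m` the pair formula leaves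
an average of `Z W Z m`, controlled by the variance constant `ν`; the centred part is of order
`1/n²`. -/
theorem norm_mean_bilinear_le (hn : n = k * b) (hn2 : 2 ≤ n) (hS : Scale k γ μ K)
    (hF : ∀ z, SmoothField (F z) (A z) θ (K * (k * γ)) γ μ) {ν : ℝ} (hν0 : 0 ≤ ν)
    (hν : ∀ (W : E →L[ℝ] E) (x : E), ‖mean fun z => derivDev A θ z (W (derivDev A θ z x))‖
      ≤ ν * ‖W‖ * ‖x‖) (hνμ : ν ≤ 4 * μ ^ 2) {r t : ℕ} (hr : r < t) (ht : t < k)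
    (j : Fin b) (W : E →L[ℝ] E) :
    ‖mean fun σ : Fin k × Fin b ≃ Fin n => derivDev A θ (σ (Fin.ofNat k t, j))
        (W (batchMean (fun z => derivDev A θ z (linRun F A θ σ r - θ)) σ r))‖
      ≤ (2 * K * ν * k * ‖mean fun z => F z θ‖ / n
          + 384 * K ^ 5 * μ ^ 2 * (k * γ) / n ^ 2) * ‖W‖ := by
  have hμ := hS.mu_nonneg
  have hγ := hS.gamma_nonneg
  have hK := hS.one_le
  have hn2' : (2 : ℝ) ≤ n := by exact_mod_cast hn2
  have hP : Fintype.card (Fin k × Fin b) = n := by simp [hn]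
  have : Nonempty (Fin k × Fin b ≃ Fin n) := ⟨Fintype.equivFinOfCardEq hP⟩
  simp only [batchMean, clm_mean]
  rw [mean_comm]
  refine norm_mean_le fun j' => ?_
  have hm := norm_mean_linRun_sub_le hn hS hF (hr.trans ht).le
  set m := mean fun σ : Fin k × Fin b ≃ Fin n => linRun F A θ σ r - θ with hmdef
  have e : ∀ σ : Fin k × Fin b ≃ Fin n, linRun F A θ σ r - θ = m + linDev F A θ r σ := by
    intro σ
    rw [hmdef, linDev, mean_sub, mean_const]
    abel
  simp only [e, map_add]
  rw [mean_add]
  have h1 := mean_equiv_pair hP (ofNat_pair_ne hr ht j' j).symm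
    (fun z z' => derivDev A θ z (W (derivDev A θ z' m))) (fun z' => sum_derivDev_apply _ _)
  have h2 := norm_mean_bilinear_linDev_le hn hn2 hS hF hr ht j j' W
  set X := mean fun σ : Fin k × Fin b ≃ Fin n => derivDev A θ (σ (Fin.ofNat k t, j))
    (W (derivDev A θ (σ (Fin.ofNat k r, j')) m))
  have h3 : ((n : ℝ) - 1) * ‖X‖ ≤ ν * ‖W‖ * ‖m‖ := by
    have h4 := congrArg norm h1
    rw [norm_smul, Real.norm_of_nonneg (by linarith), norm_neg] at h4
    rw [h4]
    exact hν W m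
  have h5 : ‖X‖ ≤ 2 * ν * ‖W‖ * ‖m‖ / n := by
    rw [le_div_iff₀ (by linarith)]
    nlinarith [norm_nonneg X]
  refine (norm_add_le _ _).trans ((add_le_add h5 h2).trans ?_)
  calc 2 * ν * ‖W‖ * ‖m‖ / n + 320 * K ^ 5 * μ ^ 2 * ‖W‖ * (k * γ) / n ^ 2
      ≤ 2 * ν * ‖W‖ * (K * k * ‖mean fun z => F z θ‖ + 8 * K ^ 5 * (k * γ) / n) / n
        + 320 * K ^ 5 * μ ^ 2 * ‖W‖ * (k * γ) / n ^ 2 := by gcongr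
    _ = 2 * K * ν * k * ‖mean fun z => F z θ‖ / n * ‖W‖
        + ν * (16 * K ^ 5 * (k * γ) / n ^ 2 * ‖W‖)
        + 320 * K ^ 5 * μ ^ 2 * ‖W‖ * (k * γ) / n ^ 2 := by
      field_simp
      ring
    _ ≤ 2 * K * ν * k * ‖mean fun z => F z θ‖ / n * ‖W‖
        + (4 * μ ^ 2) * (16 * K ^ 5 * (k * γ) / n ^ 2 * ‖W‖)
        + 320 * K ^ 5 * μ ^ 2 * ‖W‖ * (k * γ) / n ^ 2 := by gcongr
    _ = _ := by ring

/-- The correlation of the derivative at a future data point with the affine run. -/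
theorem norm_mean_derivDev_linRun_sub_le (hn : n = k * b) (hn2 : 2 ≤ n) (hS : Scale k γ μ K)
    (hF : ∀ z, SmoothField (F z) (A z) θ (K * (k * γ)) γ μ) {ν : ℝ} (hν0 : 0 ≤ ν)
    (hν : ∀ (W : E →L[ℝ] E) (x : E), ‖mean fun z => derivDev A θ z (W (derivDev A θ z x))‖
      ≤ ν * ‖W‖ * ‖x‖) (hνμ : ν ≤ 4 * μ ^ 2) {t : ℕ} (ht : t < k)
    (j : Fin b) {r : ℕ} (hr : r ≤ t) (W : E →L[ℝ] E) :
    ‖(mean fun σ : Fin k × Fin b ≃ Fin n => derivDev A θ (σ (Fin.ofNat k t, j))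
        (W (linRun F A θ σ r - θ)))
        - ∑ v ∈ Finset.range r, fieldCorr F A θ (W * stepDeriv A θ ^ v)‖
      ≤ (2 * K * ν * k * ‖mean fun z => F z θ‖ / n
          + 384 * K ^ 5 * μ ^ 2 * (k * γ) / n ^ 2)
        * ∑ v ∈ Finset.range r, ‖W * stepDeriv A θ ^ v‖ := by
  have hn2' : (2 : ℝ) ≤ n := by exact_mod_cast hn2
  have hP : Fintype.card (Fin k × Fin b) = n := by simp [hn]
  -- Unrolling the last step before time `r` multiplies `W` by `stepDeriv A θ` on the right, so `W`
  -- must vary in the induction.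
  induction r generalizing W with
  | zero => simp [linRun, run, traj, mean_zero]
  | succ r ih =>
    have h1 := ih (by omega) (W * stepDeriv A θ)
    have h2 := norm_mean_bilinear_le hn hn2 hS hF hν0 hν hνμ (Nat.lt_of_succ_le hr) ht j W
    have e : ∀ σ : Fin k × Fin b ≃ Fin n, linRun F A θ σ (r + 1) - θ
        = stepDeriv A θ (linRun F A θ σ r - θ) - batchMean (fun z => F z θ) σ r
          - batchMean (fun z => derivDev A θ z (linRun F A θ σ r - θ)) σ r := by
      intro σ
      have e1 : batchMean (fun z => derivDev A θ z (linRun F A θ σ r - θ)) σ r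
          = batchMean (fun z => A z θ) σ r (linRun F A θ σ r - θ)
            - (mean fun z => A z θ) (linRun F A θ σ r - θ) := by
        rw [← batchMean_apply, ← _root_.sub_apply]
        congr 1
        simp only [batchMean, derivDev]
        rw [mean_sub, mean_const]
      rw [linRun_succ, e1, stepDeriv, _root_.sub_apply, one_apply_eq_self]
      abel
    have h3 : mean (fun σ : Fin k × Fin b ≃ Fin n => derivDev A θ (σ (Fin.ofNat k t, j))
        (W (batchMean (fun z => F z θ) σ r))) = -fieldCorr F A θ W := by
      simp only [batchMean, clm_mean]
      rw [mean_comm]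
      have h4 : ∀ j' : Fin b, mean (fun σ : Fin k × Fin b ≃ Fin n =>
          derivDev A θ (σ (Fin.ofNat k t, j)) (W (F (σ (Fin.ofNat k r, j')) θ)))
          = -fieldCorr F A θ W := by
        intro j'
        -- Only the derivative fluctuation has to be centred here; the field `F` at the earlier
        -- position need not be.
        have h5 := mean_equiv_pair hP (ofNat_pair_ne (Nat.lt_of_succ_le hr) ht j' j).symm
          (fun z z' => derivDev A θ z (W (F z' θ))) (fun z' => sum_derivDev_apply _ _)
        rw [fieldCorr, ← smul_neg, ← h5, smul_smul, inv_mul_cancel₀ (by linarith), one_smul]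
      simp only [h4, mean_const]
    have e5 : ∀ σ : Fin k × Fin b ≃ Fin n, derivDev A θ (σ (Fin.ofNat k t, j))
        (W (linRun F A θ σ (r + 1) - θ))
        = derivDev A θ (σ (Fin.ofNat k t, j)) ((W * stepDeriv A θ) (linRun F A θ σ r - θ))
          - derivDev A θ (σ (Fin.ofNat k t, j)) (W (batchMean (fun z => F z θ) σ r))
          - derivDev A θ (σ (Fin.ofNat k t, j))
            (W (batchMean (fun z => derivDev A θ z (linRun F A θ σ r - θ)) σ r)) := by
      intro σ
      rw [e, map_sub, map_sub, map_sub, map_sub]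
      rfl
    simp only [e5]
    rw [mean_sub, mean_sub, h3, Finset.sum_range_succ', Finset.sum_range_succ']
    have e4 : ∀ v, W * stepDeriv A θ ^ (v + 1) = W * stepDeriv A θ * stepDeriv A θ ^ v := by
      intro v
      rw [pow_succ', mul_assoc]
    simp only [e4, pow_zero, mul_one]
    set U := mean fun σ : Fin k × Fin b ≃ Fin n => derivDev A θ (σ (Fin.ofNat k t, j))
      (W (batchMean (fun z => derivDev A θ z (linRun F A θ σ r - θ)) σ r))
    rw [mul_add]
    refine le_trans (le_of_eq_of_le (congrArg _ ?_) (norm_sub_le _ U)) (add_le_add h1 h2)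
    abel

end Drift

/-! ### Solving the recursion for the bias. -/

section Bias

variable {E : Type*} [NormedAddCommGroup E] [InnerProductSpace ℝ E] {n k b : ℕ}
  {F : Fin n → E → E} {A : Fin n → E → E →L[ℝ] E} {θ : E} {γ μ K : ℝ}

/-- The leading term of the drift of step `t`. -/
def driftModel (F : Fin n → E → E) (A : Fin n → E → E →L[ℝ] E) (θ : E) (t : ℕ) : E :=
  ∑ v ∈ Finset.range t, fieldCorr F A θ (stepDeriv A θ ^ v)

/-- The leading term of the bias of SGD without replacement. -/
def biasModel (F : Fin n → E → E) (A : Fin n → E → E →L[ℝ] E) (θ : E) : ℕ → E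
  | 0 => 0
  | t + 1 => stepDeriv A θ (biasModel F A θ t) - driftModel F A θ t

/-- Variation of constants for the linear recursion. -/
theorem biasModel_eq (F : Fin n → E → E) (A : Fin n → E → E →L[ℝ] E) (θ : E) (t : ℕ) :
    biasModel F A θ t
      = -∑ i ∈ Finset.range t, (stepDeriv A θ ^ (t - 1 - i)) (driftModel F A θ i) := by
  induction t with
  | zero => simp [biasModel]
  | succ t ih =>
    rw [biasModel, ih, Finset.sum_range_succ, map_neg, map_sum, neg_add, sub_eq_add_neg]
    congr 1
    · congr 1
      refine Finset.sum_congr rfl fun i hi => ?_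
      have hi := Finset.mem_range.1 hi
      rw [show t + 1 - 1 - i = (t - 1 - i) + 1 by omega, pow_succ']
      rfl
    · simp

variable [NeZero n]

theorem norm_driftModel_le (hn2 : 2 ≤ n) (hS : Scale k γ μ K)
    (hF : ∀ z, SmoothField (F z) (A z) θ (K * (k * γ)) γ μ) {t : ℕ} (ht : t ≤ k) :
    ‖driftModel F A θ t‖ ≤ 4 * K * μ * (k * γ) / n := by
  have hμ := hS.mu_nonneg
  have hγ := hS.gamma_nonneg
  have hK := hS.one_le
  have hn2' : (2 : ℝ) ≤ n := by exact_mod_cast hn2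
  have h1 : ∀ v ∈ Finset.range t,
      ‖fieldCorr F A θ (stepDeriv A θ ^ v)‖ ≤ 4 * K * μ * γ / n := by
    intro v hv
    have hT := norm_pow_stepDeriv_le hS hF ((Finset.mem_range.1 hv).le.trans ht)
    have h2 : ‖mean fun z => derivDev A θ z ((stepDeriv A θ ^ v) (F z θ))‖ ≤ 2 * μ * (K * γ) := by
      refine norm_mean_le fun z => ?_
      refine (ContinuousLinearMap.le_of_opNorm_le _ (norm_derivDev_le hF hS.base_mem z) _).trans ?_
      have h3 := ContinuousLinearMap.le_of_opNorm_le _ hT (F z θ)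
      have h4 := (hF z).base
      gcongr
      exact h3.trans (by gcongr)
    rw [fieldCorr, norm_smul, norm_inv, Real.norm_of_nonneg (by linarith),
      inv_mul_le_iff₀ (by linarith), mul_div_assoc', le_div_iff₀ (by linarith)]
    have h5 : 0 ≤ 2 * μ * (K * γ) := by positivity
    nlinarith
  refine (norm_sum_le_of_le _ h1).trans ?_
  rw [Finset.sum_const, Finset.card_range, nsmul_eq_mul]
  calc t * (4 * K * μ * γ / n) ≤ k * (4 * K * μ * γ / n) := by gcongr
    _ = _ := by ring

theorem norm_stepDeriv_le (hS : Scale k γ μ K)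
    (hF : ∀ z, SmoothField (F z) (A z) θ (K * (k * γ)) γ μ) (x : E) :
    ‖stepDeriv A θ x‖ ≤ (1 + μ) * ‖x‖ := by
  have h1 := (SmoothField.mean hF).norm_le θ hS.base_mem
  have h2 := ContinuousLinearMap.le_of_opNorm_le _ h1 x
  rw [stepDeriv, _root_.sub_apply, one_apply_eq_self]
  have h3 := norm_sub_le x ((mean fun z => A z θ) x)
  linarith

theorem norm_biasModel_le (hn2 : 2 ≤ n) (hS : Scale k γ μ K)
    (hF : ∀ z, SmoothField (F z) (A z) θ (K * (k * γ)) γ μ) {t : ℕ} (ht : t ≤ k) :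
    ‖biasModel F A θ t‖ ≤ 4 * K ^ 2 * (k * μ) * (k * γ) / n := by
  have hμ := hS.mu_nonneg
  have hγ := hS.gamma_nonneg
  have hK := hS.one_le
  have h := gronwall hS (a := fun t => ‖biasModel F A θ t‖)
    (v := fun _ => 4 * K * μ * (k * γ) / n) (by simp [biasModel])
    (fun t _ => by positivity) (fun t ht => ?_) ht
  · refine h.trans ?_
    rw [Finset.sum_const, Finset.card_range, nsmul_eq_mul]
    calc K * (t * (4 * K * μ * (k * γ) / n)) ≤ K * (k * (4 * K * μ * (k * γ) / n)) := by gcongr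
      _ = _ := by ring
  · have h1 := norm_driftModel_le hn2 hS hF ht.le
    have h2 := norm_stepDeriv_le hS hF (biasModel F A θ t)
    exact (norm_sub_le _ _).trans (add_le_add h2 h1)

variable [NeZero k] [NeZero b]

/-- Combines the passage to affine runs with the unrolled correlation for `W = 1`; the sum of the
powers of `stepDeriv` is at most `kK`. -/
theorem norm_drift_sub_driftModel_le (hn : n = k * b) (hn2 : 2 ≤ n) (hS : Scale k γ μ K)
    (hF : ∀ z, SmoothField (F z) (A z) θ (K * (k * γ)) γ μ) {ν : ℝ} (hν0 : 0 ≤ ν)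
    (hν : ∀ (W : E →L[ℝ] E) (x : E), ‖mean fun z => derivDev A θ z (W (derivDev A θ z x))‖
      ≤ ν * ‖W‖ * ‖x‖) (hνμ : ν ≤ 4 * μ ^ 2) {t : ℕ} (ht : t < k) :
    ‖drift F A θ (fun (σ : Fin k × Fin b ≃ Fin n) p => σ p) t - driftModel F A θ t‖
      ≤ 40 * K ^ 8 * μ * (k * γ) ^ 2 / n
        + (2 * K * ν * k * ‖mean fun z => F z θ‖ / n
          + 384 * K ^ 5 * μ ^ 2 * (k * γ) / n ^ 2) * (k * K) := by
  have hμ := hS.mu_nonneg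
  have hγ := hS.gamma_nonneg
  have hK := hS.one_le
  have h1 := norm_drift_sub_le hn hS hF ht
  have h2 : ‖(mean fun σ : Fin k × Fin b ≃ Fin n =>
      batchMean (fun z => derivDev A θ z (linRun F A θ σ t - θ)) σ t) - driftModel F A θ t‖
      ≤ (2 * K * ν * k * ‖mean fun z => F z θ‖ / n
          + 384 * K ^ 5 * μ ^ 2 * (k * γ) / n ^ 2) * (k * K) := by
    simp only [batchMean]
    rw [mean_comm, ← mean_const (α := Fin b) (driftModel F A θ t), ← mean_sub]
    refine norm_mean_le fun j => ?_
    have h3 := norm_mean_derivDev_linRun_sub_le hn hn2 hS hF hν0 hν hνμ ht j le_rfl 1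
    simp only [one_mul, one_apply_eq_self] at h3
    refine h3.trans ?_
    gcongr
    refine (Finset.sum_le_sum fun v hv => norm_pow_stepDeriv_le hS hF
      ((Finset.mem_range.1 hv).le.trans ht.le)).trans ?_
    rw [Finset.sum_const, Finset.card_range, nsmul_eq_mul]
    gcongr
  refine le_trans ?_ (add_le_add h1 h2)
  refine le_of_eq_of_le (congrArg _ ?_) (norm_add_le _ _)
  abel

/-- The bias of SGD without replacement relative to gradient descent. -/
theorem norm_mean_run_sub_gd_sub_biasModel_le (hn : n = k * b) (hn2 : 2 ≤ n)
    (hS : Scale k γ μ K)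
    (hF : ∀ z, SmoothField (F z) (A z) θ (K * (k * γ)) γ μ) {ν : ℝ} (hν0 : 0 ≤ ν)
    (hν : ∀ (W : E →L[ℝ] E) (x : E), ‖mean fun z => derivDev A θ z (W (derivDev A θ z x))‖
      ≤ ν * ‖W‖ * ‖x‖) (hνμ : ν ≤ 4 * μ ^ 2) :
    ‖mean (fun σ : Fin k × Fin b ≃ Fin n => run F θ σ k) - gd F θ k - biasModel F A θ k‖
      ≤ 236 * K ^ 9 * (k * μ) * (k * γ) ^ 2 / n + 384 * K ^ 8 * (k * μ) * (k * γ) / n ^ 2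
        + 2 * K ^ 3 * k ^ 3 * ν * ‖mean fun z => F z θ‖ / n := by
  have hμ := hS.mu_nonneg
  have hγ := hS.gamma_nonneg
  have hK := hS.one_le
  have hP : Fintype.card (Fin k × Fin b) = n := by simp [hn]
  have : Nonempty (Fin k × Fin b ≃ Fin n) := ⟨Fintype.equivFinOfCardEq hP⟩
  set R := 2 * K * ν * k * ‖mean fun z => F z θ‖ / n
    + 384 * K ^ 5 * μ ^ 2 * (k * γ) / n ^ 2 with hR
  have h := gronwall hS (a := fun t => ‖mean (fun σ : Fin k × Fin b ≃ Fin n => run F θ σ t)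
      - gd F θ t - biasModel F A θ t‖)
    (v := fun _ => μ * (192 * K ^ 8 * (k * γ) ^ 2 / n)
      + (40 * K ^ 8 * μ * (k * γ) ^ 2 / n + R * (k * K))
      + (μ * (K * (k * γ))) * (4 * K ^ 2 * K * (k * γ) / n))
    (by simp [run, gd, traj, biasModel, mean_const]) (fun t _ => by positivity)
    (fun t ht => ?_) le_rfl
  · refine h.trans ?_
    rw [Finset.sum_const, Finset.card_range, nsmul_eq_mul]
    calc _ = (232 * K ^ 9 + 4 * K ^ 5) * ((k * μ) * (k * γ) ^ 2 / n)
          + 384 * K ^ 7 * (k * μ) * ((k * μ) * (k * γ) / n ^ 2)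
          + 2 * K ^ 3 * k ^ 3 * ν * ‖mean fun z => F z θ‖ / n := by
          rw [hR]
          ring
      _ ≤ (232 * K ^ 9 + 4 * K ^ 9) * ((k * μ) * (k * γ) ^ 2 / n)
          + 384 * K ^ 7 * K * ((k * μ) * (k * γ) / n ^ 2)
          + 2 * K ^ 3 * k ^ 3 * ν * ‖mean fun z => F z θ‖ / n := by
          gcongr
          · norm_num
          · exact hS.mul_le
      _ = _ := by ring
  · have h1 := mean_run_succ (Sampling.equiv (E := E) hn2 hP) hn hS hF ht
    have h2 := norm_drift_sub_driftModel_le hn hn2 hS hF hν0 hν hνμ ht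
    have hx := gd_mem hS hF ht.le
    have h3 := (SmoothField.mean hF).norm_le _ hx
    have h4 := (SmoothField.mean hF).lip_deriv _ hx θ hS.base_mem
    have h5 : ‖biasModel F A θ t‖ ≤ 4 * K ^ 2 * K * (k * γ) / n := by
      refine (norm_biasModel_le hn2 hS hF ht.le).trans ?_
      have := hS.mul_le
      gcongr
    have h6 : ‖gd F θ t - θ‖ ≤ K * (k * γ) := mem_closedBall_iff_norm.1 hx
    simp only [biasModel, stepDeriv, _root_.sub_apply, one_apply_eq_self]
    set e := mean (fun σ : Fin k × Fin b ≃ Fin n => run F θ σ t) - gd F θ t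
    set e' := mean (fun σ : Fin k × Fin b ≃ Fin n => run F θ σ (t + 1)) - gd F θ (t + 1)
    set B := mean fun z => A z (gd F θ t)
    set B₀ := mean fun z => A z θ
    set w := driftModel F A θ t
    set y := biasModel F A θ t
    set D := drift F A θ (fun (σ : Fin k × Fin b ≃ Fin n) p => σ p) t
    have i1 : ‖(e - y) - B (e - y)‖ ≤ (1 + μ) * ‖e - y‖ := by
      have j1 := norm_sub_le (e - y) (B (e - y))
      have j2 := ContinuousLinearMap.le_of_opNorm_le _ h3 (e - y)
      linarith
    -- The model uses the derivative at `θ` instead of the one at the gradient descent iterate;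
    -- acting on the bias, of size `1/n`, the difference is of higher order.
    have i2 : ‖(B - B₀) y‖ ≤ (μ * (K * (k * γ))) * (4 * K ^ 2 * K * (k * γ) / n) := by
      refine (ContinuousLinearMap.le_of_opNorm_le _ h4 y).trans ?_
      gcongr
    have i3 : e' - (y - B₀ y - w)
        = ((e' - (e - B e - D)) + ((e - y) - B (e - y))) - ((D - w) + (B - B₀) y) := by
      simp only [map_sub, _root_.sub_apply]
      abel
    rw [i3]
    refine (norm_sub_le _ _).trans ?_
    refine (add_le_add (norm_add_le _ _) (norm_add_le _ _)).trans ?_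
    linarith

end Bias

/-! ### Double geometric sums and binomial coefficients. -/

section Combinatorics

/-- Both sides expand `((1 + y)^k - 1) / y`; induction with Pascal's rule avoids the division.
Summands with `m ≥ k` vanish, so any `N ≥ k` is allowed. -/
theorem sum_pow_mul_choose_succ (y : ℝ) {k N : ℕ} (hk : k ≤ N) :
    ∑ m ∈ Finset.range N, y ^ m * (k.choose (m + 1) : ℝ)
      = ∑ v ∈ Finset.range k, (1 + y) ^ v := by
  induction k with
  | zero => simp
  | succ k ih =>
    rw [Finset.sum_range_succ, ← ih (by omega)]
    have h1 : (1 + y) ^ k = ∑ m ∈ Finset.range N, y ^ m * (k.choose m : ℝ) := by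
      rw [add_comm, add_pow]
      simp only [one_pow, mul_one]
      refine Finset.sum_subset (Finset.range_subset_range.2 hk) fun m _ hm => ?_
      rw [Nat.choose_eq_zero_of_lt (by simpa using hm), Nat.cast_zero, mul_zero]
    rw [h1, ← Finset.sum_add_distrib]
    refine Finset.sum_congr rfl fun m _ => ?_
    rw [Nat.choose_succ_succ]
    push_cast
    ring

/-- Both sides satisfy `G (k+1) = (1 + a) * G k + ∑ v < k, (1 + y)^v`: on the left by splitting off
the last `t`, on the right by Pascal's rule. -/
theorem sum_pow_mul_pow_mul_choose (a y : ℝ) {k N : ℕ} (hk : k ≤ N) :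
    ∑ t ∈ Finset.range k, ∑ v ∈ Finset.range t, (1 + a) ^ (k - 1 - t) * (1 + y) ^ v
      = ∑ h ∈ Finset.range N, ∑ m ∈ Finset.range N,
          a ^ h * (y ^ m * (k.choose (h + m + 2) : ℝ)) := by
  induction k with
  | zero => simp
  | succ k ih =>
    obtain ⟨N, rfl⟩ : ∃ N', N = N' + 1 := ⟨N - 1, by omega⟩
    have ih := ih (by omega)
    have h1 : ∑ t ∈ Finset.range (k + 1), ∑ v ∈ Finset.range t,
        (1 + a) ^ (k + 1 - 1 - t) * (1 + y) ^ v
        = (1 + a) * (∑ t ∈ Finset.range k, ∑ v ∈ Finset.range t,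
          (1 + a) ^ (k - 1 - t) * (1 + y) ^ v) + ∑ v ∈ Finset.range k, (1 + y) ^ v := by
      rw [Finset.sum_range_succ, Finset.mul_sum]
      congr 1
      · refine Finset.sum_congr rfl fun t ht => ?_
        have ht := Finset.mem_range.1 ht
        rw [Finset.mul_sum]
        refine Finset.sum_congr rfl fun v _ => ?_
        rw [show k + 1 - 1 - t = (k - 1 - t) + 1 by omega, pow_succ]
        ring
      · simp
    have h2 : ∑ h ∈ Finset.range (N + 1), ∑ m ∈ Finset.range (N + 1),
          a ^ h * (y ^ m * ((k + 1).choose (h + m + 2) : ℝ))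
        = (∑ h ∈ Finset.range (N + 1), ∑ m ∈ Finset.range (N + 1),
            a ^ h * (y ^ m * (k.choose (h + m + 1) : ℝ)))
          + ∑ h ∈ Finset.range (N + 1), ∑ m ∈ Finset.range (N + 1),
            a ^ h * (y ^ m * (k.choose (h + m + 2) : ℝ)) := by
      simp only [← Finset.sum_add_distrib]
      refine Finset.sum_congr rfl fun h _ => Finset.sum_congr rfl fun m _ => ?_
      rw [Nat.choose_succ_succ]
      push_cast
      ring
    have h3 : ∑ h ∈ Finset.range (N + 1), ∑ m ∈ Finset.range (N + 1),
            a ^ h * (y ^ m * (k.choose (h + m + 1) : ℝ))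
        = a * (∑ h ∈ Finset.range (N + 1), ∑ m ∈ Finset.range (N + 1),
            a ^ h * (y ^ m * (k.choose (h + m + 2) : ℝ)))
          + ∑ v ∈ Finset.range k, (1 + y) ^ v := by
      rw [Finset.sum_range_succ', Finset.sum_range_succ (fun h => ∑ m ∈ Finset.range (N + 1),
        a ^ h * (y ^ m * (k.choose (h + m + 2) : ℝ))) N, mul_add, Finset.mul_sum]
      -- The top row vanishes because `N + m + 2 > k`; this makes the index shift in `h` exact.
      have h4 : ∑ m ∈ Finset.range (N + 1), a ^ N * (y ^ m * (k.choose (N + m + 2) : ℝ)) = 0 :=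
        Finset.sum_eq_zero fun m _ => by
          rw [Nat.choose_eq_zero_of_lt (by omega), Nat.cast_zero, mul_zero, mul_zero]
      rw [h4, mul_zero, add_zero]
      congr 1
      · refine Finset.sum_congr rfl fun h _ => ?_
        rw [Finset.mul_sum]
        refine Finset.sum_congr rfl fun m _ => ?_
        rw [show h + 1 + m + 1 = h + m + 2 by ring]
        ring
      · rw [← sum_pow_mul_choose_succ y (N := N + 1) (by omega)]
        refine Finset.sum_congr rfl fun m _ => ?_
        rw [zero_add, pow_zero, one_mul]
    rw [h1, h2, h3, ih]
    ring

/-- Substitute `l = h + m + 2`. The generous range of `h` is harmless, as binomial coefficients with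
`l > k` vanish. -/
theorem weight_sum_eq (a y : ℝ) (k : ℕ) :
    ∑ h ∈ Finset.range (k + 3), a ^ h *
        ∑ l ∈ Finset.Icc (h + 2) k, (k.choose l : ℝ) * y ^ (l - h - 2)
      = ∑ t ∈ Finset.range k, ∑ v ∈ Finset.range t, (1 + a) ^ (k - 1 - t) * (1 + y) ^ v := by
  rw [sum_pow_mul_pow_mul_choose a y (N := k + 3) (by omega)]
  refine Finset.sum_congr rfl fun h _ => ?_
  rw [← Finset.mul_sum]
  congr 1
  rw [← Finset.Ico_add_one_right_eq_Icc, Finset.sum_Ico_eq_sum_range]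
  rw [Finset.sum_subset (s₂ := Finset.range (k + 3))
    (Finset.range_subset_range.2 (by omega)) fun m _ hm => ?_]
  · refine Finset.sum_congr rfl fun m _ => ?_
    rw [show h + 2 + m - h - 2 = m by omega, show h + 2 + m = h + m + 2 by ring, mul_comm]
  · have hm : k + 1 - (h + 2) ≤ m := by simpa using hm
    rw [Nat.choose_eq_zero_of_lt (by omega), Nat.cast_zero, zero_mul]

end Combinatorics

/-! ### Averages of symmetric operators. -/

section Symmetric

variable {E : Type*} [NormedAddCommGroup E] [InnerProductSpace ℝ E] {n : ℕ}

/-- Pair the average `v` with itself, move one `Z z` to the other side, and apply Cauchy–Schwarz to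
`𝔼 ‖Z x‖ ‖Z v‖`, using `𝔼 ‖Z y‖² = ⟨y, (𝔼 Z²) y⟩`. This bounds the bilinear terms by the norm of the
Hessian variance rather than by a crude `μ²`. -/
theorem norm_mean_sandwich_le (Z : Fin n → E →L[ℝ] E)
    (hZ : ∀ z x y, (inner ℝ (Z z x) y : ℝ) = inner ℝ x (Z z y)) (W : E →L[ℝ] E) (x : E) :
    ‖mean fun z => Z z (W (Z z x))‖ ≤ ‖mean fun z => (Z z).comp (Z z)‖ * ‖W‖ * ‖x‖ := by
  set ν := ‖mean fun z => (Z z).comp (Z z)‖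
  have hsq : ∀ y, mean (fun z => ‖Z z y‖ ^ 2) ≤ ν * ‖y‖ ^ 2 := by
    intro y
    have h1 : mean (fun z => ‖Z z y‖ ^ 2)
        = inner ℝ y ((mean fun z => (Z z).comp (Z z)) y) := by
      have h := map_mean (innerₛₗ ℝ y) (fun z => Z z (Z z y))
      rw [mean_apply]
      simp only [innerₛₗ_apply_apply] at h
      refine Eq.trans ?_ h.symm
      congr 1
      ext z
      rw [← hZ, real_inner_self_eq_norm_sq]
    rw [h1]
    refine (real_inner_le_norm _ _).trans ?_
    have := ContinuousLinearMap.le_opNorm (mean fun z => (Z z).comp (Z z)) y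
    nlinarith [norm_nonneg y]
  set v := mean fun z => Z z (W (Z z x)) with hv
  have h1 : ‖v‖ ^ 2 ≤ ‖W‖ * mean fun z => ‖Z z x‖ * ‖Z z v‖ := by
    rw [← real_inner_self_eq_norm_sq]
    have h := map_mean (innerₛₗ ℝ v) (fun z => Z z (W (Z z x)))
    rw [← hv] at h
    simp only [innerₛₗ_apply_apply] at h
    rw [h, ← mean_mul_left]
    refine mean_mono fun z => ?_
    rw [← hZ]
    refine (real_inner_le_norm _ _).trans ?_
    have := W.le_opNorm (Z z x)
    nlinarith [norm_nonneg (Z z v)]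
  have h2 : (mean fun z => ‖Z z x‖ * ‖Z z v‖) ^ 2 ≤ (ν * ‖x‖ * ‖v‖) ^ 2 := by
    have h3 : (mean fun z => ‖Z z x‖ * ‖Z z v‖) ^ 2
        ≤ (mean fun z => ‖Z z x‖ ^ 2) * mean fun z => ‖Z z v‖ ^ 2 := by
      simp only [mean, smul_eq_mul]
      have := Finset.sum_mul_sq_le_sq_mul_sq Finset.univ (fun z => ‖Z z x‖) (fun z => ‖Z z v‖)
      calc _ = ((Fintype.card (Fin n) : ℝ)⁻¹) ^ 2 * (∑ z, ‖Z z x‖ * ‖Z z v‖) ^ 2 := by ring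
        _ ≤ ((Fintype.card (Fin n) : ℝ)⁻¹) ^ 2
            * ((∑ z, ‖Z z x‖ ^ 2) * ∑ z, ‖Z z v‖ ^ 2) := by gcongr
        _ = _ := by ring
    have h4 : 0 ≤ mean fun z => ‖Z z v‖ ^ 2 := by
      simp only [mean, smul_eq_mul]
      positivity
    calc _ ≤ (ν * ‖x‖ ^ 2) * (ν * ‖v‖ ^ 2) :=
          h3.trans (mul_le_mul (hsq x) (hsq v) h4 (by positivity))
      _ = _ := by ring
  have h5 : (mean fun z => ‖Z z x‖ * ‖Z z v‖) ≤ ν * ‖x‖ * ‖v‖ :=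
    abs_le_of_sq_le_sq' h2 (by positivity) |>.2
  rcases (norm_nonneg v).eq_or_lt with h0 | h0
  · rw [← h0]
    positivity
  · have h6 : ‖v‖ * ‖v‖ ≤ (ν * ‖W‖ * ‖x‖) * ‖v‖ := by
      have : ‖W‖ * (mean fun z => ‖Z z x‖ * ‖Z z v‖) ≤ ‖W‖ * (ν * ‖x‖ * ‖v‖) := by gcongr
      nlinarith
    exact le_of_mul_le_mul_right h6 h0

theorem mean_sub_mean_comp [NeZero n] (A : Fin n → E →L[ℝ] E) :
    (mean fun z => (A z - mean A).comp (A z - mean A))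
      = (mean fun z => (A z).comp (A z)) - (mean A).comp (mean A) := by
  have e : ∀ z, (A z - mean A).comp (A z - mean A)
      = (A z).comp (A z) - (A z).comp (mean A) - ((mean A).comp (A z) - (mean A).comp (mean A)) := by
    intro z
    ext x
    simp only [ContinuousLinearMap.comp_apply, _root_.sub_apply, map_sub]
    abel
  have h1 : (mean fun z => (A z).comp (mean A)) = (mean A).comp (mean A) := by
    ext x
    rw [mean_apply, ContinuousLinearMap.comp_apply, mean_apply A]
    rfl
  have h2 : (mean fun z => (mean A).comp (A z)) = (mean A).comp (mean A) := by
    ext x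
    rw [mean_apply, ContinuousLinearMap.comp_apply, mean_apply A x, clm_mean]
    rfl
  simp only [e]
  rw [mean_sub, mean_sub, mean_sub, mean_const, h1, h2, sub_self, sub_zero]

end Symmetric

/-! ### Gradients and Hessians of losses. -/

section Calculus

variable {d n : ℕ}

theorem hasFDerivAt_gradient {f : Param d → ℝ} {x : Param d} (hf : ContDiffAt ℝ 2 f x) :
    HasFDerivAt (fun y => ∇ f y) (hess f x) x := by
  have h1 : DifferentiableAt ℝ (fderiv ℝ f) x :=
    (hf.fderiv_right (m := 1) (by norm_num)).differentiableAt (by norm_num)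
  exact ((InnerProductSpace.toDual ℝ (Param d)).symm.toContinuousLinearEquiv
    |>.differentiableAt.comp x h1).hasFDerivAt

theorem inner_hess {f : Param d → ℝ} {x : Param d} (hf : ContDiffAt ℝ 2 f x) (u v : Param d) :
    (inner ℝ (hess f x u) v : ℝ) = fderiv ℝ (fderiv ℝ f) x u v := by
  have h1 : DifferentiableAt ℝ (fderiv ℝ f) x :=
    (hf.fderiv_right (m := 1) (by norm_num)).differentiableAt (by norm_num)
  have h2 := ((InnerProductSpace.toDual ℝ (Param d)).symm.toContinuousLinearEquiv
    |>.hasFDerivAt.comp x h1.hasFDerivAt)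
  have h3 := (hasFDerivAt_gradient hf).unique h2
  rw [h3]
  exact InnerProductSpace.toDual_symm_apply

theorem hess_symmetric {f : Param d → ℝ} {x : Param d} (hf : ContDiffAt ℝ 2 f x)
    (u v : Param d) : (inner ℝ (hess f x u) v : ℝ) = inner ℝ u (hess f x v) := by
  rw [inner_hess hf, real_inner_comm, inner_hess hf]
  exact hf.isSymmSndFDerivAt (by simp) u v

theorem gradient_lossOn {ℓ : Fin n → Param d → ℝ} {α : Type} [Fintype α] (B : α → Fin n)
    {x : Param d} (h : ∀ z, DifferentiableAt ℝ (ℓ z) x) :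
    ∇ (lossOn ℓ B) x = mean fun a => ∇ (ℓ (B a)) x := by
  have h1 : fderiv ℝ (lossOn ℓ B) x = mean fun a => fderiv ℝ (ℓ (B a)) x := by
    have h2 : HasFDerivAt (fun y => ∑ a, ℓ (B a) y) (∑ a, fderiv ℝ (ℓ (B a)) x) x :=
      HasFDerivAt.fun_sum fun a _ => (h (B a)).hasFDerivAt
    exact (h2.const_smul (Fintype.card α : ℝ)⁻¹).fderiv
  simp only [gradient, h1]
  exact map_mean (InnerProductSpace.toDual ℝ (Param d)).symm.toLinearEquiv.toLinearMap _

end Calculus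

/-! ### From losses to vector fields, and the bias in the eigenbasis. -/

section Losses

variable {d n k b : ℕ} {ℓ : Fin n → Param d → ℝ} {θ : Param d} {η r G M : ℝ}

/-- The ball is convex, so the Lipschitz and Taylor bounds follow from the mean value inequality,
the latter applied on the segment from `y` to `x`. -/
theorem smoothField_loss {f : Param d → ℝ} {ρ : ℝ} (hη : 0 < η) (hρ : ρ < r)
    (hf : ContDiffOn ℝ 2 f (Metric.ball θ r))
    (hM : ∀ ϑ ∈ Metric.ball θ r, ‖hess f ϑ‖ ≤ M)
    (hL : ∀ ϑ ∈ Metric.ball θ r, ∀ ϑ' ∈ Metric.ball θ r,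
      ‖hess f ϑ - hess f ϑ'‖ ≤ M * ‖ϑ - ϑ'‖) (hG : ‖∇ f θ‖ ≤ G) :
    SmoothField (fun x => η • ∇ f x) (fun x => η • hess f x) θ ρ (η * G) (η * M) := by
  have hsub : Metric.closedBall θ ρ ⊆ Metric.ball θ r := Metric.closedBall_subset_ball hρ
  have hd : ∀ x ∈ Metric.ball θ r, HasFDerivAt (fun y => ∇ f y) (hess f x) x := fun x hx =>
    hasFDerivAt_gradient (hf.contDiffAt (Metric.isOpen_ball.mem_nhds hx))
  refine ⟨?_, fun x hx => ?_, fun x hx y hy => ?_, fun x hx y hy => ?_, fun x hx y hy => ?_⟩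
  · rw [norm_smul, Real.norm_of_nonneg hη.le]
    gcongr
  · rw [norm_smul, Real.norm_of_nonneg hη.le]
    have := hM x (hsub hx)
    gcongr
  · rw [← smul_sub, norm_smul, Real.norm_of_nonneg hη.le, mul_assoc]
    have := hL x (hsub hx) y (hsub hy)
    gcongr
  · rw [← smul_sub, norm_smul, Real.norm_of_nonneg hη.le, mul_assoc]
    have := (convex_ball θ r).norm_image_sub_le_of_norm_hasFDerivWithin_le
      (fun w hw => (hd w hw).hasFDerivWithinAt) hM (hsub hy) (hsub hx)
    gcongr
  · have hM0 : 0 ≤ M := (norm_nonneg _).trans (hM x (hsub hx))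
    have hseg : segment ℝ y x ⊆ Metric.ball θ r :=
      (convex_ball θ r).segment_subset (hsub hy) (hsub hx)
    have h := (convex_segment y x).norm_image_sub_le_of_norm_hasFDerivWithin_le'
      (f := fun y => ∇ f y) (f' := hess f) (φ := hess f y) (C := M * ‖x - y‖)
      (fun w hw => (hd w (hseg hw)).hasFDerivWithinAt)
      (fun w hw => (hL w (hseg hw) y (hsub hy)).trans (by
        have := norm_sub_le_of_mem_segment hw
        gcongr)) (left_mem_segment ℝ y x) (right_mem_segment ℝ y x)
    rw [_root_.smul_apply, ← smul_sub, ← smul_sub, norm_smul, Real.norm_of_nonneg hη.le,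
      mul_assoc]
    refine (mul_le_mul_of_nonneg_left h hη.le).trans_eq (by ring)

theorem hess_fullLoss (hr : 0 < r) (hℓ : ∀ z, ContDiffOn ℝ 2 (ℓ z) (Metric.ball θ r)) :
    hess (fullLoss ℓ) θ = mean fun z => hess (ℓ z) θ := by
  have hB : Metric.ball θ r ∈ nhds θ := Metric.ball_mem_nhds θ hr
  have h1 : (fun x => ∇ (fullLoss ℓ) x) =ᶠ[nhds θ] fun x => mean fun z => ∇ (ℓ z) x := by
    filter_upwards [hB] with x hx
    exact gradient_lossOn _ fun z =>
      ((hℓ z).contDiffAt (Metric.isOpen_ball.mem_nhds hx)).differentiableAt (by norm_num)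
  have h2 : HasFDerivAt (fun x => ∑ z, ∇ (ℓ z) x) (∑ z, hess (ℓ z) θ) θ :=
    HasFDerivAt.fun_sum fun z _ => hasFDerivAt_gradient ((hℓ z).contDiffAt hB)
  rw [hess, h1.fderiv_eq]
  exact (h2.const_smul (Fintype.card (Fin n) : ℝ)⁻¹).fderiv

theorem hess_fullLoss_symmetric (hr : 0 < r)
    (hℓ : ∀ z, ContDiffOn ℝ 2 (ℓ z) (Metric.ball θ r)) (u v : Param d) :
    (inner ℝ (hess (fullLoss ℓ) θ u) v : ℝ) = inner ℝ u (hess (fullLoss ℓ) θ v) := by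
  rw [hess_fullLoss hr hℓ, mean_apply, mean_apply, real_inner_comm]
  have h1 := map_mean (innerₛₗ ℝ v) fun z => hess (ℓ z) θ u
  have h2 := map_mean (innerₛₗ ℝ u) fun z => hess (ℓ z) θ v
  simp only [innerₛₗ_apply_apply] at h1 h2
  rw [h1, h2]
  congr 1
  ext z
  rw [real_inner_comm, hess_symmetric ((hℓ z).contDiffAt (Metric.ball_mem_nhds θ hr))]

theorem gradient_fullLoss {x : Param d} (hx : x ∈ Metric.ball θ r)
    (hℓ : ∀ z, ContDiffOn ℝ 2 (ℓ z) (Metric.ball θ r)) :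
    ∇ (fullLoss ℓ) x = mean fun z => ∇ (ℓ z) x :=
  gradient_lossOn _ fun z =>
    ((hℓ z).contDiffAt (Metric.isOpen_ball.mem_nhds hx)).differentiableAt (by norm_num)

theorem descend_eq_run [NeZero k] (ω : Fin k × Fin b → Fin n)
    (hℓ : ∀ z, ContDiffOn ℝ 2 (ℓ z) (Metric.ball θ r))
    (hrun : ∀ t ≤ k, run (fun z x => η • ∇ (ℓ z) x) θ ω t ∈ Metric.ball θ r) :
    descend η (fun t : Fin k => lossOn ℓ fun j : Fin b => ω (t, j)) θ
      = run (fun z x => η • ∇ (ℓ z) x) θ ω k := by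
  rw [descend, foldl_eq_traj (Φ := fun t x =>
      η • ∇ (lossOn ℓ fun j : Fin b => ω (Fin.ofNat k t, j)) x)
    (fun t x => η • ∇ (lossOn ℓ fun j : Fin b => ω (t, j)) x) (fun t => by rw [ofNat_val])]
  refine traj_congr (k := k) (fun t ht => ?_) le_rfl
  have hx := hrun t ht.le
  have hg := gradient_lossOn (fun j : Fin b => ω (Fin.ofNat k t, j)) fun z =>
    ((hℓ z).contDiffAt (Metric.isOpen_ball.mem_nhds hx)).differentiableAt (by norm_num)
  exact (congrArg (η • ·) hg).trans (mean_smul _ _).symm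

theorem descend_eq_gd (hℓ : ∀ z, ContDiffOn ℝ 2 (ℓ z) (Metric.ball θ r))
    (hrun : ∀ t ≤ k, gd (fun z x => η • ∇ (ℓ z) x) θ t ∈ Metric.ball θ r) :
    descend η (fun _ : Fin k => fullLoss ℓ) θ = gd (fun z x => η • ∇ (ℓ z) x) θ k := by
  rw [descend, foldl_eq_traj (Φ := fun _ x => η • ∇ (fullLoss ℓ) x) _ (fun _ => rfl)]
  refine traj_congr (k := k) (fun t ht => ?_) le_rfl
  exact (congrArg (η • ·) (gradient_fullLoss (hrun t ht.le) hℓ)).trans (mean_smul _ _).symm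

/-- Only diagonal entries of the covariance enter the trace, and these are averages of squares; the
factor 2 of the product rule cancels the one in `η / (2 * k)`. -/
theorem regDeriv_eq (hr : 0 < r) (hℓ : ∀ z, ContDiffOn ℝ 2 (ℓ z) (Metric.ball θ r))
    (e : OrthonormalBasis (Fin d) ℝ (Param d)) (lam : Fin d → ℝ) (i : Fin d) :
    regDeriv ℓ k η θ e lam i = ∑ j, (η / k * ∑ h ∈ Finset.range (k + 3), (-η * lam i) ^ h *
        ∑ l ∈ Finset.Icc (h + 2) k, (k.choose l : ℝ) * (-η * lam j) ^ (l - h - 2))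
      * mean fun z => (inner ℝ (e j) ((hess (ℓ z) θ - hess (fullLoss ℓ) θ) (e i)) : ℝ)
        * inner ℝ (e j) (∇ (ℓ z) θ - ∇ (fullLoss ℓ) θ) := by
  have hB : Metric.ball θ r ∈ nhds θ := Metric.ball_mem_nhds θ hr
  have hfull : ContDiffAt ℝ 2 (fullLoss ℓ) θ := by
    have : ContDiffAt ℝ 2 (fun x => ∑ z, ℓ z x) θ :=
      ContDiffAt.sum fun z _ => (hℓ z).contDiffAt hB
    exact this.const_smul (Fintype.card (Fin n) : ℝ)⁻¹
  have h1 : ∀ z, HasDerivAt (fun t : ℝ => ∇ (ℓ z) (θ + t • e i) - ∇ (fullLoss ℓ) (θ + t • e i))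
      ((hess (ℓ z) θ - hess (fullLoss ℓ) θ) (e i)) 0 := fun z =>
    ((hasFDerivAt_gradient ((hℓ z).contDiffAt hB)).sub
      (hasFDerivAt_gradient hfull)).hasLineDerivAt (e i)
  have h2 : ∀ z j, HasDerivAt (fun t : ℝ =>
      (inner ℝ (e j) (∇ (ℓ z) (θ + t • e i) - ∇ (fullLoss ℓ) (θ + t • e i)) : ℝ))
      (inner ℝ (e j) ((hess (ℓ z) θ - hess (fullLoss ℓ) θ) (e i))) 0 := fun z j =>
    (innerSL ℝ (e j)).hasFDerivAt.comp_hasDerivAt (0 : ℝ) (h1 z)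
  have h3 := HasDerivAt.fun_sum (u := Finset.univ) fun j _ =>
    ((HasDerivAt.fun_sum (u := Finset.univ) fun z _ => (h2 z j).mul (h2 z j)).const_smul
      (Fintype.card (Fin n) : ℝ)⁻¹).const_mul (weight η k lam i j j)
  have h4 : (fun t : ℝ => (weight η k lam i * gradCov ℓ e (θ + t • e i)).trace)
      = fun t : ℝ => ∑ j, weight η k lam i j j * ((Fintype.card (Fin n) : ℝ)⁻¹ •
        ∑ z, (inner ℝ (e j) (∇ (ℓ z) (θ + t • e i) - ∇ (fullLoss ℓ) (θ + t • e i)) : ℝ)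
          * inner ℝ (e j) (∇ (ℓ z) (θ + t • e i) - ∇ (fullLoss ℓ) (θ + t • e i))) := by
    funext t
    simp only [Matrix.trace, Matrix.diag, weight, Matrix.diagonal_mul, Matrix.diagonal_apply_eq]
    rfl
  rw [regDeriv, lineDeriv, h4]
  refine (HasDerivAt.deriv h3).trans (Finset.sum_congr rfl fun j _ => ?_)
  simp only [zero_smul, add_zero]
  rw [weight, Matrix.diagonal_apply_eq, mean, smul_eq_mul, smul_eq_mul]
  have h5 : ∑ z, ((inner ℝ (e j) ((hess (ℓ z) θ - hess (fullLoss ℓ) θ) (e i)) : ℝ)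
          * inner ℝ (e j) (∇ (ℓ z) θ - ∇ (fullLoss ℓ) θ)
        + inner ℝ (e j) (∇ (ℓ z) θ - ∇ (fullLoss ℓ) θ)
          * inner ℝ (e j) ((hess (ℓ z) θ - hess (fullLoss ℓ) θ) (e i)))
      = 2 * ∑ z, (inner ℝ (e j) ((hess (ℓ z) θ - hess (fullLoss ℓ) θ) (e i)) : ℝ)
          * inner ℝ (e j) (∇ (ℓ z) θ - ∇ (fullLoss ℓ) θ) := by
    rw [Finset.mul_sum]
    exact Finset.sum_congr rfl fun z _ => by ring
  rw [h5]
  rcases eq_or_ne (k : ℝ) 0 with hk | hk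
  · simp [hk]
  · field_simp

/-- The leading term of the bias, in the eigenbasis of the full-batch Hessian. -/
theorem inner_biasModel [NeZero n] (hr : 0 < r)
    (hℓ : ∀ z, ContDiffOn ℝ 2 (ℓ z) (Metric.ball θ r))
    (e : OrthonormalBasis (Fin d) ℝ (Param d)) (lam : Fin d → ℝ)
    (he : ∀ i, hess (fullLoss ℓ) θ (e i) = lam i • e i) (i : Fin d) (hk : k ≠ 0) :
    (inner ℝ (e i) (biasModel (fun z x => η • ∇ (ℓ z) x) (fun z x => η • hess (ℓ z) x) θ k) : ℝ)
      = -(η * k / (n - 1)) * regDeriv ℓ k η θ e lam i := by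
  have hB : Metric.ball θ r ∈ nhds θ := Metric.ball_mem_nhds θ hr
  have hsym : ∀ z u v, (inner ℝ (hess (ℓ z) θ u) v : ℝ) = inner ℝ u (hess (ℓ z) θ v) := fun z =>
    hess_symmetric ((hℓ z).contDiffAt hB)
  have hfull := hess_fullLoss hr hℓ
  have hsymf := hess_fullLoss_symmetric hr hℓ
  set F : Fin n → Param d → Param d := fun z x => η • ∇ (ℓ z) x with hF
  set A : Fin n → Param d → Param d →L[ℝ] Param d := fun z x => η • hess (ℓ z) x with hA
  have hmA : (mean fun z => A z θ) = η • hess (fullLoss ℓ) θ := by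
    rw [hfull, ← mean_smul]
  have hT : ∀ j x, (inner ℝ (e j) (stepDeriv A θ x) : ℝ)
      = (1 + -η * lam j) * inner ℝ (e j) x := by
    intro j x
    rw [stepDeriv, _root_.sub_apply, one_apply_eq_self, hmA, _root_.smul_apply, inner_sub_right,
      inner_smul_right, ← hsymf, he, inner_smul_left]
    simp only [RCLike.conj_to_real]
    ring
  have hTp : ∀ v j x, (inner ℝ (e j) ((stepDeriv A θ ^ v) x) : ℝ)
      = (1 + -η * lam j) ^ v * inner ℝ (e j) x := by
    intro v
    induction v with
    | zero => simp
    | succ v ih =>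
      intro j x
      rw [pow_succ', pow_succ, mul_apply_eq_comp, hT, ih]
      ring
  set c : Fin d → ℝ := fun j =>
    mean fun z => (inner ℝ (e j) ((hess (ℓ z) θ - hess (fullLoss ℓ) θ) (e i)) : ℝ)
        * inner ℝ (e j) (∇ (ℓ z) θ - ∇ (fullLoss ℓ) θ) with hc
  have hcorr : ∀ v, (inner ℝ (e i) (fieldCorr F A θ (stepDeriv A θ ^ v)) : ℝ)
      = η ^ 2 / (n - 1) * ∑ j, (1 + -η * lam j) ^ v * c j := by
    intro v
    -- Because the derivative fluctuations are centred, the gradients may be centred for free, which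
    -- makes the covariance appear.
    have h0 : (mean fun z => derivDev A θ z ((stepDeriv A θ ^ v) (η • ∇ (fullLoss ℓ) θ))) = 0 := by
      rw [← mean_apply, mean_derivDev, _root_.zero_apply]
    have h1 : (mean fun z => derivDev A θ z ((stepDeriv A θ ^ v) (F z θ)))
        = mean fun z => derivDev A θ z
          ((stepDeriv A θ ^ v) (η • (∇ (ℓ z) θ - ∇ (fullLoss ℓ) θ))) := by
      have h2 : ∀ z, derivDev A θ z ((stepDeriv A θ ^ v) (η • (∇ (ℓ z) θ - ∇ (fullLoss ℓ) θ)))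
          = derivDev A θ z ((stepDeriv A θ ^ v) (F z θ))
            - derivDev A θ z ((stepDeriv A θ ^ v) (η • ∇ (fullLoss ℓ) θ)) := by
        intro z
        rw [smul_sub, map_sub, map_sub]
      simp only [h2]
      rw [mean_sub, h0, sub_zero]
    have h2 : ∀ z, (inner ℝ (e i) (derivDev A θ z
          ((stepDeriv A θ ^ v) (η • (∇ (ℓ z) θ - ∇ (fullLoss ℓ) θ)))) : ℝ)
        = η ^ 2 * ∑ j, (1 + -η * lam j) ^ v
          * ((inner ℝ (e j) ((hess (ℓ z) θ - hess (fullLoss ℓ) θ) (e i)) : ℝ)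
            * inner ℝ (e j) (∇ (ℓ z) θ - ∇ (fullLoss ℓ) θ)) := by
      intro z
      have h3 : derivDev A θ z = η • (hess (ℓ z) θ - hess (fullLoss ℓ) θ) := by
        rw [derivDev, hmA, smul_sub]
      have h4 : ∀ y, (inner ℝ (e i) ((hess (ℓ z) θ - hess (fullLoss ℓ) θ) y) : ℝ)
          = inner ℝ ((hess (ℓ z) θ - hess (fullLoss ℓ) θ) (e i)) y := by
        intro y
        rw [_root_.sub_apply, _root_.sub_apply, inner_sub_left, inner_sub_right, hsym, hsymf]
      rw [h3, _root_.smul_apply, inner_smul_right, h4, ← e.sum_inner_mul_inner, Finset.mul_sum,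
        Finset.mul_sum]
      refine Finset.sum_congr rfl fun j _ => ?_
      rw [hTp, inner_smul_right, real_inner_comm]
      ring
    rw [fieldCorr, inner_smul_right, h1]
    have h5 := map_mean (innerₛₗ ℝ (e i)) fun z => derivDev A θ z
      ((stepDeriv A θ ^ v) (η • (∇ (ℓ z) θ - ∇ (fullLoss ℓ) θ)))
    simp only [innerₛₗ_apply_apply] at h5
    rw [h5]
    simp only [h2]
    rw [mean_mul_left, mean_sum]
    simp only [mean_mul_left]
    rw [div_eq_inv_mul, mul_assoc]
  rw [biasModel_eq, inner_neg_right, inner_sum]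
  simp only [hTp, driftModel, inner_sum, hcorr]
  rw [regDeriv_eq hr hℓ]
  simp only [weight_sum_eq]
  have hk' : (k : ℝ) ≠ 0 := by exact_mod_cast hk
  rw [neg_mul (η * k / (n - 1)), neg_inj, Finset.mul_sum]
  simp only [Finset.mul_sum, Finset.sum_mul]
  have hcomm : ∀ f : ℕ → ℕ → Fin d → ℝ,
      ∑ t ∈ Finset.range k, ∑ v ∈ Finset.range t, ∑ j, f t v j
      = ∑ j, ∑ t ∈ Finset.range k, ∑ v ∈ Finset.range t, f t v j := by
    intro f
    rw [Finset.sum_comm]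
    exact Finset.sum_congr rfl fun t _ => Finset.sum_comm
  rw [hcomm]
  refine Finset.sum_congr rfl fun j _ => Finset.sum_congr rfl fun t _ =>
    Finset.sum_congr rfl fun v _ => ?_
  simp only [hc]
  field_simp

end Losses

/-- The multiplicative form follows from the additive one by inserting `s ≤ κ |y|`. -/
theorem approxEq_of_le {C ε s h x y : ℝ} (hC : 0 ≤ C) (hε : 0 ≤ ε)
    (hxy : |x - y| ≤ C * (ε * s + h)) : ApproxEq C ε s h x y := by
  refine ⟨hxy, fun κ hκ => hxy.trans ?_⟩
  have h1 : ε * s ≤ κ * ε * |y| := by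
    calc ε * s ≤ ε * (κ * |y|) := by gcongr
      _ = _ := by ring
  gcongr

/-! ### Comparison with the reference algorithms. -/

section Comparison

variable {d n k b : ℕ} {ℓ : Fin n → Param d → ℝ} {θ : Param d} {η r G M K : ℝ}

theorem norm_expected_sub_gd_le [NeZero n] [NeZero k] [NeZero b] (hn : n = k * b) (hn2 : 2 ≤ n)
    (hS : Scale k (η * G) (η * M) K) (hρ : K * (k * (η * G)) < r)
    (hℓ : ∀ z, ContDiffOn ℝ 2 (ℓ z) (Metric.ball θ r))
    (hF : ∀ z, SmoothField (fun x => η • ∇ (ℓ z) x) (fun x => η • hess (ℓ z) x) θ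
      (K * (k * (η * G))) (η * G) (η * M)) (R : Reference) :
    ‖R.expected ℓ k b η θ - gd (fun z x => η • ∇ (ℓ z) x) θ k‖
      ≤ 192 * K ^ 9 * (k * (η * M)) * (k * (η * G)) ^ 2 / n := by
  have hμ := hS.mu_nonneg
  have hK := hS.one_le
  have hsub : Metric.closedBall θ (K * (k * (η * G))) ⊆ Metric.ball θ r :=
    Metric.closedBall_subset_ball hρ
  have hrun := fun (ω : Fin k × Fin b → Fin n) =>
    descend_eq_run ω hℓ fun t ht => hsub (run_mem hS hF ω ht)
  have hb : b ≤ n := hn ▸ Nat.le_mul_of_pos_left b (Nat.pos_of_ne_zero (NeZero.ne k))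
  cases R with
  | gd =>
    rw [Reference.expected, descend_eq_gd hℓ fun t ht => hsub (gd_mem hS hF ht), sub_self,
      norm_zero]
    positivity
  | sgdDistinct =>
    have : Nonempty (Fin b ↪ Fin n) := ⟨Fin.castLEEmb hb⟩
    have hs := Sampling.embedding (E := Param d) hn2 hb
    have h := norm_mean_run_sub_gd_le (Sampling.pi (ι := Fin k) hs) hn hS hF
      fun t ht => drift_pi_eq_zero hs ht
    simp only [← hrun] at h
    exact h
  | sgdIndep =>
    have hs := Sampling.indep (E := Param d) (n := n) (b := b)
    have h := norm_mean_run_sub_gd_le (Sampling.pi (ι := Fin k) hs) hn hS hF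
      fun t ht => drift_pi_eq_zero hs ht
    simp only [← hrun] at h
    exact h

/-- The constant 428 is 236 for the bias without replacement plus 192 for the reference. The second
bound, on the main term itself, is needed to change the prefactor to `η / (b - 1)`. -/
theorem abs_inner_sub_expected_le (hk : 1 ≤ k) (hb : 2 ≤ b) (hn : n = k * b) (hη : 0 < η)
    (hr : 0 < r) (hS : Scale k (η * G) (η * M) K) (hρ : K * (k * (η * G)) < r)
    (hℓ : ∀ z, ContDiffOn ℝ 2 (ℓ z) (Metric.ball θ r))
    (hM : ∀ z, ∀ ϑ ∈ Metric.ball θ r, ‖hess (ℓ z) ϑ‖ ≤ M)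
    (hL : ∀ z, ∀ ϑ ∈ Metric.ball θ r, ∀ ϑ' ∈ Metric.ball θ r,
      ‖hess (ℓ z) ϑ - hess (ℓ z) ϑ'‖ ≤ M * ‖ϑ - ϑ'‖)
    (hG : ∀ z, ‖∇ (ℓ z) θ‖ ≤ G)
    (e : OrthonormalBasis (Fin d) ℝ (Param d)) (lam : Fin d → ℝ)
    (he : ∀ i, hess (fullLoss ℓ) θ (e i) = lam i • e i) (R : Reference) (i : Fin d) :
    |inner ℝ (e i) (sgdWithoutReplacement ℓ k b η θ - R.expected ℓ k b η θ)
        + η * k / (n - 1) * regDeriv ℓ k η θ e lam i|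
      ≤ 428 * K ^ 9 * ((η * k * G) * (η / b * (η * k * M) * G))
        + 384 * K ^ 8 * (1 / n * (η / b * (η * k * M) * G))
        + 4 * K ^ 3 * (η * k * (‖hessVar ℓ k η θ‖ * ‖∇ (fullLoss ℓ) θ‖)) ∧
    |η * k / (n - 1) * regDeriv ℓ k η θ e lam i|
      ≤ 4 * K ^ 2 * (η / b * (η * k * M) * G) := by
  have : NeZero k := ⟨by omega⟩
  have : NeZero b := ⟨by omega⟩
  have hn2 : 2 ≤ n := hn ▸ (by nlinarith)
  have : NeZero n := ⟨by omega⟩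
  have hn' : (n : ℝ) = k * b := by exact_mod_cast hn
  have hk0 : (0 : ℝ) < k := by exact_mod_cast hk
  have hb0 : (0 : ℝ) < b := by exact_mod_cast (by omega : 0 < b)
  have hF : ∀ z, SmoothField (fun x => η • ∇ (ℓ z) x) (fun x => η • hess (ℓ z) x) θ
      (K * (k * (η * G))) (η * G) (η * M) := fun z =>
    smoothField_loss hη hρ (hℓ z) (hM z) (hL z) (hG z)
  have hsub : Metric.closedBall θ (K * (k * (η * G))) ⊆ Metric.ball θ r :=
    Metric.closedBall_subset_ball hρ
  have hB : Metric.ball θ r ∈ nhds θ := Metric.ball_mem_nhds θ hr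
  have href := norm_expected_sub_gd_le hn hn2 hS hρ hℓ hF R
  have hbias := inner_biasModel hr hℓ e lam he i (k := k) (η := η) (by omega)
  have hbound := norm_biasModel_le hn2 hS hF le_rfl
  have hwo : sgdWithoutReplacement ℓ k b η θ
      = mean fun σ : Fin k × Fin b ≃ Fin n => run (fun z x => η • ∇ (ℓ z) x) θ σ k := by
    simp only [← fun ω : Fin k × Fin b → Fin n =>
      descend_eq_run ω hℓ fun t ht => hsub (run_mem hS hF ω ht)]
    rfl
  have hfull := hess_fullLoss hr hℓ
  have hgrad := gradient_fullLoss (mem_of_mem_nhds hB) hℓ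
  have hdev : ∀ z, derivDev (fun z x => η • hess (ℓ z) x) θ z
      = η • (hess (ℓ z) θ - hess (fullLoss ℓ) θ) := by
    intro z
    rw [derivDev, mean_smul, ← hfull, smul_sub]
  have hsym : ∀ z u v, (inner ℝ (hess (ℓ z) θ u) v : ℝ) = inner ℝ u (hess (ℓ z) θ v) := fun z =>
    hess_symmetric ((hℓ z).contDiffAt hB)
  have hsymf := hess_fullLoss_symmetric hr hℓ
  set F : Fin n → Param d → Param d := fun z x => η • ∇ (ℓ z) x with hFdef
  set A : Fin n → Param d → Param d →L[ℝ] Param d := fun z x => η • hess (ℓ z) x with hAdef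
  have hZsym : ∀ z x y, (inner ℝ (derivDev A θ z x) y : ℝ) = inner ℝ x (derivDev A θ z y) := by
    intro z x y
    rw [hdev, _root_.smul_apply, _root_.smul_apply, inner_smul_left, inner_smul_right,
      _root_.sub_apply, _root_.sub_apply, inner_sub_left, inner_sub_right, hsym, hsymf]
    rfl
  have hν : ‖mean fun z => (derivDev A θ z).comp (derivDev A θ z)‖ ≤ 4 * (η * M) ^ 2 := by
    refine norm_mean_le fun z => ?_
    have h1 := norm_derivDev_le hF hS.base_mem z
    have h0 : 0 ≤ 2 * (η * M) := mul_nonneg zero_le_two hS.mu_nonneg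
    calc _ ≤ ‖derivDev A θ z‖ * ‖derivDev A θ z‖ := ContinuousLinearMap.opNorm_comp_le _ _
      _ ≤ (2 * (η * M)) * (2 * (η * M)) := by gcongr
      _ = _ := by ring
  have hmain := norm_mean_run_sub_gd_sub_biasModel_le hn hn2 hS hF (norm_nonneg _)
    (norm_mean_sandwich_le (derivDev A θ) hZsym) hν
  -- With `A = η ∇²L` and `F = η ∇L` the left side carries `k³ η³ / n`, which is `2 ηk` times the
  -- prefactor `(ηk)² / (2n)` of `hessVar`.
  have hH : 2 * K ^ 3 * k ^ 3 * ‖mean fun z => (derivDev A θ z).comp (derivDev A θ z)‖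
      * ‖mean fun z => F z θ‖ / n
      = 4 * K ^ 3 * (η * k * (‖hessVar ℓ k η θ‖ * ‖∇ (fullLoss ℓ) θ‖)) := by
    have h1 : (mean fun z => (derivDev A θ z).comp (derivDev A θ z))
        = (η ^ 2) • ((mean fun z : Fin n => (hess (ℓ z) θ).comp (hess (ℓ z) θ)) -
          (hess (fullLoss ℓ) θ).comp (hess (fullLoss ℓ) θ)) := by
      rw [hfull, ← mean_sub_mean_comp, ← mean_smul, ← hfull]
      congr 1
      ext z x
      rw [hdev]
      simp only [ContinuousLinearMap.comp_apply, _root_.smul_apply, map_smul, smul_smul, pow_two]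
    have h2 : (mean fun z => F z θ) = η • ∇ (fullLoss ℓ) θ := by
      rw [hgrad, ← mean_smul]
    rw [h1, h2, hessVar, norm_smul, norm_smul, norm_smul, Real.norm_of_nonneg hη.le,
      Real.norm_of_nonneg (by positivity), Real.norm_of_nonneg (by positivity)]
    ring
  rw [hH] at hmain
  have hei : ∀ x, |(inner ℝ (e i) x : ℝ)| ≤ ‖x‖ := by
    intro x
    have := abs_real_inner_le_norm (e i) x
    rwa [e.norm_eq_one, one_mul] at this
  have h1 : (k * (η * M)) * (k * (η * G)) ^ 2 / n
      = (η * k * G) * (η / b * (η * k * M) * G) := by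
    rw [hn']
    field_simp
  have h2 : (k * (η * M)) * (k * (η * G)) / n = η / b * (η * k * M) * G := by
    rw [hn']
    field_simp
  constructor
  · have e1 : (inner ℝ (e i) (sgdWithoutReplacement ℓ k b η θ - R.expected ℓ k b η θ) : ℝ)
        + η * k / (n - 1) * regDeriv ℓ k η θ e lam i
        = inner ℝ (e i) ((sgdWithoutReplacement ℓ k b η θ - gd F θ k - biasModel F A θ k)
          - (R.expected ℓ k b η θ - gd F θ k)) := by
      have e2 : η * k / (n - 1) * regDeriv ℓ k η θ e lam i
          = -inner ℝ (e i) (biasModel F A θ k) := by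
        rw [hbias]
        ring
      rw [e2]
      simp only [inner_sub_right]
      ring
    rw [e1]
    refine (hei _).trans ((norm_sub_le _ _).trans ?_)
    rw [hwo]
    refine (add_le_add hmain href).trans_eq ?_
    rw [← h1, ← h2]
    ring
  · have h3 := (hei _).trans hbound
    rw [hbias, neg_mul, abs_neg] at h3
    refine h3.trans_eq ?_
    rw [← h2]
    ring

end Comparison

end SGDBias

end

/-! ### The theorem. -/

open SGDBias
theorem mainTheorem2 (Λ : ℝ) :
    ∃ C : ℝ, 0 < C ∧
      ∀ (d n k b : ℕ) (_ : 1 ≤ k) (_ : 2 ≤ b) (_ : n = k * b)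
        (ℓ : Fin n → Param d → ℝ) (θ : Param d) (η r G M : ℝ) (_ : 0 < η)
        -- regularity of the losses on a ball around the initialization
        (_ : ∀ z, ContDiffOn ℝ 2 (ℓ z) (Metric.ball θ r))
        (_ : ∀ z, ∀ ϑ ∈ Metric.ball θ r, ‖hess (ℓ z) ϑ‖ ≤ M)
        (_ : ∀ z, ∀ ϑ ∈ Metric.ball θ r, ∀ ϑ' ∈ Metric.ball θ r,
          ‖hess (ℓ z) ϑ - hess (ℓ z) ϑ'‖ ≤ M * ‖ϑ - ϑ'‖)
        -- size of the sample gradients at the initialization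
        (_ : ∀ z, ‖gradient (ℓ z) θ‖ ≤ G)
        (_ : η * k * M ≤ Λ)
        (_ : C * (η * k * G) < r)
        -- orthonormal eigenbasis of the full-batch Hessian
        (e : OrthonormalBasis (Fin d) ℝ (Param d)) (lam : Fin d → ℝ)
        (_ : ∀ i, hess (fullLoss ℓ) θ (e i) = lam i • e i)
        (A : Reference) (i : Fin d),
        ApproxEq C (η * k * G + 1 / n) (η / b * (η * k * M) * G)
            (η * k * (‖hessVar ℓ k η θ‖ * ‖gradient (fullLoss ℓ) θ‖))
            (inner ℝ (e i) (sgdWithoutReplacement ℓ k b η θ - A.expected ℓ k b η θ))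
            (-(η / (b - 1 / k)) * regDeriv ℓ k η θ e lam i) ∧
          ApproxEq C (η * k * G + k / n) (η / b * (η * k * M) * G)
            (η * k * (‖hessVar ℓ k η θ‖ * ‖gradient (fullLoss ℓ) θ‖))
            (inner ℝ (e i) (sgdWithoutReplacement ℓ k b η θ - A.expected ℓ k b η θ))
            (-(η / (b - 1)) * regDeriv ℓ k η θ e lam i) := by
  set K := Real.exp Λ with hK
  have hKpos : 0 < K := Real.exp_pos Λ
  -- The power 9 dominates all powers of `K` that occur, including the radius factor `K` needed to
  -- stay inside the ball; 1000 exceeds all numerical constants.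
  refine ⟨1000 * K ^ 9, by positivity, ?_⟩
  intro d n k b hk hb hn ℓ θ η r G M hη hℓ hM hL hG hΛ hr e lam he R i
  have hn0 : 0 < n := hn ▸ Nat.mul_pos (by omega) (by omega)
  have hk0 : (0 : ℝ) < k := by exact_mod_cast hk
  have hk1 : (1 : ℝ) ≤ k := by exact_mod_cast hk
  have hb2 : (2 : ℝ) ≤ b := by exact_mod_cast hb
  have hnR : (0 : ℝ) < n := by exact_mod_cast hn0
  have hn' : (n : ℝ) = k * b := by exact_mod_cast hn
  have hG0 : 0 ≤ G := (norm_nonneg _).trans (hG ⟨0, hn0⟩)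
  have hr0 : 0 < r := lt_of_le_of_lt (by positivity) hr
  have hM0 : 0 ≤ M := (norm_nonneg _).trans (hM ⟨0, hn0⟩ θ (Metric.mem_ball_self hr0))
  have hΛ0 : 0 ≤ Λ := le_trans (by positivity) hΛ
  have hK1 : 1 ≤ K := Real.one_le_exp hΛ0
  have hS : Scale k (η * G) (η * M) K := by
    refine ⟨by positivity, by positivity, hK1, ?_, ?_⟩
    · have := Real.add_one_le_exp Λ
      have e1 : (k : ℝ) * (η * M) = η * k * M := by ring
      linarith
    · have h1 : 1 + η * M ≤ Real.exp (η * M) := by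
        linarith [Real.add_one_le_exp (η * M)]
      calc (1 + η * M) ^ k ≤ Real.exp (η * M) ^ k := by gcongr
        _ = Real.exp (η * k * M) := by
          rw [← Real.exp_nat_mul]
          congr 1
          ring
        _ ≤ K := Real.exp_le_exp.2 hΛ
  have hKp : ∀ m ≤ 9, K ^ m ≤ K ^ 9 := fun m hm => pow_le_pow_right₀ hK1 hm
  have hρ : K * (k * (η * G)) < r := by
    refine lt_of_le_of_lt ?_ hr
    have h1 : K ^ 1 ≤ K ^ 9 := hKp 1 (by norm_num)
    have h2 : (k : ℝ) * (η * G) = η * k * G := by ring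
    rw [h2]
    gcongr
    rw [pow_one] at h1
    linarith
  obtain ⟨h1, h2⟩ := abs_inner_sub_expected_le hk hb hn hη hr0 hS hρ hℓ hM hL hG e lam he R i
  set s := η / b * (η * k * M) * G with hs
  have hs0 : 0 ≤ s := by positivity
  set h := η * k * (‖hessVar ℓ k η θ‖ * ‖∇ (fullLoss ℓ) θ‖) with hh
  have hh0 : 0 ≤ h := by positivity
  set x := (inner ℝ (e i) (sgdWithoutReplacement ℓ k b η θ - R.expected ℓ k b η θ) : ℝ)
  set D := regDeriv ℓ k η θ e lam i
  have hnk : (1 : ℝ) / n ≤ k / n := by gcongr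
  have hb1 : (0 : ℝ) < b - 1 := by linarith
  have hn1 : (0 : ℝ) < n - 1 := by
    rw [hn']
    nlinarith
  have hbk : (b : ℝ) - 1 / k = (n - 1) / k := by
    rw [hn']
    field_simp
  constructor
  · refine approxEq_of_le (by positivity) (by positivity) ?_
    have e1 : x - -(η / (b - 1 / k)) * D = x + η * k / (n - 1) * D := by
      rw [hbk]
      field_simp
      ring
    rw [e1]
    refine h1.trans ?_
    calc _ ≤ 428 * K ^ 9 * (η * k * G * s) + 384 * K ^ 9 * (1 / n * s) + 4 * K ^ 9 * h := by
          gcongr 428 * K ^ 9 * (η * k * G * s) + 384 * ?_ * (1 / n * s) + 4 * ?_ * h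
          · exact hKp 8 (by norm_num)
          · exact hKp 3 (by norm_num)
      _ ≤ 1000 * K ^ 9 * (η * k * G * s) + 1000 * K ^ 9 * (1 / n * s) + 1000 * K ^ 9 * h := by
          gcongr <;> norm_num
      _ = _ := by ring
  · refine approxEq_of_le (by positivity) (by positivity) ?_
    -- Since `n = kb`, the factor `η / (b - 1)` is `ηk / (n - 1)` times `1 + (k - 1) / (k (b - 1))`,
    -- and the relative correction is at most `2k/n` because `b ≥ 2`.
    have e1 : x - -(η / (b - 1)) * D
        = (x + η * k / (n - 1) * D) + (k - 1) / (k * (b - 1)) * (η * k / (n - 1) * D) := by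
      have e0 : ((k : ℝ) - 1) / (k * (b - 1)) = (n - 1) / (k * (b - 1)) - 1 := by
        rw [hn']
        field_simp
        ring
      rw [e0]
      field_simp
      ring
    have e2 : |(k - 1) / (k * (b - 1)) * (η * k / (n - 1) * D)| ≤ 2 * k / n * (4 * K ^ 2 * s) := by
      have h3 : ((k : ℝ) - 1) / (k * (b - 1)) ≤ 2 * k / n := by
        rw [hn', div_le_div_iff₀ (by positivity) (by positivity)]
        have h4 : ((k : ℝ) - 1) * b ≤ k * (2 * (b - 1)) :=
          mul_le_mul (by linarith) (by linarith) (by linarith) hk0.le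
        nlinarith
      rw [abs_mul, abs_of_nonneg (div_nonneg (by linarith) (by positivity))]
      gcongr
    rw [e1]
    refine (abs_add_le _ _).trans ((add_le_add h1 e2).trans ?_)
    calc _ ≤ 428 * K ^ 9 * (η * k * G * s) + 384 * K ^ 9 * (k / n * s) + 4 * K ^ 9 * h
          + 2 * k / n * (4 * K ^ 9 * s) := by
          gcongr 428 * K ^ 9 * (η * k * G * s) + 384 * ?_ * (?_ * s) + 4 * ?_ * h
            + 2 * k / n * (4 * ?_ * s)
          · exact hKp 8 (by norm_num)
          · exact hKp 3 (by norm_num)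
          · exact hKp 2 (by norm_num)
      _ = 428 * K ^ 9 * (η * k * G * s) + 392 * K ^ 9 * (k / n * s) + 4 * K ^ 9 * h := by ring
      _ ≤ 1000 * K ^ 9 * (η * k * G * s) + 1000 * K ^ 9 * (k / n * s) + 1000 * K ^ 9 * h := by
          gcongr <;> norm_num
      _ = _ := by ring
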